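/- Let $n\ge 1$, let $\mathbb{B}_n$ be the open unit ball of $\mathbb{C}^n$, let $V$ be Lebesgue measure, $|A|=V(A)$, and $\langle z,w\rangle=\sum_j z_j\overline{w_j}$. Let $P$ be the Bergman projection of $\mathbb{B}_n$, given by $$Pf(z)=\frac{n!}{\pi^n}\int_{\mathbb{B}_n}\frac{f(w)}{(1-\langle z,w\rangle)^{n+1}}\,dV(w),\qquad z\in\mathbb{B}_n,$$ and let $[\bar b,P]f=\bar b\,Pf-P(\bar b f)$. The Bloch space $\mathcal{B}$ consists of the holomorphic $f$ on $\mathbb{B}_n$ with $\sup_{z\in\mathbb{B}_n}|\nabla f(z)|(1-|z|)<\infty$, where $\nabla f=(\partial f/\partial z_1,\dots,\partial f/\partial z_n)$. For each $z\in\mathbb{B}_n\setminus\{0\}$ fix an orthonormal basis $e_1=z/|z|,e_2,\dots,e_n$ of $\mathbb{C}^n$ (depending on $z$), and for $\rho>0$ let $$E(z,\rho)=\Big\{w=\sum_{j=1}^n\xi_je_j\in\mathbb{C}^n:\ |\xi_1e_1-z|<\rho,\ |\xi_j|<\rho^{1/2}\ (2\le j\le n)\Big\}.$$ For $r>0$ write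 $E(z,\hat r)=E(z,2R\sigma)$, where $R=\tanh r$ and $\sigma=\frac{1-|z|^2}{1-R^2|z|^2}$; this polydisk is comparable to the Bergman metric ball of radius $r$ centered at $z$. Let $b$ be holomorphic on $\mathbb{B}_n$. The following are equivalent: 1. $b\in\mathcal{B}$. 2. There exists $C>0$ such that for all bounded measurable functions $f:\mathbb{B}_n\to\mathbb{C}$ with compact support in $\mathbb{B}_n$ and all $\lambda>0$, $$\big|\{z\in\mathbb{B}_n:|[\bar b,P]f(z)|>\lambda\}\big|\le C\int_{\mathbb{B}_n}\frac{|f(z)|}{\lambda}\Big(1+\log^+\Big(\frac{|f(z)|}{\lambda}\Big)\Big)\,dV(z).$$ 3. There exists $C>0$ such that for all measurable sets $A\subset\mathbb{B}_n$ the function $b$ is integrable on $A$ (so that $[\bar b,P]\mathbf{1}_A$ is defined), and for all $\lambda>1$, $$\big|\{z\in\mathbb{B}_n:|[\bar b,P](\mathbf{1}_A)(z)|>\lambda\}\big|\le C\,\frac{|A|}{\lambda}.$$ 4. There exist $C>0$ and $r>0$ such that for all $z\in\mathbb{B}_n\setminus\{0\}$ we have $E(z,\hat r)\subset\mathbb{B}_n$,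 and for all $\lambda>1$, $$\big|\{w\in\mathbb{B}_n:|[\bar b,P](\mathbf{1}_{E(z,\hat r)})(w)|>\lambda\}\big|\le C\,\frac{|E(z,\hat r)|}{\lambda}.$$ -/

import Mathlib

open MeasureTheory

noncomputable section

namespace BergmanBloch

/-- Complex Euclidean space `ℂⁿ`, with its Hermitian norm; `volume` on it is Lebesgue measure. -/
abbrev Cn (n : ℕ) : Type := EuclideanSpace ℂ (Fin n)

/-- The open unit ball `𝔹ₙ` of `ℂⁿ`. -/
def unitBall (n : ℕ) : Set (Cn n) := Metric.ball 0 1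

/-- The Hermitian pairing `⟨z, w⟩ = ∑ j, z j * conj (w j)`, linear in the first variable
(Mathlib's `inner` is linear in the second one). -/
def herm {n : ℕ} (z w : Cn n) : ℂ := inner ℂ w z

/-- The Bergman projection of the unit ball, as the integral operator with the Bergman kernel:
`P f (z) = (n! / πⁿ) ∫_{𝔹ₙ} f(w) / (1 - ⟨z, w⟩)ⁿ⁺¹ dV(w)`. -/
def bergmanProj {n : ℕ} (f : Cn n → ℂ) (z : Cn n) : ℂ :=
  ((n.factorial : ℂ) / (Real.pi : ℂ) ^ n) *
    ∫ w in unitBall n, f w / (1 - herm z w) ^ (n + 1)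

/-- The commutator `[a, P] f = a P f - P (a f)`. -/
def bergmanCommutator {n : ℕ} (a f : Cn n → ℂ) (z : Cn n) : ℂ :=
  a z * bergmanProj f z - bergmanProj (fun w => a w * f w) z

/-- The complex conjugate of a function. -/
def conjFun {n : ℕ} (b : Cn n → ℂ) (z : Cn n) : ℂ := star (b z)

/-- The level set `{z ∈ 𝔹ₙ : |[b̄, P] f (z)| > t}`. -/
def levelSet {n : ℕ} (b f : Cn n → ℂ) (t : ℝ) : Set (Cn n) :=
  {z | z ∈ unitBall n ∧ t < ‖bergmanCommutator (conjFun b) f z‖}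

/-- The characteristic function of a set, with complex values. -/
def charFun {n : ℕ} (A : Set (Cn n)) : Cn n → ℂ := A.indicator (fun _ => 1)

/-- Holomorphic functions on the unit ball (the values outside the ball are irrelevant). -/
def HolOnBall {n : ℕ} (b : Cn n → ℂ) : Prop := DifferentiableOn ℂ b (unitBall n)

/-- The holomorphic gradient `(∂f/∂z₁, …, ∂f/∂zₙ)`. -/
def holGrad {n : ℕ} (f : Cn n → ℂ) (z : Cn n) : Cn n :=
  WithLp.toLp 2 (fun j => fderiv ℂ f z (EuclideanSpace.single j 1))

/-- The Bloch space: `f` is holomorphic on the ball and `sup |∇f(z)| (1 - |z|) < ∞`. -/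
def blochSpace (n : ℕ) : Set (Cn n → ℂ) :=
  {f | HolOnBall f ∧ BddAbove ((fun z => ‖holGrad f z‖ * (1 - ‖z‖)) '' unitBall n)}

/-- The orthogonal projection `P_z w = ⟨w, z/|z|⟩ z/|z|` onto the complex line spanned by `z`,
for `z ≠ 0`. -/
def radialProj {n : ℕ} (z w : Cn n) : Cn n :=
  herm w (((‖z‖⁻¹ : ℝ) : ℂ) • z) • (((‖z‖⁻¹ : ℝ) : ℂ) • z)

/-- A choice, for each `z ∈ 𝔹ₙ ∖ {0}`, of an orthonormal basis of `ℂⁿ` whose first vector is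
`z/|z|`. The first vector has index `0`. -/
def IsAdaptedFrame {n : ℕ} [NeZero n]
    (e : Cn n → OrthonormalBasis (Fin n) ℂ (Cn n)) : Prop :=
  ∀ z ∈ unitBall n, z ≠ 0 → e z 0 = ((‖z‖⁻¹ : ℝ) : ℂ) • z

/-- The polydisk `E(z, ρ)`: radius `ρ` in the complex radial direction, and radius `√ρ` in the
complex tangential directions, which are the basis vectors of nonzero index. -/
def polydisk {n : ℕ} [NeZero n] (e : Cn n → OrthonormalBasis (Fin n) ℂ (Cn n))
    (z : Cn n) (ρ : ℝ) : Set (Cn n) :=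
  {w | ‖radialProj z w - z‖ < ρ ∧ ∀ j : Fin n, j ≠ 0 → ‖(e z).repr w j‖ < Real.sqrt ρ}

/-- `r̂ = 2 R σ` with `R = tanh r` and `σ = (1 - |z|²) / (1 - R² |z|²)`. -/
def hatRadius {n : ℕ} (r : ℝ) (z : Cn n) : ℝ :=
  2 * Real.tanh r * ((1 - ‖z‖ ^ 2) / (1 - Real.tanh r ^ 2 * ‖z‖ ^ 2))

/-- The `L log⁺ L` distributional inequality for `[b̄, P]`, for all (Lebesgue measurable) bounded
functions with compact support in the ball, and all `t > 0`. -/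
def LLogLInequality {n : ℕ} (b : Cn n → ℂ) : Prop :=
  ∃ C : ℝ, 0 < C ∧
    ∀ f : Cn n → ℂ, AEMeasurable f volume → (∃ M : ℝ, ∀ z, ‖f z‖ ≤ M) →
      HasCompactSupport f → tsupport f ⊆ unitBall n →
      ∀ t : ℝ, 0 < t →
        volume (levelSet b f t) ≤
          ENNReal.ofReal
            (C * ∫ z in unitBall n, ‖f z‖ / t * (1 + Real.posLog (‖f z‖ / t)))

/-- The restricted estimate, over all (Lebesgue measurable) subsets `A` of the ball and all
`t > 1`. That `[b̄, P] 1_A` is defined, i.e. that `b` is integrable on `A`, is part of it. -/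
def RestrictedInequality {n : ℕ} (b : Cn n → ℂ) : Prop :=
  ∃ C : ℝ, 0 < C ∧
    ∀ A : Set (Cn n), NullMeasurableSet A volume → A ⊆ unitBall n →
      IntegrableOn b A volume ∧
      ∀ t : ℝ, 1 < t →
        volume (levelSet b (charFun A) t) ≤ ENNReal.ofReal (C * (volume.real A / t))

/-- The restricted estimate, tested only on the polydisks `E(z, r̂)`, for one `r > 0` for which
they are subsets of the ball. -/
def PolydiskInequality {n : ℕ} [NeZero n] (e : Cn n → OrthonormalBasis (Fin n) ℂ (Cn n))
    (b : Cn n → ℂ) : Prop :=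
  ∃ C r : ℝ, 0 < C ∧ 0 < r ∧
    (∀ z ∈ unitBall n, z ≠ 0 → polydisk e z (hatRadius r z) ⊆ unitBall n) ∧
    ∀ z ∈ unitBall n, z ≠ 0 → ∀ t : ℝ, 1 < t →
      volume (levelSet b (charFun (polydisk e z (hatRadius r z))) t) ≤
        ENNReal.ofReal (C * (volume.real (polydisk e z (hatRadius r z)) / t))

end BergmanBloch

end

/-!
The implications proved are 1 ⇒ 2, 1 ⇒ 3, 2 ⇒ 4, 3 ⇒ 4 and 4 ⇒ 1. Write `D = qdist`, that is
`D(z, w) = |1 - ⟨z, w⟩|`, and `δ(z) = 1 - ‖z‖`. Then `D` is a quasi-distance on the ball with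
`δ(z) ≤ D(z, w)`, and its balls of radius `t` have volume at most a multiple of `t ^ (n + 1)`.

**From the Bloch space to the distributional inequalities.** A Bloch function satisfies
`|b(z) - b(w)| ≲ 1 + log (D / δ(z)) + log (D / δ(w))` (`HasBlochBound.norm_sub_le_qdist`), so the
commutator is dominated by the positive operator with kernel `logKernel`. Its weak type `L log L`
inequality (`exists_volume_logKernel_le`), normalized to height one, goes as follows. Put
`F = f (1 + log⁺ f)` and let `G` be the set of points at which the averages of `F` over all
quasi-balls are at most one; the complement of `G` has volume `≲ ∫ F`
(`exists_volume_diff_goodSet_le`). Let `σ(u)` be the quasi-distance from `u` to `G`. For `z ∈ G`,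
split `log (D(z, u) / δ(u)) = log (D / σ(u)) + log (σ(u) / δ(u))`. The first term is absorbed by a
small power of `D / σ(u)`. The product of the second with `f` is `≲ F + (σ / δ) ^ (3/4)` by
Young's inequality, which is used only in the layer `64 δ < σ`. Now spread the mass at each `u` over
the points at quasi-distance at most a multiple of `σ(u)` from `u` and at depth at least
`σ(u) / 64`. From `z ∈ G` one does not see the difference (`exists_lintegral_kernel_le_spread`), the
resulting density is bounded because of the definition of `G`, and its integral is `≲ ∫ F` because
the layer only contributes off `G` (`spread_qInfDist_goodSet_le`, `exists_spread_layerWeight_le`).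
So its square has integral `≲ ∫ F`, and the `L²` bound for `schurKernel` with Chebyshev's inequality
concludes.

**Testing on polydisks.** For small `r` the polydisks are relatively compact in the ball. On a
characteristic function the right side of the `L log L` inequality at height `t > 1` is `|A| / t`,
because `log⁺ (1 / t) = 0`. So each of the first two inequalities gives the one for polydisks.

**From polydisks to the Bloch space.** The polydisk `E` is balanced about `z`, so the mean value
property gives `[b̄, P] 1_E (w) = c |E| conj (b(w) - b(z)) / (1 - ⟨w, z⟩) ^ (n + 1)`, and for `w ∈ E`
the modulus is at least a multiple of `|b(w) - b(z)|`. The hypothesis becomes a weak type bound for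
`b - b(z)` on `E`, uniform in `z` after rescaling. For holomorphic functions it implies a uniform
bound on a smaller polydisk (`exists_bound_of_weak_type`), and Cauchy's estimate bounds the
gradient at `z`.
-/

open MeasureTheory

namespace BergmanBloch

variable {n : ℕ}

/-! ### The Korányi quasi-distance -/

/-- The Korányi quasi-distance `|1 - ⟨z, w⟩|`. It vanishes on the diagonal of the unit sphere only:
inside the ball `qdist z z = 1 - ‖z‖ ^ 2`, so it sees points up to their distance to the sphere. -/
noncomputable def qdist (z w : Cn n) : ℝ := ‖1 - herm z w‖

/-- The quasi-ball of `qdist` inside the unit ball. It is empty for `t ≤ 1 - ‖z‖`, and may then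
fail to contain its centre `z`. -/
def qBall (z : Cn n) (t : ℝ) : Set (Cn n) := {w | w ∈ unitBall n ∧ qdist z w < t}

lemma mem_unitBall {z : Cn n} : z ∈ unitBall n ↔ ‖z‖ < 1 := by
  simp [unitBall]

lemma isOpen_unitBall : IsOpen (unitBall n) := Metric.isOpen_ball

lemma measurableSet_unitBall : MeasurableSet (unitBall n) := isOpen_unitBall.measurableSet

lemma qdist_comm (z w : Cn n) : qdist z w = qdist w z := by
  unfold qdist herm
  rw [← inner_conj_symm, ← RCLike.norm_conj]
  simp

lemma qdist_nonneg (z w : Cn n) : 0 ≤ qdist z w := norm_nonneg _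

lemma norm_herm_le (z w : Cn n) : ‖herm z w‖ ≤ ‖z‖ * ‖w‖ := by
  unfold herm; rw [mul_comm]; exact norm_inner_le_norm _ _

lemma one_sub_norm_le_qdist {z w : Cn n} (hw : ‖w‖ ≤ 1) : 1 - ‖z‖ ≤ qdist z w := by
  have h1 := norm_herm_le z w
  have h2 : ‖(1:ℂ)‖ - ‖herm z w‖ ≤ qdist z w := norm_sub_norm_le _ _
  rw [norm_one] at h2
  nlinarith [norm_nonneg z]

lemma one_sub_norm_le_qdist' {z w : Cn n} (hz : ‖z‖ ≤ 1) : 1 - ‖w‖ ≤ qdist z w := by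
  rw [qdist_comm]; exact one_sub_norm_le_qdist hz

lemma qdist_pos {z w : Cn n} (hz : ‖z‖ < 1) (hw : ‖w‖ ≤ 1) : 0 < qdist z w :=
  lt_of_lt_of_le (by linarith) (one_sub_norm_le_qdist (z := z) hw)

lemma qdist_le_two {z w : Cn n} (hz : ‖z‖ ≤ 1) (hw : ‖w‖ ≤ 1) : qdist z w ≤ 2 := by
  have h1 := norm_herm_le z w
  have h2 : qdist z w ≤ ‖(1:ℂ)‖ + ‖herm z w‖ := norm_sub_le _ _
  rw [norm_one] at h2
  nlinarith [norm_nonneg z, norm_nonneg w]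

lemma qdist_self {z : Cn n} (hz : ‖z‖ ≤ 1) : qdist z z = 1 - ‖z‖ ^ 2 := by
  unfold qdist herm
  rw [inner_self_eq_norm_sq_to_K]
  have : (1 : ℂ) - (‖z‖ : ℂ) ^ 2 = ((1 - ‖z‖ ^ 2 : ℝ) : ℂ) := by push_cast; ring
  erw [this]
  rw [Complex.norm_real, Real.norm_of_nonneg]
  nlinarith [norm_nonneg z]

lemma qdist_self_le {z : Cn n} (hz : ‖z‖ ≤ 1) : qdist z z ≤ 2 * (1 - ‖z‖) := by
  rw [qdist_self hz]; nlinarith [norm_nonneg z]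

lemma continuous_qdist : Continuous (fun p : Cn n × Cn n => qdist p.1 p.2) := by
  unfold qdist herm
  fun_prop

lemma continuous_qdist_right (z : Cn n) : Continuous (fun w => qdist z w) := by
  unfold qdist herm
  fun_prop

lemma continuous_qdist_left (w : Cn n) : Continuous (fun z => qdist z w) := by
  unfold qdist herm
  fun_prop

lemma isOpen_qBall (z : Cn n) (t : ℝ) : IsOpen (qBall z t) :=
  isOpen_unitBall.inter (isOpen_lt (continuous_qdist_right z) continuous_const)

lemma measurableSet_qBall (z : Cn n) (t : ℝ) : MeasurableSet (qBall z t) :=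
  (isOpen_qBall z t).measurableSet

lemma qBall_subset_unitBall (z : Cn n) (t : ℝ) : qBall z t ⊆ unitBall n := fun _ h => h.1

lemma norm_one_sub_le_two_mul {x : ℂ} (hx : ‖x‖ ≤ 1) {r : ℝ} (h0 : 0 ≤ r) (h1 : r ≤ 1) :
    ‖1 - x‖ ≤ 2 * ‖1 - (r : ℂ) * x‖ := by
  have e1 : ‖1 - x‖ ≤ ‖1 - (r:ℂ) * x‖ + (1 - r) * ‖x‖ := by
    have : 1 - x = (1 - (r:ℂ) * x) - ((1 - r : ℝ) : ℂ) * x := by push_cast; ring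
    rw [this]
    refine (norm_sub_le _ _).trans ?_
    rw [norm_mul, Complex.norm_real, Real.norm_of_nonneg (by linarith)]
  have e2 : 1 - r * ‖x‖ ≤ ‖1 - (r:ℂ) * x‖ := by
    have := norm_sub_norm_le (1:ℂ) ((r:ℂ) * x)
    rwa [norm_one, norm_mul, Complex.norm_real, Real.norm_of_nonneg h0] at this
  nlinarith [norm_nonneg x]

/-- The quasi-triangle inequality through a point `e` of the unit sphere. Write
`z = x e + z'` and `w = y e + w'` with `z'`, `w'` orthogonal to `e`; then `⟨z', w'⟩` is controlled by
`‖z'‖ ‖w'‖`, and `‖z'‖ ^ 2 ≤ 1 - |x| ^ 2 ≤ 2 |1 - x|`. -/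
lemma qdist_le_of_norm_one {z w e : Cn n} (hz : ‖z‖ ≤ 1) (hw : ‖w‖ ≤ 1) (he : ‖e‖ = 1) :
    qdist z w ≤ 2 * (qdist z e + qdist e w) := by
  set x : ℂ := inner ℂ e z with hx
  set y : ℂ := inner ℂ w e with hy
  have key : ∀ v : Cn n, ‖v‖ ≤ 1 → ‖v - (inner ℂ e v : ℂ) • e‖ ^ 2 ≤ 2 * ‖1 - (inner ℂ e v : ℂ)‖ := by
    intro v hv
    have h1 : ‖v - (inner ℂ e v : ℂ) • e‖ ^ 2 = ‖v‖ ^ 2 - ‖(inner ℂ e v : ℂ)‖ ^ 2 := by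
      have hv' : v = (v - (inner ℂ e v : ℂ) • e) + (inner ℂ e v : ℂ) • e := by abel
      have horth : inner ℂ (v - (inner ℂ e v : ℂ) • e) ((inner ℂ e v : ℂ) • e) = 0 := by
        rw [inner_smul_right, inner_sub_left, inner_smul_left, inner_self_eq_norm_sq_to_K, he]
        simp
      have := norm_add_sq_eq_norm_sq_add_norm_sq_of_inner_eq_zero _ _ horth
      rw [← hv', norm_smul, he] at this
      nlinarith
    have h2 : 1 - ‖(inner ℂ e v : ℂ)‖ ≤ ‖1 - (inner ℂ e v : ℂ)‖ := by
      simpa using norm_sub_norm_le (1:ℂ) (inner ℂ e v)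
    have h3 : ‖(inner ℂ e v : ℂ)‖ ≤ 1 := by
      have := norm_inner_le_norm (𝕜 := ℂ) e v
      rw [he] at this; linarith
    nlinarith [norm_nonneg v, norm_nonneg (inner ℂ e v : ℂ)]
  have hxn : ‖x‖ ≤ 1 := by
    have := norm_inner_le_norm (𝕜 := ℂ) e z
    rw [he] at this; linarith
  have hdec : (inner ℂ w z : ℂ) =
      y * x + inner ℂ (w - (inner ℂ e w : ℂ) • e) (z - (inner ℂ e z : ℂ) • e) := by
    rw [inner_sub_left, inner_sub_right, inner_sub_right, inner_smul_left, inner_smul_left,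
      inner_smul_right, inner_smul_right, inner_self_eq_norm_sq_to_K, he, inner_conj_symm]
    simp only [← hx, ← hy]
    push_cast
    ring
  have hz' := key z hz
  have hw' := key w hw
  have hyc : ‖1 - (inner ℂ e w : ℂ)‖ = ‖1 - y‖ := by
    rw [← inner_conj_symm, ← RCLike.norm_conj]; simp [hy]
  rw [hyc] at hw'
  have q1 : qdist z e = ‖1 - x‖ := rfl
  have q2 : qdist e w = ‖1 - y‖ := rfl
  rw [q1, q2]
  unfold qdist herm
  rw [hdec]
  set p := ‖w - (inner ℂ e w : ℂ) • e‖
  set q := ‖z - (inner ℂ e z : ℂ) • e‖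
  have hin : ‖(inner ℂ (w - (inner ℂ e w : ℂ) • e) (z - (inner ℂ e z : ℂ) • e) : ℂ)‖ ≤ p * q :=
    norm_inner_le_norm _ _
  set i : ℂ := inner ℂ (w - (inner ℂ e w : ℂ) • e) (z - (inner ℂ e z : ℂ) • e)
  have : 1 - (y * x + i) = (1 - x) + x * (1 - y) - i := by ring
  rw [this]
  have h4 : ‖(1 - x) + x * (1 - y) - i‖ ≤ ‖1 - x‖ + ‖x‖ * ‖1 - y‖ + ‖i‖ := by
    refine (norm_sub_le _ _).trans (add_le_add_left ((norm_add_le _ _).trans ?_) _)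
    rw [norm_mul]
  nlinarith [norm_nonneg (1 - y), sq_nonneg (p - q), norm_nonneg (1-x)]

/-- The quasi-triangle inequality of `qdist`, with constant `4`. For `u ≠ 0` it goes through the
boundary point `u / ‖u‖`, and projecting `u` to the sphere costs a factor `2`. -/
lemma qdist_triangle {z u w : Cn n} (hz : ‖z‖ ≤ 1) (hu : ‖u‖ ≤ 1) (hw : ‖w‖ ≤ 1) :
    qdist z w ≤ 4 * (qdist z u + qdist u w) := by
  rcases eq_or_ne u 0 with rfl | hu0
  · have h1 : qdist z (0 : Cn n) = 1 := by simp [qdist, herm]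
    have h2 : qdist (0 : Cn n) w = 1 := by simp [qdist, herm]
    have := qdist_le_two hz hw
    rw [h1, h2]; linarith
  · have hpos : 0 < ‖u‖ := norm_pos_iff.2 hu0
    set e : Cn n := ((‖u‖⁻¹ : ℝ) : ℂ) • u with he
    have hen : ‖e‖ = 1 := by
      rw [he, norm_smul, Complex.norm_real, norm_inv, norm_norm, inv_mul_cancel₀ hpos.ne']
    have hue : u = ((‖u‖ : ℝ) : ℂ) • e := by
      rw [he, smul_smul, ← Complex.ofReal_mul, mul_inv_cancel₀ hpos.ne']; simp
    have h1 := qdist_le_of_norm_one hz hw hen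
    have aux : ∀ v : Cn n, ‖v‖ ≤ 1 → qdist v e ≤ 2 * qdist v u := by
      intro v hv
      have hx : ‖herm v e‖ ≤ 1 := (norm_herm_le v e).trans (by rw [hen]; linarith)
      have h2 : herm v u = ((‖u‖ : ℝ) : ℂ) * herm v e := by
        conv_lhs => rw [hue]
        unfold herm
        rw [inner_smul_left]; simp
      have := norm_one_sub_le_two_mul hx (norm_nonneg u) hu
      unfold qdist; rw [h2]; exact this
    have a1 := aux z hz
    have a2 := aux w hw
    rw [qdist_comm w e, qdist_comm w u] at a2
    linarith

/-- Every point is a nonnegative multiple of the first vector of some orthonormal basis. -/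
lemma exists_frame [NeZero n] (z : Cn n) :
    ∃ e : OrthonormalBasis (Fin n) ℂ (Cn n), z = ((‖z‖ : ℝ) : ℂ) • e 0 := by
  rcases eq_or_ne z 0 with rfl | hz
  · exact ⟨EuclideanSpace.basisFun (Fin n) ℂ, by simp⟩
  · have hpos : 0 < ‖z‖ := norm_pos_iff.2 hz
    set v : Fin n → Cn n := fun _ => ((‖z‖⁻¹ : ℝ) : ℂ) • z with hv
    have hvn : ‖((‖z‖⁻¹ : ℝ) : ℂ) • z‖ = 1 := by
      rw [norm_smul, Complex.norm_real, norm_inv, norm_norm, inv_mul_cancel₀ hpos.ne']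
    have hon : Orthonormal ℂ (({0} : Set (Fin n)).domRestrict v) := by
      constructor
      · intro i; exact hvn
      · intro i j hij
        exact absurd (Subsingleton.elim i j) hij
    obtain ⟨e, he⟩ := hon.exists_orthonormalBasis_extension_of_card_eq (by simp)
    refine ⟨e, ?_⟩
    rw [he 0 rfl, hv]
    simp only
    rw [smul_smul, ← Complex.ofReal_mul, mul_inv_cancel₀ hpos.ne']; simp

lemma measurePreserving_repr (e : OrthonormalBasis (Fin n) ℂ (Cn n)) :
    MeasurePreserving e.repr volume volume := by
  let f : Cn n ≃ₗᵢ[ℝ] Cn n :=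
    { toLinearEquiv := e.repr.toLinearEquiv.restrictScalars ℝ
      norm_map' := e.repr.norm_map }
  exact LinearIsometryEquiv.measurePreserving f

/-! ### Volumes -/

/-- The volume of a polydisc with axes along an orthonormal basis. The constant `κ` compares the
Euclidean Lebesgue measure with the product measure, and its value (which is `πⁿ`) is not needed. -/
lemma exists_volume_polydisc (n : ℕ) [NeZero n] : ∃ κ : ℝ, 0 < κ ∧
    ∀ (e : OrthonormalBasis (Fin n) ℂ (Cn n)) (c : ℂ) (r s : ℝ), 0 ≤ r → 0 ≤ s →
      volume {w : Cn n | ‖e.repr w 0 - c‖ < r ∧ ∀ j : Fin n, j ≠ 0 → ‖e.repr w j‖ < s} =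
        ENNReal.ofReal (κ * r ^ 2 * (s ^ 2) ^ (n - 1)) := by
  let L : Cn n ≃L[ℝ] (Fin n → ℂ) := PiLp.continuousLinearEquiv 2 ℝ (fun _ : Fin n => ℂ)
  have hH : ((volume : Measure (Cn n)).map L).IsAddHaarMeasure := L.isAddHaarMeasure_map volume
  set μ := (volume : Measure (Cn n)).map L with hμ
  set a := Measure.addHaarScalarFactor μ (volume : Measure (Fin n → ℂ)) with ha
  have ha0 : 0 < a := Measure.addHaarScalarFactor_pos_of_isAddHaarMeasure _ _
  have haμ : μ = a • (volume : Measure (Fin n → ℂ)) := Measure.isAddLeftInvariant_eq_smul _ _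
  refine ⟨a * Real.pi ^ n, by positivity, fun e c r s hr hs => ?_⟩
  set P : Set (Fin n → ℂ) :=
    Set.univ.pi fun j => if j = 0 then Metric.ball c r else Metric.ball 0 s with hP
  have hPm : MeasurableSet P := by
    refine MeasurableSet.univ_pi fun j => ?_
    split_ifs <;> exact measurableSet_ball
  have hset : {w : Cn n | ‖e.repr w 0 - c‖ < r ∧ ∀ j : Fin n, j ≠ 0 → ‖e.repr w j‖ < s} =
      e.repr ⁻¹' (L ⁻¹' P) := by
    ext w
    simp only [Set.mem_ofPred_eq, Set.mem_preimage, hP, Set.mem_univ_pi]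
    constructor
    · rintro ⟨h0, h⟩ j
      by_cases hj : j = 0
      · subst hj; simpa [dist_eq_norm, L] using h0
      · simpa [hj, L] using h j hj
    · intro h
      refine ⟨by simpa [dist_eq_norm, L] using h 0, fun j hj => by simpa [hj, L] using h j⟩
  rw [hset, (measurePreserving_repr e).measure_preimage
    (L.continuous.measurable hPm).nullMeasurableSet,
    ← Measure.map_apply L.continuous.measurable hPm, ← hμ, haμ, Measure.smul_apply, hP,
    volume_pi_pi]
  have hprod : ∏ j : Fin n, volume (if j = 0 then Metric.ball c r else Metric.ball (0:ℂ) s) =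
      ENNReal.ofReal (Real.pi ^ n * r ^ 2 * (s ^ 2) ^ (n - 1)) := by
    rw [← Finset.mul_prod_erase _ _ (Finset.mem_univ (0 : Fin n))]
    have h1 : ∀ j ∈ Finset.univ.erase (0 : Fin n),
        volume (if j = 0 then Metric.ball c r else Metric.ball (0:ℂ) s) =
          ENNReal.ofReal (s ^ 2 * Real.pi) := by
      intro j hj
      rw [if_neg (Finset.ne_of_mem_erase hj), Complex.volume_ball, ← ENNReal.ofReal_pow hs,
        ENNReal.ofReal_mul (by positivity)]
      congr 1
      rw [ENNReal.ofReal]; congr 1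
      exact (Real.toNNReal_of_nonneg Real.pi_pos.le).symm
    rw [Finset.prod_congr rfl h1, Finset.prod_const, Finset.card_erase_of_mem (Finset.mem_univ _),
      Finset.card_univ, Fintype.card_fin, if_pos rfl, Complex.volume_ball,
      ← ENNReal.ofReal_pow hr, ← ENNReal.ofReal_pow (by positivity)]
    have : (NNReal.pi : ENNReal) = ENNReal.ofReal Real.pi := by
      rw [ENNReal.ofReal]; congr 1
      exact (Real.toNNReal_of_nonneg Real.pi_pos.le).symm
    rw [this, ← ENNReal.ofReal_mul (by positivity), ← ENNReal.ofReal_mul (by positivity)]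
    congr 1
    obtain ⟨m, hm⟩ := Nat.exists_eq_succ_of_ne_zero (NeZero.ne n)
    rw [hm]; simp only [Nat.succ_eq_add_one, Nat.add_sub_cancel]
    rw [mul_pow]; ring
  rw [hprod, ENNReal.smul_def, smul_eq_mul, ← ENNReal.ofReal_coe_nnreal,
    ← ENNReal.ofReal_mul (by positivity)]
  congr 1; ring

lemma sq_repr_add_sq_repr_le (e : OrthonormalBasis (Fin n) ℂ (Cn n)) (w : Cn n) {i j : Fin n}
    (hij : i ≠ j) : ‖e.repr w i‖ ^ 2 + ‖e.repr w j‖ ^ 2 ≤ ‖w‖ ^ 2 := by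
  rw [← e.repr.norm_map w, EuclideanSpace.norm_sq_eq,
    ← Finset.sum_pair hij (f := fun k => ‖e.repr w k‖ ^ 2)]
  exact Finset.sum_le_sum_of_subset_of_nonneg (Finset.subset_univ _) (fun _ _ _ => by positivity)

lemma norm_repr_le (e : OrthonormalBasis (Fin n) ℂ (Cn n)) (w : Cn n) (i : Fin n) :
    ‖e.repr w i‖ ≤ ‖w‖ := by
  rw [← e.repr.norm_map w]; exact PiLp.norm_apply_le _ _

lemma qdist_smul_frame (e : OrthonormalBasis (Fin n) ℂ (Cn n)) (r : ℝ) (w : Cn n) (i : Fin n) :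
    qdist (((r : ℝ) : ℂ) • e i) w = ‖1 - (r : ℂ) * e.repr w i‖ := by
  rw [qdist_comm]
  unfold qdist herm
  rw [inner_smul_left, e.repr_apply_apply, Complex.conj_ofReal]

lemma exists_volume_qBall_le (n : ℕ) [NeZero n] : ∃ C : ℝ, 0 < C ∧
    ∀ z ∈ unitBall n, ∀ t : ℝ, 0 < t → volume (qBall z t) ≤ ENNReal.ofReal (C * t ^ (n + 1)) := by
  obtain ⟨κ, hκ, hvol⟩ := exists_volume_polydisc n
  refine ⟨κ * 4 ^ n, by positivity, fun z hz t ht => ?_⟩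
  rw [mem_unitBall] at hz
  obtain ⟨e, he⟩ := exists_frame z
  have hsub : qBall z t ⊆ {w : Cn n | ‖e.repr w 0 - 1‖ < 2 * t ∧
      ∀ j : Fin n, j ≠ 0 → ‖e.repr w j‖ < Real.sqrt (4 * t)} := by
    rintro w ⟨hw, hd⟩
    rw [mem_unitBall] at hw
    have hw0 := norm_repr_le e w 0
    rw [he, qdist_smul_frame] at hd
    have h1 := norm_one_sub_le_two_mul (hw0.trans hw.le) (norm_nonneg z) hz.le
    have h2 : ‖1 - e.repr w 0‖ < 2 * t := by linarith
    refine ⟨by rwa [norm_sub_rev], fun j hj => Real.lt_sqrt_of_sq_lt ?_⟩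
    have h3 := sq_repr_add_sq_repr_le e w hj
    have h4 : 1 - ‖e.repr w 0‖ ≤ ‖1 - e.repr w 0‖ := by
      simpa using norm_sub_norm_le (1:ℂ) (e.repr w 0)
    nlinarith [norm_nonneg w, norm_nonneg (e.repr w 0)]
  refine (measure_mono hsub).trans ?_
  rw [hvol e 1 _ _ (by positivity) (Real.sqrt_nonneg _), Real.sq_sqrt (by positivity)]
  apply ENNReal.ofReal_le_ofReal
  obtain ⟨m, hm⟩ := Nat.exists_eq_succ_of_ne_zero (NeZero.ne n)
  rw [hm]; simp only [Nat.succ_eq_add_one, Nat.add_sub_cancel]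
  apply le_of_eq; rw [mul_pow]; ring

/-- The points at depth at least `η` whose quasi-distance from `u` exceeds `1 - ‖u‖` by less than
`3η` fill a volume of order at least `η ^ (n + 1)`: they include a polydisc centred at
`(1 - 2η) u / ‖u‖`. -/
lemma exists_le_volume_top_half (n : ℕ) [NeZero n] : ∃ c : ℝ, 0 < c ∧
    ∀ u ∈ unitBall n, ∀ η : ℝ, 0 < η → η ≤ 1 / 2 →
      ENNReal.ofReal (c * η ^ (n + 1)) ≤
        volume {w | w ∈ unitBall n ∧ qdist u w < 3 * η + (1 - ‖u‖) ∧ η ≤ 1 - ‖w‖} := by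
  obtain ⟨κ, hκ, hvol⟩ := exists_volume_polydisc n
  have hn : 0 < (n : ℝ) := by exact_mod_cast Nat.pos_of_ne_zero (NeZero.ne n)
  refine ⟨κ * (1 / 4) ^ 2 * (1 / (4 * n)) ^ (n - 1), by positivity, fun u hu η hη hη2 => ?_⟩
  rw [mem_unitBall] at hu
  obtain ⟨e, he⟩ := exists_frame u
  have hsub : {w : Cn n | ‖e.repr w 0 - ((1 - 2 * η : ℝ) : ℂ)‖ < η / 4 ∧
      ∀ j : Fin n, j ≠ 0 → ‖e.repr w j‖ < Real.sqrt (η / (4 * n))} ⊆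
      {w | w ∈ unitBall n ∧ qdist u w < 3 * η + (1 - ‖u‖) ∧ η ≤ 1 - ‖w‖} := by
    rintro w ⟨h0, hj⟩
    have a1 : ‖e.repr w 0‖ < 1 - 7 / 4 * η := by
      have := norm_sub_norm_le (e.repr w 0) (((1 - 2 * η : ℝ) : ℂ))
      rw [Complex.norm_real, Real.norm_of_nonneg (by linarith)] at this
      linarith
    have a2 : ‖1 - e.repr w 0‖ < 9 / 4 * η := by
      have : 1 - e.repr w 0 = ((2 * η : ℝ) : ℂ) - (e.repr w 0 - ((1 - 2 * η : ℝ) : ℂ)) := by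
        push_cast; ring
      rw [this]
      have := norm_sub_le (((2 * η : ℝ) : ℂ)) (e.repr w 0 - ((1 - 2 * η : ℝ) : ℂ))
      rw [Complex.norm_real, Real.norm_of_nonneg (by linarith)] at this
      linarith
    have a3 : ‖w‖ ^ 2 ≤ (1 - 7 / 4 * η) ^ 2 + η / 4 := by
      rw [← e.repr.norm_map w, EuclideanSpace.norm_sq_eq,
        ← Finset.add_sum_erase _ _ (Finset.mem_univ (0 : Fin n))]
      refine add_le_add (by gcongr) ?_
      have : ∀ j ∈ Finset.univ.erase (0 : Fin n), ‖e.repr w j‖ ^ 2 ≤ η / (4 * n) := by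
        intro j hj'
        have := hj j (Finset.ne_of_mem_erase hj')
        rw [Real.lt_sqrt (norm_nonneg _)] at this
        exact this.le
      refine (Finset.sum_le_sum this).trans ?_
      rw [Finset.sum_const, nsmul_eq_mul]
      have hc : ((Finset.univ.erase (0 : Fin n)).card : ℝ) ≤ n := by
        exact_mod_cast (Finset.card_le_univ _).trans (by simp)
      calc _ ≤ (n : ℝ) * (η / (4 * n)) := by gcongr
        _ = η / 4 := by field_simp
    have a4 : ‖w‖ ≤ 1 - η := by
      refine le_of_sq_le_sq ?_ (by linarith)
      nlinarith
    refine ⟨mem_unitBall.2 (by linarith), ?_, by linarith⟩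
    rw [he, qdist_smul_frame]
    have e1 : ‖1 - ((‖u‖ : ℝ) : ℂ) * e.repr w 0‖ ≤
        ‖1 - e.repr w 0‖ + (1 - ‖u‖) * ‖e.repr w 0‖ := by
      have : 1 - ((‖u‖ : ℝ) : ℂ) * e.repr w 0 =
          (1 - e.repr w 0) + ((1 - ‖u‖ : ℝ) : ℂ) * e.repr w 0 := by push_cast; ring
      rw [this]
      refine (norm_add_le _ _).trans ?_
      rw [norm_mul, Complex.norm_real, Real.norm_of_nonneg (by linarith)]
    have : ‖((‖u‖ : ℝ) : ℂ) • e 0‖ = ‖u‖ := by rw [← he]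
    rw [this]
    nlinarith [norm_nonneg (e.repr w 0)]
  refine le_trans (le_of_eq ?_) (measure_mono hsub)
  rw [hvol e _ _ _ (by positivity) (Real.sqrt_nonneg _), Real.sq_sqrt (by positivity)]
  congr 1
  obtain ⟨m, hm⟩ := Nat.exists_eq_succ_of_ne_zero (NeZero.ne n)
  have : (n - 1) + 2 = n + 1 := by omega
  rw [← this, div_eq_mul_one_div η, mul_pow η]; ring

lemma lintegral_shifted_rpow_le {a τ : ℝ} (ha : a < 1) (hτ : 0 < τ) :
    ∫⁻ σ in Set.Ioo (1 - τ) 1, (Set.Ioi a).indicator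
      (fun σ => ENNReal.ofReal ((σ - a) ^ (-(3 / 4) : ℝ))) σ ≤
        ENNReal.ofReal (4 * τ ^ (1 / 4 : ℝ)) := by
  set m := max a (1 - τ) with hm
  have hm1 : m < 1 := max_lt ha (by linarith)
  have hint : ∫⁻ σ in Set.Ioc m 1, ENNReal.ofReal ((σ - m) ^ (-(3 / 4) : ℝ)) =
      ENNReal.ofReal (4 * (1 - m) ^ (1 / 4 : ℝ)) := by
    have h1 : IntervalIntegrable (fun σ : ℝ => (σ - m) ^ (-(3 / 4) : ℝ)) volume m 1 := by
      have := (intervalIntegral.intervalIntegrable_rpow' (a := 0) (b := 1 - m)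
        (r := -(3 / 4)) (by norm_num)).comp_sub_right m
      simpa using this
    have h2 : ∫ σ in m..1, (σ - m) ^ (-(3 / 4) : ℝ) = 4 * (1 - m) ^ (1 / 4 : ℝ) := by
      rw [intervalIntegral.integral_comp_sub_right (fun x : ℝ => x ^ (-(3 / 4) : ℝ)) m, sub_self,
        integral_rpow (Or.inl (by norm_num))]
      norm_num
      ring
    rw [← h2, intervalIntegral.integral_of_le hm1.le]
    symm
    refine ofReal_integral_eq_lintegral_ofReal
      ((intervalIntegrable_iff_integrableOn_Ioc_of_le hm1.le).1 h1) ?_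
    filter_upwards [ae_restrict_mem measurableSet_Ioc] with σ hσ
    exact Real.rpow_nonneg (by linarith [hσ.1]) _
  calc
    _ ≤ ∫⁻ σ in Set.Ioo (1 - τ) 1, (Set.Ioc m 1).indicator
        (fun σ => ENNReal.ofReal ((σ - m) ^ (-(3 / 4) : ℝ))) σ := by
        refine lintegral_mono_ae ?_
        filter_upwards [ae_restrict_mem measurableSet_Ioo,
          (ae_restrict_of_ae (Measure.ae_ne volume m))] with σ hσ hne
        by_cases h : a < σ
        -- the single point `σ = m` is negligible, so strict inequality may be assumed
        · have hmσ : m < σ := lt_of_le_of_ne (max_le h.le hσ.1.le) (Ne.symm hne)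
          rw [Set.indicator_of_mem (show σ ∈ Set.Ioi a from h),
            Set.indicator_of_mem (show σ ∈ Set.Ioc m 1 from ⟨hmσ, hσ.2.le⟩)]
          apply ENNReal.ofReal_le_ofReal
          exact Real.rpow_le_rpow_of_nonpos (by linarith) (by linarith [le_max_left a (1 - τ)])
            (by norm_num)
        · rw [Set.indicator_of_notMem (by simpa using h)]
          exact zero_le
    _ ≤ ∫⁻ σ, (Set.Ioc m 1).indicator
        (fun σ => ENNReal.ofReal ((σ - m) ^ (-(3 / 4) : ℝ))) σ := setLIntegral_le_lintegral _ _
    _ = _ := by rw [lintegral_indicator measurableSet_Ioc, hint]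
    _ ≤ _ := by
      apply ENNReal.ofReal_le_ofReal
      have : 1 - m ≤ τ := by linarith [le_max_right a (1 - τ)]
      have h0 : 0 ≤ 1 - m := by linarith
      gcongr

/-! ### A weighted integral over quasi-balls, and Schur's test -/

lemma le_ofReal_div_of_ofReal_mul_le {x : ENNReal} {a b : ℝ} (ha : 0 < a)
    (h : ENNReal.ofReal a * x ≤ ENNReal.ofReal b) : x ≤ ENNReal.ofReal (b / a) := by
  rw [ENNReal.ofReal_div_of_pos ha, ENNReal.le_div_iff_mul_le
    (Or.inl (by simpa using ha)) (Or.inl ENNReal.ofReal_ne_top), mul_comm]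
  exact h

lemma lintegral_comp_inv_smul (H : Cn n → ENNReal) (hH : Measurable H) {σ : ℝ} (hσ : 0 < σ) :
    ∫⁻ w, H (σ⁻¹ • w) = ENNReal.ofReal (σ ^ Module.finrank ℝ (Cn n)) * ∫⁻ w, H w := by
  have h1 := Measure.map_addHaar_smul (volume : Measure (Cn n)) (inv_ne_zero hσ.ne')
  have h2 : ∫⁻ w, H (σ⁻¹ • w) = ∫⁻ w, H w ∂(Measure.map (fun x : Cn n => σ⁻¹ • x) volume) :=
    (lintegral_map hH (measurable_const_smul σ⁻¹)).symm
  rw [h2]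
  erw [h1]
  rw [lintegral_smul_measure, smul_eq_mul, inv_pow, inv_inv, abs_of_nonneg (by positivity)]

lemma qBall_subset_qBall_two {z : Cn n} (hz : z ∈ unitBall n) (t : ℝ) : qBall z t ⊆ qBall z 2 := by
  rintro w ⟨hw, -⟩
  refine ⟨hw, ?_⟩
  rw [mem_unitBall] at hw hz
  have h1 := norm_herm_le z w
  have h2 : qdist z w ≤ ‖(1:ℂ)‖ + ‖herm z w‖ := norm_sub_le _ _
  rw [norm_one] at h2
  nlinarith [norm_nonneg z, norm_nonneg w]

/-- The weight `(1 - ‖w‖) ^ (-3/4)` is integrable on quasi-balls, with the bound given by scaling.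
Polar coordinates are avoided by averaging over dilations: the integral over `qBall z t` is
compared with the integrals of the dilated function for `1 - t / 4 < σ < 1`, which live on
`qBall z (2 * t)`, and Tonelli leaves the one-dimensional integral of `(σ - ‖w‖) ^ (-3/4)` in `σ`. -/
lemma exists_lintegral_qBall_le (n : ℕ) [NeZero n] : ∃ C : ℝ, 0 < C ∧
    ∀ z ∈ unitBall n, ∀ t : ℝ, 0 < t →
      ∫⁻ w in qBall z t, ENNReal.ofReal ((1 - ‖w‖) ^ (-(3 / 4) : ℝ)) ≤
        ENNReal.ofReal (C * (t ^ n * t ^ (1 / 4 : ℝ))) := by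
  obtain ⟨C₀, hC₀, hvol⟩ := exists_volume_qBall_le n
  set d := Module.finrank ℝ (Cn n) with hd
  set C : ℝ := 16 * C₀ * 2 ^ (n + 1) * 2 ^ d with hC
  have hCpos : 0 < C := by positivity
  have small : ∀ z ∈ unitBall n, ∀ t : ℝ, 0 < t → t ≤ 2 →
      ∫⁻ w in qBall z t, ENNReal.ofReal ((1 - ‖w‖) ^ (-(3 / 4) : ℝ)) ≤
        ENNReal.ofReal (C * (t ^ n * t ^ (1 / 4 : ℝ))) := by
    intro z hz t ht ht2
    set τ := t / 4 with hτ
    have hτ0 : 0 < τ := by positivity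
    set H : Cn n → ENNReal :=
      (qBall z t).indicator fun w => ENNReal.ofReal ((1 - ‖w‖) ^ (-(3 / 4) : ℝ)) with hH
    have hHm : Measurable H := by
      refine Measurable.indicator ?_ (measurableSet_qBall z t)
      fun_prop
    rw [← lintegral_indicator (measurableSet_qBall z t)]
    change ∫⁻ w, H w ≤ _
    set I := ∫⁻ w, H w with hI
    -- `K σ` dominates the dilate of `H` by the factor `σ`; it is what gets averaged over `σ`
    set K : ℝ → Cn n → ENNReal := fun σ w => (qBall z (2 * t)).indicator (fun w =>
      (Set.Ioi ‖w‖).indicator (fun σ => ENNReal.ofReal ((σ - ‖w‖) ^ (-(3 / 4) : ℝ))) σ) w with hK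
    have hKm : Measurable (Function.uncurry K) := by
      have : Function.uncurry K = Set.indicator
          ((Prod.snd ⁻¹' (qBall z (2 * t))) ∩ {p : ℝ × Cn n | ‖p.2‖ < p.1})
          (fun p => ENNReal.ofReal ((p.1 - ‖p.2‖) ^ (-(3 / 4) : ℝ))) := by
        ext ⟨σ, w⟩
        simp only [Function.uncurry, hK, Set.indicator, Set.mem_inter_iff, Set.mem_preimage,
          Set.mem_ofPred_eq, Set.mem_Ioi]
        by_cases h1 : w ∈ qBall z (2 * t) <;> simp [h1]
      rw [this]
      refine Measurable.indicator (by fun_prop) ?_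
      refine (measurable_snd (measurableSet_qBall z (2 * t))).inter ?_
      exact measurableSet_lt (by fun_prop) (by fun_prop)
    have hpt : ∀ σ ∈ Set.Ioo (1 - τ) 1, ∀ w, H (σ⁻¹ • w) ≤ K σ w := by
      intro σ hσ w
      have hσ0 : 0 < σ := by linarith [hσ.1]
      by_cases hv : σ⁻¹ • w ∈ qBall z t
      · have hw : w = σ • (σ⁻¹ • w) := by rw [smul_smul, mul_inv_cancel₀ hσ0.ne', one_smul]
        set v := σ⁻¹ • w with hvdef
        have hnw : ‖w‖ = σ * ‖v‖ := by rw [hw, norm_smul, Real.norm_of_nonneg hσ0.le]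
        have hv1 : ‖v‖ < 1 := mem_unitBall.1 hv.1
        have hz1 : ‖z‖ < 1 := mem_unitBall.1 hz
        have hlt : ‖w‖ < σ := by rw [hnw]; nlinarith
        have hwmem : w ∈ qBall z (2 * t) := by
          refine ⟨mem_unitBall.2 (hlt.trans hσ.2), ?_⟩
          have e1 : herm z w = (σ : ℂ) * herm z v := by
            conv_lhs => rw [hw]
            unfold herm
            rw [← Complex.coe_smul, inner_smul_left, Complex.conj_ofReal]
          have e2 : 1 - herm z w = (1 - herm z v) + ((1 - σ : ℝ) : ℂ) * herm z v := by
            rw [e1]; push_cast; ring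
          have e3 : qdist z w ≤ qdist z v + (1 - σ) * ‖herm z v‖ := by
            unfold qdist; rw [e2]
            refine (norm_add_le _ _).trans ?_
            rw [norm_mul, Complex.norm_real, Real.norm_of_nonneg (by linarith [hσ.2])]
          have e4 := norm_herm_le z v
          have e5 : ‖herm z v‖ ≤ 1 := e4.trans (by nlinarith [norm_nonneg z, norm_nonneg v])
          have e6 := hv.2
          nlinarith [hσ.1, hσ.2]
        rw [hH, hK]
        simp only
        rw [Set.indicator_of_mem hv, Set.indicator_of_mem hwmem,
          Set.indicator_of_mem (show σ ∈ Set.Ioi ‖w‖ from hlt)]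
        apply ENNReal.ofReal_le_ofReal
        refine Real.rpow_le_rpow_of_nonpos (by linarith) ?_ (by norm_num)
        rw [hnw]; nlinarith [hσ.2]
      · rw [hH, Set.indicator_of_notMem hv]; exact zero_le
    have h1 : ∀ σ ∈ Set.Ioo (1 - τ) 1,
        ENNReal.ofReal ((1 / 2) ^ d) * I ≤ ∫⁻ w, K σ w := by
      intro σ hσ
      have hσ2 : 1 / 2 ≤ σ := by linarith [hσ.1]
      calc _ ≤ ENNReal.ofReal (σ ^ d) * I := by gcongr
        _ = ∫⁻ w, H (σ⁻¹ • w) := (lintegral_comp_inv_smul H hHm (by linarith)).symm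
        _ ≤ _ := lintegral_mono (hpt σ hσ)
    have h2 : ENNReal.ofReal (τ * (1 / 2) ^ d) * I ≤
        ENNReal.ofReal (4 * τ ^ (1 / 4 : ℝ) * (C₀ * (2 * t) ^ (n + 1))) := by
      calc ENNReal.ofReal (τ * (1 / 2) ^ d) * I
          = ∫⁻ _σ in Set.Ioo (1 - τ) 1, ENNReal.ofReal ((1 / 2) ^ d) * I := by
            rw [setLIntegral_const, Real.volume_Ioo, ENNReal.ofReal_mul hτ0.le]
            rw [show 1 - (1 - τ) = τ by ring]; ring
        _ ≤ ∫⁻ σ in Set.Ioo (1 - τ) 1, ∫⁻ w, K σ w := setLIntegral_mono' measurableSet_Ioo h1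
        _ = ∫⁻ w, ∫⁻ σ in Set.Ioo (1 - τ) 1, K σ w := lintegral_lintegral_swap hKm.aemeasurable
        _ ≤ ∫⁻ w, (qBall z (2 * t)).indicator
            (fun _ => ENNReal.ofReal (4 * τ ^ (1 / 4 : ℝ))) w := by
            refine lintegral_mono fun w => ?_
            by_cases hw : w ∈ qBall z (2 * t)
            · simp only [hK]
              rw [Set.indicator_of_mem hw]
              simp only [Set.indicator_of_mem hw]
              exact lintegral_shifted_rpow_le (mem_unitBall.1 hw.1) hτ0
            · simp [hK, Set.indicator_of_notMem hw]
        _ = ENNReal.ofReal (4 * τ ^ (1 / 4 : ℝ)) * volume (qBall z (2 * t)) :=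
            lintegral_indicator_const (measurableSet_qBall z (2 * t)) _
        _ ≤ ENNReal.ofReal (4 * τ ^ (1 / 4 : ℝ)) * ENNReal.ofReal (C₀ * (2 * t) ^ (n + 1)) := by
            gcongr
            exact hvol z hz _ (by positivity)
        _ = _ := (ENNReal.ofReal_mul (by positivity)).symm
    refine (le_ofReal_div_of_ofReal_mul_le (by positivity) h2).trans (ENNReal.ofReal_le_ofReal ?_)
    have h3 : τ ^ (1 / 4 : ℝ) ≤ t ^ (1 / 4 : ℝ) :=
      Real.rpow_le_rpow hτ0.le (by linarith) (by norm_num)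
    rw [div_le_iff₀ (by positivity)]
    calc 4 * τ ^ (1 / 4 : ℝ) * (C₀ * (2 * t) ^ (n + 1))
        ≤ 4 * t ^ (1 / 4 : ℝ) * (C₀ * (2 * t) ^ (n + 1)) := by gcongr
      _ = C * (t ^ n * t ^ (1 / 4 : ℝ)) * (τ * (1 / 2) ^ d) := by
        have hd2 : (2 : ℝ) ^ d * (1 / 2) ^ d = 1 := by rw [← mul_pow]; norm_num
        rw [hC, hτ]
        generalize t ^ (1 / 4 : ℝ) = q
        rw [mul_pow]
        linear_combination (-(4 * C₀ * 2 ^ (n + 1) * t ^ (n + 1) * q)) * hd2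
  refine ⟨C, hCpos, fun z hz t ht => ?_⟩
  rcases le_or_gt t 2 with h | h
  · exact small z hz t ht h
  · refine ((lintegral_mono_set (qBall_subset_qBall_two hz t)).trans
      (small z hz 2 (by norm_num) le_rfl)).trans (ENNReal.ofReal_le_ofReal ?_)
    gcongr

/-- Schur's test on `L²` for a nonnegative symmetric kernel `k` with test function `h`. -/
lemma lintegral_sq_lintegral_le_of_schur {α : Type*} [MeasurableSpace α] {μ : Measure α}
    [SFinite μ] {k : α → α → ENNReal} (hk : Measurable (Function.uncurry k))
    (hsymm : ∀ x y, k x y = k y x) {h : α → ENNReal} (hh : Measurable h)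
    (h0 : ∀ᵐ x ∂μ, h x ≠ 0) (htop : ∀ᵐ x ∂μ, h x ≠ ⊤) {C : ENNReal}
    (hC : ∀ᵐ x ∂μ, ∫⁻ y, k x y * h y ∂μ ≤ C * h x) {g : α → ENNReal} (hg : Measurable g) :
    ∫⁻ x, (∫⁻ y, k x y * g y ∂μ) ^ 2 ∂μ ≤ C ^ 2 * ∫⁻ y, g y ^ 2 ∂μ := by
  have hkx : ∀ x, Measurable (k x) := fun x => hk.comp measurable_prodMk_left
  have h1 : ∀ᵐ x ∂μ, (∫⁻ y, k x y * g y ∂μ) ^ 2 ≤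
      C * h x * ∫⁻ y, k x y * (g y ^ 2 * (h y)⁻¹) ∂μ := by
    filter_upwards [hC] with x hx
    have e1 : ∫⁻ y, k x y * g y ∂μ = ∫⁻ y, (k x y * h y) ^ (1 / 2 : ℝ) *
        (k x y * (g y ^ 2 * (h y)⁻¹)) ^ (1 / 2 : ℝ) ∂μ := by
      refine lintegral_congr_ae ?_
      filter_upwards [h0, htop] with y hy0 hyt
      rw [← ENNReal.mul_rpow_of_nonneg _ _ (by norm_num)]
      have : k x y * h y * (k x y * (g y ^ 2 * (h y)⁻¹)) = (k x y * g y) ^ 2 := by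
        calc _ = (k x y * g y) ^ 2 * (h y * (h y)⁻¹) := by ring
          _ = _ := by rw [ENNReal.mul_inv_cancel hy0 hyt, mul_one]
      rw [this, ← ENNReal.rpow_natCast, ← ENNReal.rpow_mul]
      norm_num
    have e2 := ENNReal.lintegral_mul_norm_pow_le (μ := μ) (p := 1 / 2) (q := 1 / 2)
      (f := fun y => k x y * h y) (g := fun y => k x y * (g y ^ 2 * (h y)⁻¹))
      (((hkx x).mul hh).aemeasurable)
      (((hkx x).mul ((hg.pow_const 2).mul hh.inv)).aemeasurable)
      (by norm_num) (by norm_num) (by norm_num)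
    rw [← e1] at e2
    calc _ ≤ ((∫⁻ y, k x y * h y ∂μ) ^ (1 / 2 : ℝ) *
        (∫⁻ y, k x y * (g y ^ 2 * (h y)⁻¹) ∂μ) ^ (1 / 2 : ℝ)) ^ 2 := by gcongr
      _ = (∫⁻ y, k x y * h y ∂μ) * (∫⁻ y, k x y * (g y ^ 2 * (h y)⁻¹) ∂μ) := by
        rw [mul_pow, ← ENNReal.rpow_natCast, ← ENNReal.rpow_natCast, ← ENNReal.rpow_mul,
          ← ENNReal.rpow_mul]
        norm_num
      _ ≤ _ := by gcongr
  calc _ ≤ ∫⁻ x, C * h x * ∫⁻ y, k x y * (g y ^ 2 * (h y)⁻¹) ∂μ ∂μ := lintegral_mono_ae h1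
    _ = ∫⁻ x, ∫⁻ y, C * h x * (k x y * (g y ^ 2 * (h y)⁻¹)) ∂μ ∂μ := by
      refine lintegral_congr fun x => (lintegral_const_mul _ ?_).symm
      exact (hkx x).mul ((hg.pow_const 2).mul hh.inv)
    _ = ∫⁻ y, ∫⁻ x, C * h x * (k x y * (g y ^ 2 * (h y)⁻¹)) ∂μ ∂μ := by
      refine lintegral_lintegral_swap (Measurable.aemeasurable ?_)
      exact ((measurable_const.mul (hh.comp measurable_fst))).mul
        (hk.mul (((hg.comp measurable_snd).pow_const 2).mul (hh.comp measurable_snd).inv))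
    _ = ∫⁻ y, C * (g y ^ 2 * (h y)⁻¹) * ∫⁻ x, k y x * h x ∂μ ∂μ := by
      refine lintegral_congr fun y => ?_
      rw [← lintegral_const_mul _ (show Measurable fun x => k y x * h x from (hkx y).mul hh)]
      refine lintegral_congr fun x => ?_
      rw [hsymm x y]; ring
    _ ≤ ∫⁻ y, C ^ 2 * g y ^ 2 ∂μ := by
      refine lintegral_mono_ae ?_
      filter_upwards [hC, h0, htop] with y hy hy0 hyt
      calc _ ≤ C * (g y ^ 2 * (h y)⁻¹) * (C * h y) := by gcongr
        _ = C ^ 2 * g y ^ 2 * (h y * (h y)⁻¹) := by ring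
        _ = _ := by rw [ENNReal.mul_inv_cancel hy0 hyt, mul_one]
    _ = _ := lintegral_const_mul _ (hg.pow_const 2)

/-! ### A positive kernel bounded on L² -/

/-- The integral behind Schur's test, estimated over the dyadic shells
`2 ^ j * (1 - ‖z‖) ≤ qdist z w < 2 ^ (j + 1) * (1 - ‖z‖)`. -/
lemma exists_lintegral_qdist_rpow_le (n : ℕ) [NeZero n] : ∃ C : ℝ, 0 < C ∧
    ∀ z ∈ unitBall n,
      ∫⁻ w in unitBall n,
        ENNReal.ofReal (qdist z w ^ (-(n + 1 / 2) : ℝ) * (1 - ‖w‖) ^ (-(3 / 4) : ℝ)) ≤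
      ENNReal.ofReal (C * (1 - ‖z‖) ^ (-(1 / 4) : ℝ)) := by
  obtain ⟨C₀, hC₀, hbox⟩ := exists_lintegral_qBall_le n
  set q : ℝ := (2 : ℝ) ^ (-(1 / 4) : ℝ) with hq
  have hq0 : 0 < q := by positivity
  have hq1 : q < 1 := Real.rpow_lt_one_of_one_lt_of_neg (by norm_num) (by norm_num)
  refine ⟨C₀ * 2 ^ n * 2 ^ (1 / 4 : ℝ) * (1 - q)⁻¹, by
    have : 0 < 1 - q := by linarith
    positivity, fun z hz => ?_⟩
  have hz1 : ‖z‖ < 1 := mem_unitBall.1 hz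
  set δ := 1 - ‖z‖ with hδ
  have hδ0 : 0 < δ := by linarith
  -- `E j` dominates the integrand on the `j`-th dyadic shell
  set E : ℕ → Cn n → ENNReal := fun j => (qBall z (2 ^ (j + 1) * δ)).indicator fun w =>
    ENNReal.ofReal ((2 ^ j * δ) ^ (-(n + 1 / 2) : ℝ)) *
      ENNReal.ofReal ((1 - ‖w‖) ^ (-(3 / 4) : ℝ)) with hE
  have hEm : ∀ j, Measurable (E j) := fun j =>
    Measurable.indicator (by fun_prop) (measurableSet_qBall _ _)
  have hpt : ∀ w ∈ unitBall n, ENNReal.ofReal (qdist z w ^ (-(n + 1 / 2) : ℝ) *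
      (1 - ‖w‖) ^ (-(3 / 4) : ℝ)) ≤ ∑' j, E j w := by
    intro w hw
    have hw1 : ‖w‖ < 1 := mem_unitBall.1 hw
    have hD : δ ≤ qdist z w := one_sub_norm_le_qdist hw1.le
    obtain ⟨j, hj1, hj2⟩ := exists_nat_pow_near (x := qdist z w / δ) (y := 2)
      ((one_le_div hδ0).2 hD) (by norm_num)
    rw [le_div_iff₀ hδ0] at hj1
    rw [div_lt_iff₀ hδ0] at hj2
    refine le_trans ?_ (ENNReal.le_tsum j)
    rw [hE]; simp only
    rw [Set.indicator_of_mem (show w ∈ qBall z (2 ^ (j + 1) * δ) from ⟨hw, hj2⟩),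
      ← ENNReal.ofReal_mul (by positivity)]
    apply ENNReal.ofReal_le_ofReal
    have : 0 ≤ (1 - ‖w‖) ^ (-(3 / 4) : ℝ) := Real.rpow_nonneg (by linarith) _
    refine mul_le_mul_of_nonneg_right ?_ this
    refine Real.rpow_le_rpow_of_nonpos (by positivity) hj1 ?_
    have : (0 : ℝ) ≤ n := Nat.cast_nonneg n
    linarith
  have hint : ∀ j, ∫⁻ w, E j w ≤
      ENNReal.ofReal (C₀ * 2 ^ n * 2 ^ (1 / 4 : ℝ) * δ ^ (-(1 / 4) : ℝ) * q ^ j) := by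
    intro j
    rw [hE]; simp only
    rw [lintegral_indicator (measurableSet_qBall _ _), lintegral_const_mul _ (by fun_prop)]
    refine (mul_le_mul_right (hbox z hz _ (by positivity)) _).trans ?_
    rw [← ENNReal.ofReal_mul (by positivity)]
    apply ENNReal.ofReal_le_ofReal
    apply le_of_eq
    set x : ℝ := 2 ^ j * δ with hx
    have hx0 : 0 < x := by positivity
    have e1 : (2 : ℝ) ^ (j + 1) * δ = 2 * x := by rw [hx]; ring
    have e2 : x ^ (-(1 / 4) : ℝ) = q ^ j * δ ^ (-(1 / 4) : ℝ) := by
      rw [hx, Real.mul_rpow (by positivity) hδ0.le, hq, ← Real.rpow_natCast, ← Real.rpow_natCast,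
        ← Real.rpow_mul (by norm_num), ← Real.rpow_mul (by norm_num)]
      congr 2; ring
    have e3 : x ^ (-(n + 1 / 2) : ℝ) * (x ^ n * x ^ (1 / 4 : ℝ)) = x ^ (-(1 / 4) : ℝ) := by
      rw [← Real.rpow_natCast x n, ← Real.rpow_add hx0, ← Real.rpow_add hx0]
      congr 1; ring
    rw [e1, mul_pow, Real.mul_rpow (by norm_num) hx0.le]
    calc _ = C₀ * 2 ^ n * 2 ^ (1 / 4 : ℝ) *
          (x ^ (-(n + 1 / 2) : ℝ) * (x ^ n * x ^ (1 / 4 : ℝ))) := by ring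
      _ = _ := by rw [e3, e2]; ring
  calc _ ≤ ∫⁻ w in unitBall n, ∑' j, E j w := setLIntegral_mono' measurableSet_unitBall hpt
    _ ≤ ∫⁻ w, ∑' j, E j w := setLIntegral_le_lintegral _ _
    _ = ∑' j, ∫⁻ w, E j w := lintegral_tsum fun j => (hEm j).aemeasurable
    _ ≤ ∑' j, ENNReal.ofReal (C₀ * 2 ^ n * 2 ^ (1 / 4 : ℝ) * δ ^ (-(1 / 4) : ℝ) * q ^ j) :=
      ENNReal.tsum_le_tsum hint
    _ = ENNReal.ofReal (∑' j : ℕ, C₀ * 2 ^ n * 2 ^ (1 / 4 : ℝ) * δ ^ (-(1 / 4) : ℝ) * q ^ j) :=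
      (ENNReal.ofReal_tsum_of_nonneg (fun j => by positivity)
        ((summable_geometric_of_lt_one hq0.le hq1).mul_left _)).symm
    _ = _ := by
      rw [tsum_mul_left, tsum_geometric_of_lt_one hq0.le hq1]
      congr 1; ring

/-- The positive kernel `D(z, w) ^ (-(n + 1/2)) (1 - ‖z‖) ^ (-1/4) (1 - ‖w‖) ^ (-1/4)`, where
`D = qdist`. It has the homogeneity of the Bergman kernel, so it is bounded on `L²`, while its decay
exponent is smaller than `n + 1`, which leaves room to absorb logarithms. -/
noncomputable def schurKernel (z w : Cn n) : ENNReal :=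
  ENNReal.ofReal (qdist z w ^ (-(n + 1 / 2) : ℝ) * (1 - ‖z‖) ^ (-(1 / 4) : ℝ) *
    (1 - ‖w‖) ^ (-(1 / 4) : ℝ))

lemma measurable_schurKernel :
    Measurable (Function.uncurry (schurKernel : Cn n → Cn n → ENNReal)) := by
  unfold schurKernel Function.uncurry
  have : Measurable (fun p : Cn n × Cn n => qdist p.1 p.2) := continuous_qdist.measurable
  fun_prop

/-- `schurKernel` is bounded on `L²` of the ball, by Schur's test with `(1 - ‖w‖) ^ (-1/2)`. -/
lemma exists_lintegral_sq_schurKernel_le (n : ℕ) [NeZero n] : ∃ C : ℝ, 0 < C ∧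
    ∀ g : Cn n → ENNReal, Measurable g →
      ∫⁻ z in unitBall n, (∫⁻ w in unitBall n, schurKernel z w * g w) ^ 2 ≤
        ENNReal.ofReal C * ∫⁻ w in unitBall n, g w ^ 2 := by
  obtain ⟨C, hC, hint⟩ := exists_lintegral_qdist_rpow_le n
  refine ⟨C ^ 2, by positivity, fun g hg => ?_⟩
  rw [ENNReal.ofReal_pow hC.le]
  refine lintegral_sq_lintegral_le_of_schur measurable_schurKernel
    (h := fun w => ENNReal.ofReal ((1 - ‖w‖) ^ (-(1 / 2) : ℝ))) ?_ (by fun_prop) ?_ ?_ ?_ hg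
  · intro x y
    unfold schurKernel
    rw [qdist_comm]; congr 1; ring
  · filter_upwards [ae_restrict_mem measurableSet_unitBall] with x hx
    have : 0 < 1 - ‖x‖ := by linarith [mem_unitBall.1 hx]
    simpa using Real.rpow_pos_of_pos this _
  · exact Filter.Eventually.of_forall fun x => ENNReal.ofReal_ne_top
  · filter_upwards [ae_restrict_mem measurableSet_unitBall] with z hz
    have hz0 : 0 < 1 - ‖z‖ := by linarith [mem_unitBall.1 hz]
    have : ∀ w ∈ unitBall n, schurKernel z w * ENNReal.ofReal ((1 - ‖w‖) ^ (-(1 / 2) : ℝ)) =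
        ENNReal.ofReal ((1 - ‖z‖) ^ (-(1 / 4) : ℝ)) *
        ENNReal.ofReal (qdist z w ^ (-(n + 1 / 2) : ℝ) * (1 - ‖w‖) ^ (-(3 / 4) : ℝ)) := by
      intro w hw
      have hw0 : 0 < 1 - ‖w‖ := by linarith [mem_unitBall.1 hw]
      have hD := qdist_nonneg z w
      unfold schurKernel
      rw [← ENNReal.ofReal_mul (by positivity), ← ENNReal.ofReal_mul (by positivity)]
      congr 1
      rw [show (-(3 / 4) : ℝ) = -(1 / 4) + -(1 / 2) by norm_num, Real.rpow_add hw0]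
      ring
    rw [setLIntegral_congr_fun measurableSet_unitBall this, lintegral_const_mul]
    · refine (mul_le_mul_right (hint z hz) _).trans (le_of_eq ?_)
      rw [← ENNReal.ofReal_mul (by positivity), ← ENNReal.ofReal_mul (by positivity)]
      congr 1
      rw [show (-(1 / 2) : ℝ) = -(1 / 4) + -(1 / 4) by norm_num, Real.rpow_add hz0]
      ring
    · have : Measurable (fun w : Cn n => qdist z w) := (continuous_qdist_right z).measurable
      fun_prop

/-! ### The maximal inequality and the distance to the good set -/

/-- The points of the ball at which the density `F` has average at most one at every scale, with
`t ^ (n + 1)` in the role of the volume of the quasi-ball of radius `t`. -/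
def goodSet (F : Cn n → ENNReal) : Set (Cn n) :=
  {v | v ∈ unitBall n ∧ ∀ t : ℝ, 0 < t → ∫⁻ u in qBall v t, F u ≤ ENNReal.ofReal (t ^ (n + 1))}

/-- The weak type (1,1) inequality of the maximal function over quasi-balls, by Vitali covering. -/
lemma exists_volume_diff_goodSet_le (n : ℕ) [NeZero n] : ∃ C : ℝ, 0 < C ∧
    ∀ F : Cn n → ENNReal,
      volume (unitBall n \ goodSet F) ≤ ENNReal.ofReal C * ∫⁻ u in unitBall n, F u := by
  obtain ⟨C₀, hC₀, hvol⟩ := exists_volume_qBall_le n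
  refine ⟨C₀ * 12 ^ (n + 1), by positivity, fun F => ?_⟩
  by_cases hfin : ∫⁻ u in unitBall n, F u = ⊤
  · rw [hfin, ENNReal.mul_top (by simpa using by positivity)]; exact le_top
  set A := (∫⁻ u in unitBall n, F u).toReal with hA
  set T : Set (Cn n × ℝ) := {p | p.1 ∈ unitBall n ∧ 0 < p.2 ∧
    ENNReal.ofReal (p.2 ^ (n + 1)) < ∫⁻ u in qBall p.1 p.2, F u} with hT
  have hbdd : ∀ p ∈ T, p.2 ≤ max 1 A := by
    rintro p ⟨-, h0, hp⟩
    rcases le_or_gt p.2 1 with h1 | h1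
    · exact h1.trans (le_max_left _ _)
    · have h2 := hp.trans_le (lintegral_mono_set (qBall_subset_unitBall p.1 p.2))
      have h3 : p.2 ^ (n + 1) ≤ A := (ENNReal.ofReal_le_iff_le_toReal hfin).1 h2.le
      exact ((le_self_pow₀ h1.le (by omega)).trans h3).trans (le_max_right _ _)
  have hne : ∀ p ∈ T, (qBall p.1 p.2).Nonempty := by
    rintro p ⟨-, -, hp⟩
    by_contra h
    rw [Set.not_nonempty_iff_eq_empty] at h
    rw [h] at hp; simp at hp
  obtain ⟨U, hUT, hdisj, hcov⟩ := Vitali.exists_disjoint_subfamily_covering_enlargement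
    (fun p : Cn n × ℝ => qBall p.1 p.2) T (fun p => p.2) 2 (by norm_num)
    (fun p hp => hp.2.1.le) (max 1 A) hbdd hne
  have hcount : U.Countable := hdisj.countable_of_isOpen (fun p _ => isOpen_qBall _ _)
    (fun p hp => hne p (hUT hp))
  have hsub : unitBall n \ goodSet F ⊆ ⋃ p ∈ U, qBall p.1 (12 * p.2) := by
    rintro v ⟨hv, hvG⟩
    have : ∃ t : ℝ, 0 < t ∧ ENNReal.ofReal (t ^ (n + 1)) < ∫⁻ u in qBall v t, F u := by
      by_contra! h
      exact hvG ⟨hv, h⟩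
    obtain ⟨t, ht, htF⟩ := this
    obtain ⟨p, hpU, ⟨x, hx1, hx2⟩, hp⟩ := hcov (v, t) ⟨hv, ht, htF⟩
    refine Set.mem_biUnion hpU ⟨hv, ?_⟩
    -- the selected quasi-ball about `p` of radius `s` meets `qBall v t` and has `t ≤ 2 * s`, whence
    -- `qdist p v < 4 * (s + t) ≤ 12 * s`
    have h1 := qdist_triangle (mem_unitBall.1 (hUT hpU).1).le (mem_unitBall.1 hx1.1).le
      (mem_unitBall.1 hv).le
    have h2 := hx1.2
    have h3 := hx2.2
    rw [qdist_comm] at h2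
    simp only at h2 h3 hp
    linarith
  calc volume (unitBall n \ goodSet F) ≤ volume (⋃ p ∈ U, qBall p.1 (12 * p.2)) :=
        measure_mono hsub
    _ ≤ ∑' p : U, volume (qBall p.1.1 (12 * p.1.2)) := measure_biUnion_le _ hcount _
    _ ≤ ∑' p : U, ENNReal.ofReal (C₀ * 12 ^ (n + 1)) * ∫⁻ u in qBall p.1.1 p.1.2, F u := by
        refine ENNReal.tsum_le_tsum fun p => ?_
        obtain ⟨h1, h2, h3⟩ := hUT p.2
        refine (hvol _ h1 _ (by positivity)).trans ?_
        rw [mul_pow, ← mul_assoc, ENNReal.ofReal_mul (by positivity)]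
        gcongr
    _ = ENNReal.ofReal (C₀ * 12 ^ (n + 1)) * ∑' p : U, ∫⁻ u in qBall p.1.1 p.1.2, F u :=
        ENNReal.tsum_mul_left
    _ = ENNReal.ofReal (C₀ * 12 ^ (n + 1)) * ∫⁻ u in ⋃ p ∈ U, qBall p.1 p.2, F u := by
        rw [lintegral_biUnion hcount (fun p _ => measurableSet_qBall _ _) hdisj]
    _ ≤ _ := by
        gcongr
        exact Set.iUnion₂_subset fun p _ => qBall_subset_unitBall _ _

/-- The quasi-distance from `u` to the set `G`. For empty `G` the infimum has the junk value `0`;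
nonemptiness is assumed wherever this matters. -/
noncomputable def qInfDist (G : Set (Cn n)) (u : Cn n) : ℝ := ⨅ v : G, qdist u v

section qInfDist

variable {G : Set (Cn n)}

lemma bddBelow_qdist (G : Set (Cn n)) (u : Cn n) :
    BddBelow (Set.range fun v : G => qdist u v) :=
  ⟨0, by rintro _ ⟨v, rfl⟩; exact qdist_nonneg _ _⟩

lemma qInfDist_le {v : Cn n} (hv : v ∈ G) (u : Cn n) : qInfDist G u ≤ qdist u v :=
  ciInf_le (bddBelow_qdist G u) (⟨v, hv⟩ : G)

lemma le_qInfDist (hG : G ⊆ unitBall n) (hne : G.Nonempty) (u : Cn n) :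
    1 - ‖u‖ ≤ qInfDist G u := by
  have : Nonempty G := hne.to_subtype
  exact le_ciInf fun v => one_sub_norm_le_qdist (mem_unitBall.1 (hG v.2)).le

lemma qInfDist_le_two (hG : G ⊆ unitBall n) (hne : G.Nonempty) {u : Cn n} (hu : ‖u‖ ≤ 1) :
    qInfDist G u ≤ 2 := by
  obtain ⟨v, hv⟩ := hne
  exact (qInfDist_le hv u).trans (qdist_le_two hu (mem_unitBall.1 (hG hv)).le)

lemma qInfDist_triangle (hG : G ⊆ unitBall n) (hne : G.Nonempty) {u w : Cn n} (hu : ‖u‖ ≤ 1)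
    (hw : ‖w‖ ≤ 1) : qInfDist G u ≤ 4 * (qdist u w + qInfDist G w) := by
  have : Nonempty G := hne.to_subtype
  have h : qInfDist G u / 4 - qdist u w ≤ qInfDist G w := le_ciInf fun v => by
    have h1 := qInfDist_le v.2 u
    have h2 := qdist_triangle hu hw (mem_unitBall.1 (hG v.2)).le
    linarith
  linarith

lemma exists_qdist_lt_two_mul_qInfDist (hne : G.Nonempty) {u : Cn n} (hpos : 0 < qInfDist G u) :
    ∃ v ∈ G, qdist u v < 2 * qInfDist G u := by
  have : Nonempty G := hne.to_subtype
  obtain ⟨v, hv⟩ := exists_lt_of_ciInf_lt (show (⨅ v : G, qdist u v) < 2 * qInfDist G u from by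
    change qInfDist G u < _; linarith)
  exact ⟨v, v.2, hv⟩

lemma measurable_qInfDist (G : Set (Cn n)) : Measurable (qInfDist G) :=
  (upperSemicontinuous_ciInf (fun u => bddBelow_qdist G u)
    fun v => (continuous_qdist_left (v : Cn n)).upperSemicontinuous).measurable

end qInfDist

/-! ### Spreading mass into the ball -/

/-- The properties of `u ↦ qInfDist G u` on the ball that the spreading argument uses: it is
measurable, bounded below by the depth `1 - ‖u‖` and above by `2`, and quasi-Lipschitz. -/
structure IsStoppingScale (σ : Cn n → ℝ) : Prop where
  measurable : Measurable σ
  depth_le : ∀ u ∈ unitBall n, 1 - ‖u‖ ≤ σ u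
  le_two : ∀ u ∈ unitBall n, σ u ≤ 2
  triangle : ∀ u ∈ unitBall n, ∀ w ∈ unitBall n, σ u ≤ 4 * (qdist u w + σ w)

lemma isStoppingScale_qInfDist {G : Set (Cn n)} (hG : G ⊆ unitBall n) (hne : G.Nonempty) :
    IsStoppingScale (qInfDist G) where
  measurable := measurable_qInfDist G
  depth_le u _ := le_qInfDist hG hne u
  le_two _ hu := qInfDist_le_two hG hne (mem_unitBall.1 hu).le
  triangle _ hu _ hw := qInfDist_triangle hG hne (mem_unitBall.1 hu).le (mem_unitBall.1 hw).le

/-- The region over which the mass at `u` is spread: points within quasi-distance comparable to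
`σ u` of `u`, and at depth at least `σ u / 64`. The ratio `64` is what makes a point `w` that
receives mass from the boundary layer `64 * (1 - ‖u‖) < σ u` satisfy `2 * (1 - ‖w‖) < σ w`. -/
def spreadSet (σ : Cn n → ℝ) (u : Cn n) : Set (Cn n) :=
  {w | w ∈ unitBall n ∧ qdist u w < 3 * (σ u / 64) + (1 - ‖u‖) ∧ σ u / 64 ≤ 1 - ‖w‖}

/-- The density obtained from `h` by spreading the mass at each `u` over `spreadSet σ u`. -/
noncomputable def spreadKernel (σ : Cn n → ℝ) (u w : Cn n) : ENNReal :=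
  (spreadSet σ u).indicator (fun _ => ENNReal.ofReal ((σ u ^ (n + 1))⁻¹)) w

noncomputable def spread (σ : Cn n → ℝ) (h : Cn n → ENNReal) (w : Cn n) : ENNReal :=
  ∫⁻ u in unitBall n, spreadKernel σ u w * h u

lemma IsStoppingScale.pos {σ : Cn n → ℝ} (hσ : IsStoppingScale σ) {u : Cn n}
    (hu : u ∈ unitBall n) : 0 < σ u := by
  have := hσ.depth_le u hu
  have := mem_unitBall.1 hu
  linarith

lemma IsStoppingScale.qdist_lt {σ : Cn n → ℝ} (hσ : IsStoppingScale σ) {u w : Cn n}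
    (hu : u ∈ unitBall n) (hw : w ∈ spreadSet σ u) : qdist u w < 2 * σ u := by
  have := hσ.depth_le u hu
  have := hσ.pos hu
  have := hw.2.1
  linarith

lemma measurableSet_spreadSet (σ : Cn n → ℝ) (u : Cn n) : MeasurableSet (spreadSet σ u) :=
  measurableSet_unitBall.inter ((measurableSet_lt (continuous_qdist_right u).measurable
    measurable_const).inter (measurableSet_le measurable_const
      (show Measurable fun w : Cn n => 1 - ‖w‖ by fun_prop)))

lemma measurable_spreadKernel {σ : Cn n → ℝ} (hσ : Measurable σ) :
    Measurable (Function.uncurry (spreadKernel σ)) := by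
  have : Function.uncurry (spreadKernel σ) = Set.indicator
      {p : Cn n × Cn n | p.2 ∈ unitBall n ∧ qdist p.1 p.2 < 3 * (σ p.1 / 64) + (1 - ‖p.1‖) ∧
        σ p.1 / 64 ≤ 1 - ‖p.2‖} (fun p => ENNReal.ofReal ((σ p.1 ^ (n + 1))⁻¹)) := by
    ext ⟨u, w⟩
    rfl
  rw [this]
  have hσ1 : Measurable (fun p : Cn n × Cn n => σ p.1) := hσ.comp measurable_fst
  refine Measurable.indicator (by fun_prop) ?_
  exact (measurable_snd measurableSet_unitBall).inter ((measurableSet_lt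
    continuous_qdist.measurable
      (show Measurable fun p : Cn n × Cn n => 3 * (σ p.1 / 64) + (1 - ‖p.1‖) by fun_prop)).inter
    (measurableSet_le (show Measurable fun p : Cn n × Cn n => σ p.1 / 64 by fun_prop)
      (show Measurable fun p : Cn n × Cn n => 1 - ‖p.2‖ by fun_prop)))

lemma measurable_spread {σ : Cn n → ℝ} (hσ : Measurable σ) {h : Cn n → ENNReal}
    (hh : Measurable h) : Measurable (spread σ h) := by
  unfold spread
  have : Measurable (Function.uncurry fun w u => spreadKernel σ u w * h u) :=
    ((measurable_spreadKernel hσ).comp measurable_swap).mul (hh.comp measurable_snd)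
  exact this.lintegral_prod_right

lemma lintegral_mul_spread {σ : Cn n → ℝ} (hσ : Measurable σ) {h k : Cn n → ENNReal}
    (hh : Measurable h) (hk : Measurable k) :
    ∫⁻ w in unitBall n, k w * spread σ h w =
      ∫⁻ u in unitBall n, (∫⁻ w in spreadSet σ u, k w) * ENNReal.ofReal ((σ u ^ (n + 1))⁻¹) *
        h u := by
  have hK := measurable_spreadKernel hσ
  calc _ = ∫⁻ w in unitBall n, ∫⁻ u in unitBall n, k w * (spreadKernel σ u w * h u) := by
        refine lintegral_congr fun w => (lintegral_const_mul _ ?_).symm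
        exact (hK.comp measurable_prodMk_right).mul hh
    _ = ∫⁻ u in unitBall n, ∫⁻ w in unitBall n, k w * (spreadKernel σ u w * h u) := by
        refine lintegral_lintegral_swap (Measurable.aemeasurable ?_)
        exact (hk.comp measurable_fst).mul
          ((hK.comp measurable_swap).mul (hh.comp measurable_snd))
    _ = _ := by
        refine lintegral_congr fun u => ?_
        have : ∀ w, k w * (spreadKernel σ u w * h u) =
            (spreadSet σ u).indicator k w * (ENNReal.ofReal ((σ u ^ (n + 1))⁻¹) * h u) := by
          intro w
          unfold spreadKernel
          by_cases hw : w ∈ spreadSet σ u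
          · rw [Set.indicator_of_mem hw, Set.indicator_of_mem hw]
          · rw [Set.indicator_of_notMem hw, Set.indicator_of_notMem hw]; simp
        simp only [this]
        rw [lintegral_mul_const _ (hk.indicator (measurableSet_spreadSet σ u)),
          lintegral_indicator (measurableSet_spreadSet σ u), Measure.restrict_restrict
          (measurableSet_spreadSet σ u), Set.inter_eq_left.2 (fun w hw => hw.1), mul_assoc]

/-- Spreading does not increase the total mass by more than a constant factor. -/
lemma exists_lintegral_spread_le (n : ℕ) [NeZero n] : ∃ C : ℝ, 0 < C ∧
    ∀ σ : Cn n → ℝ, IsStoppingScale σ → ∀ h : Cn n → ENNReal, Measurable h →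
      ∫⁻ w in unitBall n, spread σ h w ≤ ENNReal.ofReal C * ∫⁻ u in unitBall n, h u := by
  obtain ⟨C₀, hC₀, hvol⟩ := exists_volume_qBall_le n
  refine ⟨C₀ * 2 ^ (n + 1), by positivity, fun σ hσ h hh => ?_⟩
  have := lintegral_mul_spread hσ.measurable hh (k := fun _ => 1) measurable_const
  simp only [one_mul] at this
  rw [this, ← lintegral_const_mul _ hh]
  refine setLIntegral_mono' measurableSet_unitBall fun u hu => ?_
  gcongr
  have hpos := hσ.pos hu
  have h1 : volume (spreadSet σ u) ≤ ENNReal.ofReal (C₀ * (2 * σ u) ^ (n + 1)) :=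
    (measure_mono (t := qBall u (2 * σ u)) fun w hw => ⟨hw.1, hσ.qdist_lt hu hw⟩).trans
      (hvol u hu _ (by linarith))
  rw [setLIntegral_one]
  refine (mul_le_mul_left h1 _).trans ?_
  rw [← ENNReal.ofReal_mul (by positivity)]
  apply ENNReal.ofReal_le_ofReal
  rw [mul_pow]
  apply le_of_eq
  field_simp

/-- Seen from a point `z` with `σ u ≤ qdist z u` for all `u`, spreading does not lose mass: on
`spreadSet σ u` the kernel `schurKernel z` is at least a constant times its value at `u` with
`1 - ‖u‖` replaced by `σ u`, since `w` is at quasi-distance at most a multiple of `qdist z u` from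
`z` and at depth at most a multiple of `σ u`, and the set has volume of order `σ u ^ (n + 1)`. -/
lemma exists_lintegral_kernel_le_spread (n : ℕ) [NeZero n] : ∃ C : ℝ, 0 < C ∧
    ∀ σ : Cn n → ℝ, IsStoppingScale σ → ∀ h : Cn n → ENNReal, Measurable h →
      ∀ z ∈ unitBall n, (∀ u ∈ unitBall n, σ u ≤ qdist z u) →
      ∫⁻ u in unitBall n, ENNReal.ofReal (qdist z u ^ (-(n + 1 / 2) : ℝ) *
        (1 - ‖z‖) ^ (-(1 / 4) : ℝ) * σ u ^ (-(1 / 4) : ℝ)) * h u ≤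
      ENNReal.ofReal C * ∫⁻ w in unitBall n, schurKernel z w * spread σ h w := by
  obtain ⟨c, hc, hvol⟩ := exists_le_volume_top_half n
  set a : ℝ := (12 : ℝ) ^ (-(n + 1 / 2) : ℝ) * 2 ^ (-(1 / 4) : ℝ) * (c * (1 / 64) ^ (n + 1))
    with ha
  have ha0 : 0 < a := by positivity
  refine ⟨a⁻¹, by positivity, fun σ hσ h hh z hz hzσ => ?_⟩
  have hz0 : 0 < 1 - ‖z‖ := by linarith [mem_unitBall.1 hz]
  rw [lintegral_mul_spread hσ.measurable hh
    measurable_schurKernel.of_uncurry_left,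
    ← lintegral_const_mul' _ _ ENNReal.ofReal_ne_top]
  refine setLIntegral_mono' measurableSet_unitBall fun u hu => ?_
  have hσ0 := hσ.pos hu
  have hu1 := mem_unitBall.1 hu
  have hD : 0 < qdist z u := hσ0.trans_le (hzσ u hu)
  rw [← mul_assoc, ← mul_assoc]
  refine mul_le_mul_left ?_ (h u)
  set X : ℝ := qdist z u ^ (-(n + 1 / 2) : ℝ) * (1 - ‖z‖) ^ (-(1 / 4) : ℝ) *
    σ u ^ (-(1 / 4) : ℝ) with hX
  have hX0 : 0 < X := by positivity
  have hker : ∀ w ∈ spreadSet σ u,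
      ENNReal.ofReal ((12 : ℝ) ^ (-(n + 1 / 2) : ℝ) * 2 ^ (-(1 / 4) : ℝ) * X) ≤
        schurKernel z w := by
    intro w hw
    have hw1 := mem_unitBall.1 hw.1
    have h1 := hσ.qdist_lt hu hw
    have h2 := qdist_triangle (mem_unitBall.1 hz).le hu1.le hw1.le
    have h3 := hzσ u hu
    have h4 : qdist z w ≤ 12 * qdist z u := by linarith
    have h5 : 1 - ‖w‖ ≤ 2 * σ u := (one_sub_norm_le_qdist' hu1.le).trans h1.le
    have h6 : 0 < qdist z w := qdist_pos (mem_unitBall.1 hz) hw1.le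
    have hn : (0 : ℝ) ≤ n := Nat.cast_nonneg n
    apply ENNReal.ofReal_le_ofReal
    calc _ = (12 * qdist z u) ^ (-(n + 1 / 2) : ℝ) * (1 - ‖z‖) ^ (-(1 / 4) : ℝ) *
          (2 * σ u) ^ (-(1 / 4) : ℝ) := by
          rw [Real.mul_rpow (by norm_num) hD.le, Real.mul_rpow (by norm_num) hσ0.le, hX]; ring
      _ ≤ _ := by
          have e1 : (12 * qdist z u) ^ (-(n + 1 / 2) : ℝ) ≤ qdist z w ^ (-(n + 1 / 2) : ℝ) :=
            Real.rpow_le_rpow_of_nonpos h6 h4 (by linarith)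
          have e2 : (2 * σ u) ^ (-(1 / 4) : ℝ) ≤ (1 - ‖w‖) ^ (-(1 / 4) : ℝ) :=
            Real.rpow_le_rpow_of_nonpos (by linarith) h5 (by norm_num)
          gcongr
  have hint : ENNReal.ofReal ((12 : ℝ) ^ (-(n + 1 / 2) : ℝ) * 2 ^ (-(1 / 4) : ℝ) * X) *
      ENNReal.ofReal (c * (σ u / 64) ^ (n + 1)) ≤ ∫⁻ w in spreadSet σ u, schurKernel z w := by
    have hv := hvol u hu (σ u / 64) (by positivity) (by linarith [hσ.le_two u hu])
    calc _ ≤ ENNReal.ofReal ((12 : ℝ) ^ (-(n + 1 / 2) : ℝ) * 2 ^ (-(1 / 4) : ℝ) * X) *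
          volume (spreadSet σ u) := by gcongr; exact hv
      _ = ∫⁻ w in spreadSet σ u,
          ENNReal.ofReal ((12 : ℝ) ^ (-(n + 1 / 2) : ℝ) * 2 ^ (-(1 / 4) : ℝ) * X) :=
          (setLIntegral_const _ _).symm
      _ ≤ _ := setLIntegral_mono' (measurableSet_spreadSet σ u) hker
  calc ENNReal.ofReal X = ENNReal.ofReal a⁻¹ *
        (ENNReal.ofReal ((12 : ℝ) ^ (-(n + 1 / 2) : ℝ) * 2 ^ (-(1 / 4) : ℝ) * X) *
        ENNReal.ofReal (c * (σ u / 64) ^ (n + 1))) * ENNReal.ofReal ((σ u ^ (n + 1))⁻¹) := by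
        clear_value X
        rw [← ENNReal.ofReal_mul (by positivity), ← ENNReal.ofReal_mul (by positivity),
          ← ENNReal.ofReal_mul (by positivity)]
        congr 1
        rw [div_eq_mul_one_div (σ u), mul_pow]
        have : a⁻¹ * ((12 : ℝ) ^ (-(n + 1 / 2) : ℝ) * 2 ^ (-(1 / 4) : ℝ) * X *
            (c * (σ u ^ (n + 1) * (1 / 64) ^ (n + 1)))) * (σ u ^ (n + 1))⁻¹ =
            a⁻¹ * a * X * (σ u ^ (n + 1) * (σ u ^ (n + 1))⁻¹) := by rw [ha]; ring
        rw [this, inv_mul_cancel₀ ha0.ne', mul_inv_cancel₀ (by positivity)]; ring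
    _ ≤ _ := by
        rw [mul_assoc, mul_assoc (ENNReal.ofReal a⁻¹)]
        exact mul_le_mul_right (mul_le_mul_left hint _) _

/-- Only points `u` with `σ u` comparable to `1 - ‖w‖`, inside a quasi-ball around `w` of that
size, contribute to the spread density at `w`. -/
lemma IsStoppingScale.spread_le {σ : Cn n → ℝ} (hσ : IsStoppingScale σ) {h : Cn n → ENNReal}
    {w : Cn n} (hw : w ∈ unitBall n) {k : Cn n → ENNReal}
    (hk : ∀ u ∈ unitBall n, w ∈ spreadSet σ u → h u ≤ k u) :
    spread σ h w ≤ ENNReal.ofReal ((2 / (1 - ‖w‖)) ^ (n + 1)) *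
      ∫⁻ u in qBall w (128 * (1 - ‖w‖)), k u := by
  have hw1 := mem_unitBall.1 hw
  have hδ : 0 < 1 - ‖w‖ := by linarith
  rw [← lintegral_const_mul' _ _ ENNReal.ofReal_ne_top,
    ← lintegral_indicator (measurableSet_qBall _ _)]
  refine le_trans ?_ (setLIntegral_le_lintegral (unitBall n) _)
  refine setLIntegral_mono' measurableSet_unitBall fun u hu => ?_
  by_cases hmem : w ∈ spreadSet σ u
  · have h1 := hσ.qdist_lt hu hmem
    have h2 := hmem.2.2
    have h3 : 1 - ‖w‖ ≤ qdist u w := one_sub_norm_le_qdist' (mem_unitBall.1 hu).le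
    have h4 : u ∈ qBall w (128 * (1 - ‖w‖)) := ⟨hu, by rw [qdist_comm]; linarith⟩
    rw [Set.indicator_of_mem h4]
    unfold spreadKernel
    rw [Set.indicator_of_mem hmem]
    refine mul_le_mul' (ENNReal.ofReal_le_ofReal ?_) (hk u hu hmem)
    rw [← inv_pow]
    have := hσ.pos hu
    gcongr
    rw [inv_eq_one_div, div_le_div_iff₀ this hδ]
    linarith
  · unfold spreadKernel
    rw [Set.indicator_of_notMem hmem, zero_mul]
    exact zero_le

/-! ### The weak type L log L inequality for the logarithmic kernel -/

/-- The spread density of `F` is bounded if the scale is the quasi-distance to the good set: a good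
point lies within a multiple of `1 - ‖w‖` of every `w` that receives mass. -/
lemma spread_qInfDist_goodSet_le {F : Cn n → ENNReal} (hne : (goodSet F).Nonempty)
    {w : Cn n} (hw : w ∈ unitBall n) :
    spread (qInfDist (goodSet F)) F w ≤ ENNReal.ofReal (14000 ^ (n + 1)) := by
  have hsub : goodSet F ⊆ unitBall n := fun v hv => hv.1
  have hσ := isStoppingScale_qInfDist hsub hne
  set σ := qInfDist (goodSet F) with hσdef
  have hw1 := mem_unitBall.1 hw
  have hδ : 0 < 1 - ‖w‖ := by linarith
  by_cases hex : ∃ u ∈ unitBall n, w ∈ spreadSet σ u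
  · obtain ⟨u, hu, hmem⟩ := hex
    refine (hσ.spread_le hw (k := F) fun _ _ _ => le_rfl).trans ?_
    obtain ⟨v, hv, hvlt⟩ := exists_qdist_lt_two_mul_qInfDist hne (hσ.pos hw)
    have h1 := hσ.qdist_lt hu hmem
    have h2 := hmem.2.2
    have h3 := hσ.triangle w hw u hu
    rw [qdist_comm] at h1
    -- `σ u ≤ 64 (1 - ‖w‖)` and `qdist w u < 2 σ u`, so `σ w ≤ 4 (2 σ u + σ u)`
    have h4 : σ w ≤ 768 * (1 - ‖w‖) := by linarith
    -- a good point `v` has `qdist w v < 1536 (1 - ‖w‖)`, and `4 (1536 + 128) < 7000`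
    have hball : qBall w (128 * (1 - ‖w‖)) ⊆ qBall v (7000 * (1 - ‖w‖)) := by
      rintro x ⟨hx, hxd⟩
      refine ⟨hx, ?_⟩
      have h5 := qdist_triangle (mem_unitBall.1 hv.1).le hw1.le (mem_unitBall.1 hx).le
      rw [qdist_comm v w] at h5
      linarith
    have h6 := (lintegral_mono_set hball).trans (hv.2 (7000 * (1 - ‖w‖)) (by positivity))
    refine (mul_le_mul_right h6 _).trans (le_of_eq ?_)
    rw [← ENNReal.ofReal_mul (by positivity), ← mul_pow]
    congr 2; field_simp; norm_num
  · push Not at hex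
    have h0 : spread σ F w ≤ ENNReal.ofReal ((2 / (1 - ‖w‖)) ^ (n + 1)) *
        ∫⁻ u in qBall w (128 * (1 - ‖w‖)), 0 :=
      hσ.spread_le hw fun u hu hmem => absurd hmem (hex u hu)
    refine h0.trans ?_
    simp

/-- The weight `(σ / (1 - ‖u‖)) ^ (3/4)` on the boundary layer `64 * (1 - ‖u‖) < σ u`, the second
term of Young's inequality for the product of the density with `log (σ / (1 - ‖u‖))`. -/
noncomputable def layerWeight (σ : Cn n → ℝ) : Cn n → ENNReal :=
  Set.indicator {u | 64 * (1 - ‖u‖) < σ u} fun u =>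
    ENNReal.ofReal ((σ u / (1 - ‖u‖)) ^ (3 / 4 : ℝ))

lemma measurable_layerWeight {σ : Cn n → ℝ} (hσ : Measurable σ) : Measurable (layerWeight σ) :=
  Measurable.indicator (by fun_prop)
    (measurableSet_lt (show Measurable fun u : Cn n => 64 * (1 - ‖u‖) by fun_prop) hσ)

/-- The spread layer weight is bounded, and lives where `2 * (1 - ‖w‖) < σ w`, hence off the good
set when `σ` is the quasi-distance to it. -/
lemma exists_spread_layerWeight_le (n : ℕ) [NeZero n] : ∃ C : ℝ, 0 < C ∧
    ∀ σ : Cn n → ℝ, IsStoppingScale σ → ∀ w ∈ unitBall n,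
      spread σ (layerWeight σ) w ≤ ENNReal.ofReal C *
        Set.indicator {w | 2 * (1 - ‖w‖) < σ w} 1 w := by
  obtain ⟨C₀, hC₀, hbox⟩ := exists_lintegral_qBall_le n
  refine ⟨2 ^ (n + 1) * 64 ^ (3 / 4 : ℝ) * C₀ * 128 ^ n * 128 ^ (1 / 4 : ℝ), by positivity,
    fun σ hσ w hw => ?_⟩
  have hw1 := mem_unitBall.1 hw
  set δ := 1 - ‖w‖ with hδdef
  have hδ : 0 < δ := by linarith
  by_cases hS : 2 * δ < σ w
  · rw [Set.indicator_of_mem (by exact hS), Pi.one_apply, mul_one]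
    have hk : ∀ u ∈ unitBall n, w ∈ spreadSet σ u → layerWeight σ u ≤
        ENNReal.ofReal ((64 * δ) ^ (3 / 4 : ℝ)) *
          ENNReal.ofReal ((1 - ‖u‖) ^ (-(3 / 4) : ℝ)) := by
      intro u hu hmem
      have hu0 : 0 < 1 - ‖u‖ := by linarith [mem_unitBall.1 hu]
      have h2 := hmem.2.2
      have hpos := hσ.pos hu
      refine (Set.indicator_le_self' (fun _ _ => zero_le) u).trans ?_
      rw [← ENNReal.ofReal_mul (by positivity)]
      apply ENNReal.ofReal_le_ofReal
      rw [Real.div_rpow hpos.le hu0.le, Real.rpow_neg hu0.le, div_eq_mul_inv]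
      gcongr
      linarith
    refine (hσ.spread_le hw hk).trans ?_
    rw [lintegral_const_mul' _ _ ENNReal.ofReal_ne_top]
    refine (mul_le_mul_right (mul_le_mul_right (hbox w hw _ (by positivity)) _) _).trans ?_
    rw [← ENNReal.ofReal_mul (by positivity), ← ENNReal.ofReal_mul (by positivity)]
    apply ENNReal.ofReal_le_ofReal
    rw [← hδdef]
    rw [Real.mul_rpow (by norm_num) hδ.le, Real.mul_rpow (by norm_num) hδ.le, mul_pow, div_pow]
    have e1 : δ ^ (3 / 4 : ℝ) * δ ^ (1 / 4 : ℝ) = δ := by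
      rw [← Real.rpow_add hδ]; norm_num
    have e2 : δ ^ (n + 1) = δ ^ n * δ := pow_succ _ _
    rw [div_mul_eq_mul_div, div_le_iff₀ (by positivity)]
    apply le_of_eq
    rw [e2]
    calc _ = 2 ^ (n + 1) * 64 ^ (3 / 4 : ℝ) * C₀ * 128 ^ n * 128 ^ (1 / 4 : ℝ) * δ ^ n *
          (δ ^ (3 / 4 : ℝ) * δ ^ (1 / 4 : ℝ)) := by ring
      _ = _ := by rw [e1]; ring
  · have hk : ∀ u ∈ unitBall n, w ∈ spreadSet σ u → layerWeight σ u ≤ 0 := by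
      intro u hu hmem
      refine (Set.indicator_of_notMem ?_ _).le
      intro hlt
      have hlt' : 64 * (1 - ‖u‖) < σ u := hlt
      have h1 := hmem.2.1
      have h3 := hσ.triangle u hu w hw
      have h4 : δ ≤ qdist u w := one_sub_norm_le_qdist' (mem_unitBall.1 hu).le
      have := hσ.pos hu
      linarith
    refine (hσ.spread_le hw hk).trans ?_
    simp

/-- Young's inequality for the dual pair `L log L` and `exp L`. -/
lemma mul_le_mul_posLog_add_exp {f y : ℝ} (hf : 0 ≤ f) :
    f * y ≤ f * Real.posLog f + Real.exp y := by
  have h0 : f ≤ Real.exp (Real.posLog f) := by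
    rcases hf.eq_or_lt with rfl | hf'
    · exact (Real.exp_pos _).le
    · calc f = Real.exp (Real.log f) := (Real.exp_log hf').symm
        _ ≤ _ := Real.exp_le_exp.2 (le_max_right _ _)
  have h1 : y - Real.posLog f ≤ Real.exp (y - Real.posLog f) := by
    linarith [Real.add_one_le_exp (y - Real.posLog f)]
  have h2 : f * (y - Real.posLog f) ≤ Real.exp y := by
    rcases le_or_gt (y - Real.posLog f) 0 with h | h
    · exact (mul_nonpos_of_nonneg_of_nonpos hf h).trans (Real.exp_pos _).le
    · calc _ ≤ Real.exp (Real.posLog f) * Real.exp (y - Real.posLog f) := by gcongr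
        _ = _ := by rw [← Real.exp_add]; congr 1; ring
  linarith

/-- The positive kernel that dominates the commutator with a Bloch function: up to a constant, the
modulus of the Bergman kernel times the bound of `HasBlochBound.norm_sub_le_qdist` for the difference of values.
It treats `z` by a power and `w` by a logarithm, because only the latter meets the density. -/
noncomputable def logKernel (z w : Cn n) : ℝ :=
  (qdist z w ^ (n + 1))⁻¹ * (qdist z w / (1 - ‖z‖)) ^ (1 / 4 : ℝ) *
    (1 + Real.log (qdist z w / (1 - ‖w‖)))

/-- The pointwise estimate behind `logKernel_mul_le`, with `D` for the quasi-distance, `δ` and `ε`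
for the depths of the two points, `σ` for the scale and `B` for the layer weight. -/
lemma logKernel_mul_le_aux {D σ δ ε f B : ℝ} (m : ℕ) (hδ : 0 < δ) (hδσ : δ ≤ σ) (hσD : σ ≤ D)
    (hε : 0 < ε) (hf : 0 ≤ f) (hB : 0 ≤ B) (hB' : 64 * δ < σ → (σ / δ) ^ (3 / 4 : ℝ) ≤ B) :
    (D ^ (m + 1))⁻¹ * (D / ε) ^ (1 / 4 : ℝ) * (1 + Real.log (D / δ)) * f ≤
      D ^ (-(m + 1 / 2) : ℝ) * ε ^ (-(1 / 4) : ℝ) * σ ^ (-(1 / 4) : ℝ) *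
        (10 * (f * (1 + Real.posLog f) + B)) := by
  have hσ : 0 < σ := hδ.trans_le hδσ
  have hD : 0 < D := hσ.trans_le hσD
  have hpl : 0 ≤ Real.posLog f := Real.posLog_nonneg
  have e1 : (D ^ (m + 1))⁻¹ * (D / ε) ^ (1 / 4 : ℝ) * (D / σ) ^ (1 / 4 : ℝ) =
      D ^ (-(m + 1 / 2) : ℝ) * ε ^ (-(1 / 4) : ℝ) * σ ^ (-(1 / 4) : ℝ) := by
    rw [Real.div_rpow hD.le hε.le, Real.div_rpow hD.le hσ.le, Real.rpow_neg hε.le,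
      Real.rpow_neg hσ.le, ← Real.rpow_natCast, ← Real.rpow_neg hD.le]
    have : D ^ (-(m + 1 / 2) : ℝ) =
        D ^ (-((m + 1 : ℕ) : ℝ)) * D ^ (1 / 4 : ℝ) * D ^ (1 / 4 : ℝ) := by
      rw [← Real.rpow_add hD, ← Real.rpow_add hD]; congr 1; push_cast; ring
    rw [this]; ring
  rw [← e1]
  set x := (D / σ) ^ (1 / 4 : ℝ) with hx
  have hx1 : 1 ≤ x := Real.one_le_rpow ((one_le_div hσ).2 hσD) (by norm_num)
  have hlogx : Real.log (D / σ) ≤ 4 * x := by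
    have := Real.log_le_rpow_div (x := D / σ) (by positivity) (ε := 1 / 4) (by norm_num)
    rw [← hx] at this; linarith
  -- the first logarithm is absorbed by `x`; the second one meets `f` only through Young's inequality
  have hlog : Real.log (D / δ) = Real.log (D / σ) + Real.log (σ / δ) := by
    rw [← Real.log_mul (by positivity) (by positivity)]
    congr 1; field_simp
  have hy0 : 0 ≤ Real.log (σ / δ) := Real.log_nonneg ((one_le_div hδ).2 hδσ)
  have key : (5 + Real.log (σ / δ)) * f ≤ 10 * (f * (1 + Real.posLog f) + B) := by
    -- Young's inequality is applied in the layer only: elsewhere the weight would not be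
    -- supported off the good set, and the logarithm is bounded anyway
    rcases lt_or_ge (64 * δ) σ with h | h
    · have h1 := mul_le_mul_posLog_add_exp (y := 3 / 4 * Real.log (σ / δ)) hf
      have h2 : Real.exp (3 / 4 * Real.log (σ / δ)) = (σ / δ) ^ (3 / 4 : ℝ) := by
        rw [Real.rpow_def_of_pos (by positivity), mul_comm]
      rw [h2] at h1
      have h3 := hB' h
      nlinarith [mul_nonneg hf hpl]
    · have h1 : Real.log (σ / δ) ≤ 5 := by
        have h2 : σ / δ ≤ 64 := (div_le_iff₀ hδ).2 h
        have h3 : Real.log (σ / δ) ≤ Real.log 64 := Real.log_le_log (by positivity) h2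
        have h4 : Real.log 64 = 6 * Real.log 2 := by
          rw [show (64 : ℝ) = 2 ^ 6 by norm_num, Real.log_pow]; norm_num
        have := Real.log_two_lt_d9
        linarith
      nlinarith [mul_nonneg hf hpl]
  have h5 : (1 + Real.log (D / δ)) * f ≤ x * (10 * (f * (1 + Real.posLog f) + B)) := by
    calc (1 + Real.log (D / δ)) * f ≤ x * (5 + Real.log (σ / δ)) * f := by
          gcongr
          rw [hlog]
          nlinarith
      _ = x * ((5 + Real.log (σ / δ)) * f) := by ring
      _ ≤ _ := by gcongr
  calc _ = (D ^ (m + 1))⁻¹ * (D / ε) ^ (1 / 4 : ℝ) * ((1 + Real.log (D / δ)) * f) := by ring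
    _ ≤ (D ^ (m + 1))⁻¹ * (D / ε) ^ (1 / 4 : ℝ) * (x * (10 * (f * (1 + Real.posLog f) + B))) := by
        gcongr
    _ = _ := by ring

/-- On the good side, `logKernel z u` times a density value `f` is at most the stopped Schur kernel
times `f (1 + log⁺ f)` plus the layer weight. -/
lemma logKernel_mul_le {σ : Cn n → ℝ} (hσ : IsStoppingScale σ) {z : Cn n} (hz : z ∈ unitBall n)
    (hzσ : ∀ u ∈ unitBall n, σ u ≤ qdist z u) {f : ℝ} (hf : 0 ≤ f) {u : Cn n}
    (hu : u ∈ unitBall n) :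
    ENNReal.ofReal (logKernel z u * f) ≤ ENNReal.ofReal (qdist z u ^ (-(n + 1 / 2) : ℝ) *
        (1 - ‖z‖) ^ (-(1 / 4) : ℝ) * σ u ^ (-(1 / 4) : ℝ)) *
      (10 * (ENNReal.ofReal (f * (1 + Real.posLog f)) + layerWeight σ u)) := by
  have hz0 : 0 < 1 - ‖z‖ := by linarith [mem_unitBall.1 hz]
  have hu0 : 0 < 1 - ‖u‖ := by linarith [mem_unitBall.1 hu]
  have hpos := hσ.pos hu
  have hD := qdist_nonneg z u
  have hpl : 0 ≤ Real.posLog f := Real.posLog_nonneg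
  set B : ℝ := Set.indicator {u | 64 * (1 - ‖u‖) < σ u} (fun u =>
    (σ u / (1 - ‖u‖)) ^ (3 / 4 : ℝ)) u with hB
  have hB0 : 0 ≤ B := by
    rw [hB]; unfold Set.indicator
    split_ifs
    · positivity
    · exact le_rfl
  have hBl : layerWeight σ u = ENNReal.ofReal B := by
    rw [hB]; unfold layerWeight Set.indicator
    split_ifs
    · rfl
    · simp
  rw [hBl, ← ENNReal.ofReal_add (by positivity) hB0,
    show (10 : ENNReal) = ENNReal.ofReal 10 by simp, ← ENNReal.ofReal_mul (by norm_num),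
    ← ENNReal.ofReal_mul (by positivity)]
  apply ENNReal.ofReal_le_ofReal
  refine logKernel_mul_le_aux n hu0 (hσ.depth_le u hu) (hzσ u hu) hz0 hf hB0 fun h => ?_
  rw [hB, Set.indicator_of_mem (by exact h)]

/-- The weak type `L log L` inequality of the operator with kernel `logKernel`. Off the good set of
`F = f (1 + log⁺ f)` the maximal inequality suffices. On it, the operator is dominated by
`schurKernel` applied to the spread density `g`, and `g` is bounded with integral at most a multiple
of `∫ F`, so that its `L²` norm is under control and Chebyshev's inequality applies. -/
theorem exists_volume_logKernel_le (n : ℕ) [NeZero n] : ∃ C : ℝ, 0 < C ∧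
    ∀ f : Cn n → ℝ, Measurable f → (∀ w, 0 ≤ f w) →
      volume {z | z ∈ unitBall n ∧ 1 < ∫⁻ w in unitBall n, ENNReal.ofReal (logKernel z w * f w)} ≤
        ENNReal.ofReal C *
          ∫⁻ w in unitBall n, ENNReal.ofReal (f w * (1 + Real.posLog (f w))) := by
  obtain ⟨C₁, hC₁, hgood⟩ := exists_volume_diff_goodSet_le n
  obtain ⟨C₂, hC₂, hmass⟩ := exists_lintegral_spread_le n
  obtain ⟨C₃, hC₃, hker⟩ := exists_lintegral_kernel_le_spread n
  obtain ⟨C₄, hC₄, hlay⟩ := exists_spread_layerWeight_le n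
  obtain ⟨C₅, hC₅, hL2⟩ := exists_lintegral_sq_schurKernel_le n
  set M : ℝ := 14000 ^ (n + 1) + C₄ with hM
  have hM0 : 0 < M := by positivity
  refine ⟨C₁ + (10 * C₃) ^ 2 * (C₅ * (M * (C₂ + C₄ * C₁))), by positivity, fun f hf hf0 => ?_⟩
  set F : Cn n → ENNReal := fun w => ENNReal.ofReal (f w * (1 + Real.posLog (f w))) with hF
  have hFm : Measurable F := by
    have : Measurable fun w => Real.posLog (f w) := by
      unfold Real.posLog; fun_prop
    fun_prop
  set S := {z | z ∈ unitBall n ∧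
    1 < ∫⁻ w in unitBall n, ENNReal.ofReal (logKernel z w * f w)} with hS
  have hbad := hgood F
  set I := ∫⁻ w in unitBall n, F w with hI
  rcases (goodSet F).eq_empty_or_nonempty with hempty | hne
  · rw [hempty, Set.sdiff_empty] at hbad
    calc volume S ≤ volume (unitBall n) := measure_mono fun z hz => hz.1
      _ ≤ ENNReal.ofReal C₁ * I := hbad
      _ ≤ _ := by
        gcongr
        have : 0 ≤ (10 * C₃) ^ 2 * (C₅ * (M * (C₂ + C₄ * C₁))) := by positivity
        linarith
  have hsub : goodSet F ⊆ unitBall n := fun v hv => hv.1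
  have hσ := isStoppingScale_qInfDist hsub hne
  have hσle : ∀ v ∈ goodSet F, ∀ u, qInfDist (goodSet F) u ≤ qdist v u := fun v hv u => by
    rw [qdist_comm]; exact qInfDist_le hv u
  have hsupF := fun w (hw : w ∈ unitBall n) => spread_qInfDist_goodSet_le hne hw
  set σ := qInfDist (goodSet F) with hσdef
  have hlm := measurable_layerWeight hσ.measurable
  set g : Cn n → ENNReal := spread σ (fun u => F u + layerWeight σ u) with hg
  have hgm : Measurable g := measurable_spread hσ.measurable (hFm.add hlm)
  have hgsplit : ∀ w, g w = spread σ F w + spread σ (layerWeight σ) w := by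
    intro w
    rw [hg]; unfold spread
    simp only [mul_add]
    exact lintegral_add_left ((measurable_spreadKernel hσ.measurable).of_uncurry_right.mul hFm) _
  set W : Set (Cn n) := {w | 2 * (1 - ‖w‖) < σ w} with hW
  have hWm : MeasurableSet W :=
    measurableSet_lt (show Measurable fun u : Cn n => 2 * (1 - ‖u‖) by fun_prop) hσ.measurable
  have hgsup : ∀ w ∈ unitBall n, g w ≤ ENNReal.ofReal M := by
    intro w hw
    rw [hgsplit, hM, ENNReal.ofReal_add (by positivity) hC₄.le]
    refine add_le_add (hsupF w hw) ((hlay σ hσ w hw).trans ?_)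
    refine (mul_le_mul_right (Set.indicator_le_self' (fun _ _ => zero_le) w) _).trans ?_
    simp
  have hWvol : volume (W ∩ unitBall n) ≤ ENNReal.ofReal C₁ * I := by
    refine (measure_mono ?_).trans hbad
    rintro w ⟨hwW, hw⟩
    refine ⟨hw, fun hwG => ?_⟩
    -- for `w` in the good set, `σ w ≤ qdist w w ≤ 2 (1 - ‖w‖)`
    have h1 := hσle w hwG w
    have h2 := qdist_self_le (mem_unitBall.1 hw).le
    have h3 : 2 * (1 - ‖w‖) < σ w := hwW
    linarith
  have hgint : ∫⁻ w in unitBall n, g w ≤ ENNReal.ofReal (C₂ + C₄ * C₁) * I := by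
    calc _ = ∫⁻ w in unitBall n, spread σ F w + spread σ (layerWeight σ) w :=
          lintegral_congr hgsplit
      _ = (∫⁻ w in unitBall n, spread σ F w) + ∫⁻ w in unitBall n, spread σ (layerWeight σ) w :=
          lintegral_add_left (measurable_spread hσ.measurable hFm) _
      _ ≤ ENNReal.ofReal C₂ * I + ENNReal.ofReal C₄ * (ENNReal.ofReal C₁ * I) := by
          refine add_le_add (hmass σ hσ F hFm) ?_
          calc _ ≤ ∫⁻ w in unitBall n, ENNReal.ofReal C₄ * W.indicator 1 w :=
                setLIntegral_mono' measurableSet_unitBall (hlay σ hσ)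
            _ = ENNReal.ofReal C₄ * volume (W ∩ unitBall n) := by
                rw [lintegral_const_mul' _ _ ENNReal.ofReal_ne_top, lintegral_indicator_one hWm,
                  Measure.restrict_apply hWm]
            _ ≤ _ := by gcongr
      _ = _ := by
          rw [ENNReal.ofReal_add hC₂.le (by positivity), ENNReal.ofReal_mul hC₄.le]; ring
  have hgsq : ∫⁻ w in unitBall n, g w ^ 2 ≤ ENNReal.ofReal (M * (C₂ + C₄ * C₁)) * I := by
    calc _ ≤ ∫⁻ w in unitBall n, ENNReal.ofReal M * g w := by
          refine setLIntegral_mono' measurableSet_unitBall fun w hw => ?_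
          rw [sq]; gcongr; exact hgsup w hw
      _ = ENNReal.ofReal M * ∫⁻ w in unitBall n, g w :=
          lintegral_const_mul' _ _ ENNReal.ofReal_ne_top
      _ ≤ ENNReal.ofReal M * (ENNReal.ofReal (C₂ + C₄ * C₁) * I) := by gcongr
      _ = _ := by rw [ENNReal.ofReal_mul hM0.le]; ring
  set T : Cn n → ENNReal := fun z => ∫⁻ w in unitBall n, schurKernel z w * g w with hT
  have hTm : Measurable T := by
    have : Measurable (Function.uncurry fun z w : Cn n => schurKernel z w * g w) :=
      measurable_schurKernel.mul (hgm.comp measurable_snd)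
    exact this.lintegral_prod_right
  have hST : ∀ z ∈ S, z ∈ goodSet F → 1 ≤ ENNReal.ofReal (10 * C₃) ^ 2 * T z ^ 2 := by
    rintro z ⟨hz, hz1⟩ hzG
    have h1 : ∫⁻ w in unitBall n, ENNReal.ofReal (logKernel z w * f w) ≤
        ENNReal.ofReal (10 * C₃) * T z := by
      calc _ ≤ ∫⁻ u in unitBall n, 10 * (ENNReal.ofReal (qdist z u ^ (-(n + 1 / 2) : ℝ) *
            (1 - ‖z‖) ^ (-(1 / 4) : ℝ) * σ u ^ (-(1 / 4) : ℝ)) *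
              (F u + layerWeight σ u)) := by
            refine setLIntegral_mono' measurableSet_unitBall fun u hu => ?_
            refine (logKernel_mul_le hσ hz (fun u _ => hσle z hzG u) (hf0 u) hu).trans ?_
            rw [mul_left_comm]
        _ = 10 * ∫⁻ u in unitBall n, ENNReal.ofReal (qdist z u ^ (-(n + 1 / 2) : ℝ) *
            (1 - ‖z‖) ^ (-(1 / 4) : ℝ) * σ u ^ (-(1 / 4) : ℝ)) *
              (F u + layerWeight σ u) := lintegral_const_mul' _ _ (by norm_num)
        _ ≤ 10 * (ENNReal.ofReal C₃ * T z) := by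
            gcongr
            exact hker σ hσ _ (hFm.add hlm) z hz (fun u _ => hσle z hzG u)
        _ = _ := by
            rw [ENNReal.ofReal_mul (by norm_num)]; simp [mul_assoc]
    rw [← mul_pow]
    exact one_le_pow₀ (hz1.le.trans h1)
  have hcheb : volume (S ∩ goodSet F) ≤
      ENNReal.ofReal ((10 * C₃) ^ 2 * (C₅ * (M * (C₂ + C₄ * C₁)))) * I := by
    calc volume (S ∩ goodSet F)
        ≤ volume ({z | 1 ≤ ENNReal.ofReal (10 * C₃) ^ 2 * T z ^ 2} ∩ unitBall n) :=
          measure_mono fun z hz => ⟨hST z hz.1 hz.2, hz.1.1⟩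
      _ ≤ volume.restrict (unitBall n) {z | 1 ≤ ENNReal.ofReal (10 * C₃) ^ 2 * T z ^ 2} :=
          Measure.le_restrict_apply _ _
      _ ≤ ∫⁻ z in unitBall n, ENNReal.ofReal (10 * C₃) ^ 2 * T z ^ 2 := by
          have := mul_meas_ge_le_lintegral (μ := volume.restrict (unitBall n))
            ((hTm.pow_const 2).const_mul (ENNReal.ofReal (10 * C₃) ^ 2)) 1
          rwa [one_mul] at this
      _ = ENNReal.ofReal (10 * C₃) ^ 2 * ∫⁻ z in unitBall n, T z ^ 2 :=
          lintegral_const_mul _ (hTm.pow_const 2)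
      _ ≤ ENNReal.ofReal (10 * C₃) ^ 2 * (ENNReal.ofReal C₅ *
          (ENNReal.ofReal (M * (C₂ + C₄ * C₁)) * I)) := by
          gcongr
          exact (hL2 g hgm).trans (mul_le_mul_right hgsq _)
      _ = _ := by
          rw [ENNReal.ofReal_mul (by positivity : 0 ≤ (10 * C₃) ^ 2), ENNReal.ofReal_mul hC₅.le,
            ENNReal.ofReal_pow (by positivity)]
          ring
  calc volume S ≤ volume ((unitBall n \ goodSet F) ∪ (S ∩ goodSet F)) := by
        refine measure_mono fun z hz => ?_
        by_cases h : z ∈ goodSet F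
        · exact Or.inr ⟨hz, h⟩
        · exact Or.inl ⟨hz.1, h⟩
    _ ≤ volume (unitBall n \ goodSet F) + volume (S ∩ goodSet F) := measure_union_le _ _
    _ ≤ _ := add_le_add hbad hcheb
    _ = _ := by rw [← add_mul, ← ENNReal.ofReal_add hC₁.le (by positivity)]

/-! ### The two-point estimate for Bloch functions -/

lemma norm_fderiv_le_norm_holGrad (b : Cn n → ℂ) (z : Cn n) : ‖fderiv ℂ b z‖ ≤ ‖holGrad b z‖ := by
  refine ContinuousLinearMap.opNorm_le_bound _ (norm_nonneg _) fun v => ?_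
  have hv : v = ∑ j, v j • EuclideanSpace.single j (1 : ℂ) := by
    have := (EuclideanSpace.basisFun (Fin n) ℂ).sum_repr v
    simpa using this.symm
  have h1 : fderiv ℂ b z v = ∑ j, v j * (holGrad b z) j := by
    conv_lhs => rw [hv]
    simp [map_sum, holGrad]
  rw [h1]
  refine (norm_sum_le _ _).trans ?_
  simp only [norm_mul]
  refine (Real.sum_mul_le_sqrt_mul_sqrt Finset.univ (fun j => ‖v j‖)
    (fun j => ‖holGrad b z j‖)).trans ?_
  rw [mul_comm, EuclideanSpace.norm_eq, EuclideanSpace.norm_eq]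

/-- `b` is holomorphic on the ball, with derivative of norm at most `M / (1 - ‖z‖)` at `z`; the
constant is taken positive for convenience. -/
structure HasBlochBound (b : Cn n → ℂ) (M : ℝ) : Prop where
  holomorphic : HolOnBall b
  pos : 0 < M
  norm_fderiv_le : ∀ z ∈ unitBall n, ‖fderiv ℂ b z‖ ≤ M / (1 - ‖z‖)

lemma exists_hasBlochBound {b : Cn n → ℂ} (hb : b ∈ blochSpace n) : ∃ M, HasBlochBound b M := by
  obtain ⟨hhol, M, hM⟩ := hb
  refine ⟨max M 1, hhol, by positivity, fun z hz => ?_⟩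
  have h0 : 0 < 1 - ‖z‖ := by linarith [mem_unitBall.1 hz]
  have h1 : ‖holGrad b z‖ * (1 - ‖z‖) ≤ M := hM ⟨z, hz, rfl⟩
  rw [le_div_iff₀ h0]
  calc _ ≤ ‖holGrad b z‖ * (1 - ‖z‖) := by
        gcongr
        exact norm_fderiv_le_norm_holGrad b z
    _ ≤ _ := h1.trans (le_max_left _ _)

lemma HolOnBall.differentiableAt {b : Cn n → ℂ} (hb : HolOnBall b) {z : Cn n}
    (hz : z ∈ unitBall n) : DifferentiableAt ℂ b z :=
  DifferentiableOn.differentiableAt hb (isOpen_unitBall.mem_nhds hz)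

section

variable {b : Cn n → ℂ} {M : ℝ}

lemma HasBlochBound.norm_sub_le_segment (hb : HasBlochBound b M) {x y : Cn n} {d : ℝ} (hd : 0 < d)
    (hx : ‖x‖ ≤ 1 - d) (hy : ‖y‖ ≤ 1 - d) : ‖b x - b y‖ ≤ M / d * ‖x - y‖ := by
  have hmem : ∀ u ∈ Metric.closedBall (0 : Cn n) (1 - d), u ∈ unitBall n := by
    intro u hu
    rw [mem_closedBall_zero_iff] at hu
    exact mem_unitBall.2 (by linarith)
  refine (convex_closedBall (0 : Cn n) (1 - d)).norm_image_sub_le_of_norm_fderiv_le (𝕜 := ℂ)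
    (fun u hu => hb.holomorphic.differentiableAt (hmem u hu)) (fun u hu => ?_)
    (mem_closedBall_zero_iff.2 hy) (mem_closedBall_zero_iff.2 hx)
  refine (hb.norm_fderiv_le u (hmem u hu)).trans ?_
  rw [mem_closedBall_zero_iff] at hu
  have := hb.pos
  gcongr
  linarith

/-- Moving `z` radially towards the centre by the relative amount `θ` costs a logarithm. -/
lemma HasBlochBound.norm_sub_radial_le (hb : HasBlochBound b M) {z : Cn n} (hz : z ∈ unitBall n)
    {θ : ℝ} (h0 : 0 ≤ θ) (h1 : θ ≤ 1) :
    ‖b ((1 - θ) • z) - b z‖ ≤ M * Real.log ((1 - ‖z‖ + θ) / (1 - ‖z‖)) := by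
  have hz1 := mem_unitBall.1 hz
  set δ := 1 - ‖z‖ with hδ
  have hδ0 : 0 < δ := by linarith
  have hnorm : ∀ s ∈ Set.Icc 0 θ, ‖(1 - s) • z‖ = (1 - s) * ‖z‖ := by
    intro s hs
    rw [norm_smul, Real.norm_of_nonneg (by linarith [hs.2])]
  have hmem : ∀ s ∈ Set.Icc 0 θ, (1 - s) • z ∈ unitBall n := by
    intro s hs
    rw [mem_unitBall, hnorm s hs]
    nlinarith [hs.1, norm_nonneg z]
  have hder : ∀ s ∈ Set.Icc 0 θ, HasDerivAt (fun s : ℝ => b ((1 - s) • z) - b z)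
      (fderiv ℂ b ((1 - s) • z) (-z)) s := by
    intro s hs
    have e1 : HasDerivAt (fun s : ℝ => (1 - s) • z) (-z) s := by
      have := ((hasDerivAt_id s).const_sub 1).smul_const z
      simpa using this
    have e2 := (hb.holomorphic.differentiableAt (hmem s hs)).hasFDerivAt.restrictScalars ℝ
    exact (e2.comp_hasDerivAt s e1).sub_const _
  have key := image_norm_le_of_norm_deriv_right_le_deriv_boundary'
    (f := fun s : ℝ => b ((1 - s) • z) - b z) (a := 0) (b := θ)
    (f' := fun s => fderiv ℂ b ((1 - s) • z) (-z))
    (B := fun s => M * Real.log ((δ + s) / δ)) (B' := fun s => M * (1 / (δ + s)))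
    (fun s hs => (hder s hs).continuousAt.continuousWithinAt)
    (fun s hs => (hder s ⟨hs.1, hs.2.le⟩).hasDerivWithinAt)
    (by simp [hδ0.ne']) ?_ ?_ ?_
  · exact key (Set.right_mem_Icc.2 h0)
  · intro s hs
    have : (δ + s) / δ ≠ 0 := by have := hs.1; positivity
    refine ContinuousAt.continuousWithinAt ?_
    fun_prop (disch := assumption)
  · intro s hs
    have hs0 : 0 < δ + s := by linarith [hs.1]
    have e1 : HasDerivAt (fun s => (δ + s) / δ) (1 / δ) s :=
      ((hasDerivAt_id s).const_add δ).div_const δ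
    have e2 := (e1.log (by positivity)).const_mul M
    have e3 : M * (1 / δ / ((δ + s) / δ)) = M * (1 / (δ + s)) := by field_simp
    rw [e3] at e2
    exact e2.hasDerivWithinAt
  · intro s hs
    have hs' : s ∈ Set.Icc 0 θ := ⟨hs.1, hs.2.le⟩
    have hs0 : 0 < δ + s := by linarith [hs.1]
    refine (ContinuousLinearMap.le_opNorm _ _).trans ?_
    rw [norm_neg]
    refine (mul_le_mul_of_nonneg_right (hb.norm_fderiv_le _ (hmem s hs')) (norm_nonneg z)).trans ?_
    rw [hnorm s hs']
    have hpos : 0 < 1 - (1 - s) * ‖z‖ := by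
      have := mem_unitBall.1 (hmem s hs'); rw [hnorm s hs'] at this; linarith
    have := hb.pos
    rw [div_mul_eq_mul_div, mul_div_assoc]
    refine mul_le_mul_of_nonneg_left ?_ this.le
    rw [div_le_div_iff₀ hpos hs0]
    nlinarith [hs.1, hs.2, norm_nonneg z, mul_nonneg hs.1 hδ0.le]

/-- The complex line through `z` and `w` stays close to the unit ball for `|ζ|` up to about the
inverse square root of `qdist z w`. -/
lemma norm_sq_add_smul_sub_le {z w : Cn n} (hz : ‖z‖ ≤ 1) (hw : ‖w‖ ≤ 1) (ζ : ℂ) :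
    ‖z + ζ • (w - z)‖ ^ 2 ≤ 1 + 6 * ‖ζ‖ * qdist z w + 2 * ‖ζ‖ ^ 2 * qdist z w := by
  have h1 : ‖w - z‖ ^ 2 ≤ 2 * qdist z w := by
    have e1 := norm_sub_sq (𝕜 := ℂ) w z
    have e2 : RCLike.re (1 - herm z w) ≤ qdist z w := RCLike.re_le_norm _
    have e3 : RCLike.re (1 - herm z w) = 1 - RCLike.re (inner ℂ w z : ℂ) := by
      simp [herm]
    nlinarith [norm_nonneg w, norm_nonneg z]
  have h2 : ‖(inner ℂ z (w - z) : ℂ)‖ ≤ 3 * qdist z w := by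
    have e1 : (inner ℂ z (w - z) : ℂ) = ((1 : ℂ) - herm z z) - (1 - herm w z) := by
      rw [inner_sub_right]; unfold herm; ring
    rw [e1]
    refine (norm_sub_le _ _).trans ?_
    have e2 : ‖(1 : ℂ) - herm z z‖ = qdist z z := rfl
    have e3 : ‖(1 : ℂ) - herm w z‖ = qdist w z := rfl
    rw [e2, e3, qdist_comm w z]
    have := qdist_self_le hz
    have := one_sub_norm_le_qdist (z := z) hw
    linarith
  have h3 := norm_add_sq (𝕜 := ℂ) z (ζ • (w - z))
  have h4 : RCLike.re (inner ℂ z (ζ • (w - z)) : ℂ) ≤ ‖ζ‖ * (3 * qdist z w) := by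
    refine (RCLike.re_le_norm _).trans ?_
    rw [inner_smul_right, norm_mul]
    gcongr
  rw [h3, norm_smul, mul_pow]
  nlinarith [norm_nonneg z, mul_le_mul_of_nonneg_left h1 (sq_nonneg ‖ζ‖)]

/-- The variation of `u ↦ b ((1 - θ) u) - b ((1 - 4θ) u)` between `z` and `w`. This function is
bounded by a multiple of `M` on the disc `|ζ| < R` of the complex line `u = z + ζ (w - z)`, where
`R ^ 2 = θ / (16 * qdist z w)`, so the Schwarz lemma gains the factor `1 / R`. -/
lemma HasBlochBound.norm_sub_dilate_step (hb : HasBlochBound b M) {z w : Cn n}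
    (hz : z ∈ unitBall n) (hw : w ∈ unitBall n) {θ : ℝ} (hθ : 64 * qdist z w ≤ θ)
    (hθ1 : θ < 1 / 4) :
    ‖(b ((1 - θ) • z) - b ((1 - 4 * θ) • z)) - (b ((1 - θ) • w) - b ((1 - 4 * θ) • w))‖ ≤
      48 * M * Real.sqrt (qdist z w / θ) := by
  have hz1 := mem_unitBall.1 hz
  have hw1 := mem_unitBall.1 hw
  have hD : 0 < qdist z w := qdist_pos hz1 hw1.le
  set D := qdist z w with hDdef
  have hM := hb.pos
  have hθ0 : 0 < θ := by linarith
  set R := Real.sqrt (θ / (16 * D)) with hR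
  have hR2 : R ^ 2 = θ / (16 * D) := Real.sq_sqrt (by positivity)
  have hRge : 2 ≤ R := by
    refine Real.le_sqrt_of_sq_le ?_
    rw [le_div_iff₀ (by positivity)]; linarith
  set L : ℂ → Cn n := fun ζ => z + ζ • (w - z) with hL
  have hLn : ∀ ζ ∈ Metric.ball (0 : ℂ) R, ‖L ζ‖ ≤ 1 + θ / 4 := by
    intro ζ hζ
    rw [mem_ball_zero_iff] at hζ
    refine le_of_sq_le_sq ?_ (by linarith)
    refine (norm_sq_add_smul_sub_le hz1.le hw1.le ζ).trans ?_
    have e1 : R ^ 2 * D = θ / 16 := by rw [hR2]; field_simp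
    have e2 : ‖ζ‖ * D ≤ R * D := by gcongr
    have e3 : ‖ζ‖ ^ 2 * D ≤ R ^ 2 * D := by gcongr
    have e4 : 2 * (R * D) ≤ R ^ 2 * D := by nlinarith
    rw [← hDdef]
    nlinarith
  have hin : ∀ ζ ∈ Metric.ball (0 : ℂ) R, ∀ s : ℝ, θ ≤ s → s ≤ 1 →
      ‖(1 - s) • L ζ‖ ≤ 1 - 3 * θ / 4 := by
    intro ζ hζ s hs hs1
    rw [norm_smul, Real.norm_of_nonneg (by linarith)]
    calc _ ≤ (1 - θ) * (1 + θ / 4) := by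
          gcongr
          · linarith
          · exact hLn ζ hζ
      _ ≤ _ := by nlinarith
  set ψ : ℂ → ℂ := fun ζ => b ((1 - θ) • L ζ) - b ((1 - 4 * θ) • L ζ) with hψ
  have hψn : ∀ ζ ∈ Metric.ball (0 : ℂ) R, ‖ψ ζ‖ ≤ 6 * M := by
    intro ζ hζ
    have e1 := hb.norm_sub_le_segment (d := 3 * θ / 4) (by positivity)
      (hin ζ hζ θ le_rfl (by linarith)) (hin ζ hζ (4 * θ) (by linarith) (by linarith))
    refine e1.trans ?_
    rw [← sub_smul, norm_smul, show 1 - θ - (1 - 4 * θ) = 3 * θ by ring,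
      Real.norm_of_nonneg (by positivity)]
    have e2 := hLn ζ hζ
    calc M / (3 * θ / 4) * (3 * θ * ‖L ζ‖) = 4 * M * ‖L ζ‖ := by field_simp
      _ ≤ 4 * M * (1 + θ / 4) := by gcongr
      _ ≤ _ := by nlinarith
  have hdiff : DifferentiableOn ℂ ψ (Metric.ball 0 R) := by
    intro ζ hζ
    refine DifferentiableAt.differentiableWithinAt ?_
    have hLd : DifferentiableAt ℂ L ζ := by
      rw [hL]; fun_prop
    have aux : ∀ s : ℝ, θ ≤ s → s ≤ 1 → DifferentiableAt ℂ (fun ζ => b ((1 - s) • L ζ)) ζ := by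
      intro s hs hs1
      have hmem : (1 - s) • L ζ ∈ unitBall n :=
        mem_unitBall.2 (by linarith [hin ζ hζ s hs hs1])
      exact (hb.holomorphic.differentiableAt hmem).comp ζ (hLd.const_smul (1 - s))
    exact (aux θ le_rfl (by linarith)).sub (aux (4 * θ) (by linarith) (by linarith))
  have h0mem : (0 : ℂ) ∈ Metric.ball (0 : ℂ) R := Metric.mem_ball_self (by linarith)
  have h1mem : (1 : ℂ) ∈ Metric.ball (0 : ℂ) R := by
    rw [mem_ball_zero_iff, norm_one]; linarith
  have hmaps : Set.MapsTo ψ (Metric.ball 0 R) (Metric.closedBall (ψ 0) (12 * M)) := by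
    intro ζ hζ
    rw [Metric.mem_closedBall, dist_eq_norm]
    refine (norm_sub_le _ _).trans ?_
    linarith [hψn ζ hζ, hψn 0 h0mem]
  have hS := Complex.dist_le_div_mul_dist_of_mapsTo_ball hdiff hmaps h1mem
  have hψ0 : ψ 0 = b ((1 - θ) • z) - b ((1 - 4 * θ) • z) := by simp [hψ, hL]
  have hψ1 : ψ 1 = b ((1 - θ) • w) - b ((1 - 4 * θ) • w) := by
    simp only [hψ, hL, one_smul, add_sub_cancel]
  rw [dist_eq_norm, hψ0, hψ1, norm_sub_rev, dist_zero_right, norm_one, mul_one] at hS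
  refine hS.trans (le_of_eq ?_)
  have hRs : R = (Real.sqrt (D / θ))⁻¹ / 4 := by
    rw [hR, ← Real.sqrt_inv, inv_div, show θ / (16 * D) = (θ / D) / 4 ^ 2 by field_simp; norm_num,
      Real.sqrt_div' _ (by norm_num), Real.sqrt_sq (by norm_num)]
  rw [hRs]
  have : 0 < Real.sqrt (D / θ) := Real.sqrt_pos.2 (by positivity)
  field_simp
  norm_num

/-- At depth `θ ≥ 64 * qdist z w` the values along `z` and `w` differ by a bounded amount: the
errors of `norm_sub_dilate_step` at depths `θ, 4θ, 16θ, …` form a geometric series. -/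
lemma HasBlochBound.norm_sub_dilate_le (hb : HasBlochBound b M) {z w : Cn n}
    (hz : z ∈ unitBall n) (hw : w ∈ unitBall n) {θ : ℝ} (hθ : 64 * qdist z w ≤ θ)
    (hθ1 : θ ≤ 1) : ‖b ((1 - θ) • z) - b ((1 - θ) • w)‖ ≤ 20 * M := by
  have hz1 := mem_unitBall.1 hz
  have hw1 := mem_unitBall.1 hw
  have hD : 0 < qdist z w := qdist_pos hz1 hw1.le
  have hM := hb.pos
  have base : ∀ θ : ℝ, 1 / 4 ≤ θ → θ ≤ 1 → ‖b ((1 - θ) • z) - b ((1 - θ) • w)‖ ≤ 8 * M := by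
    intro θ h1 h2
    have e : ∀ v : Cn n, ‖v‖ < 1 → ‖(1 - θ) • v‖ ≤ 1 - 1 / 4 := by
      intro v hv
      rw [norm_smul, Real.norm_of_nonneg (by linarith)]
      nlinarith [norm_nonneg v]
    have e1 := hb.norm_sub_le_segment (d := 1 / 4) (by norm_num) (e z hz1) (e w hw1)
    refine e1.trans ?_
    have e2 := (norm_sub_le ((1 - θ) • z) ((1 - θ) • w)).trans (add_le_add (e z hz1) (e w hw1))
    calc _ ≤ M / (1 / 4) * (1 - 1 / 4 + (1 - 1 / 4)) := by gcongr
      _ ≤ _ := by linarith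
  -- the coefficient `96` solves `48 + 96 / 2 = 96`, since passing from `θ` to `4θ` halves the root
  have step : ∀ k : ℕ, ∀ θ : ℝ, 64 * qdist z w ≤ θ → θ ≤ 1 → (1 / 4 : ℝ) ^ (k + 1) ≤ θ →
      ‖b ((1 - θ) • z) - b ((1 - θ) • w)‖ ≤ M * (8 + 96 * Real.sqrt (qdist z w / θ)) := by
    intro k
    induction k with
    | zero =>
      intro θ h1 h2 h3
      refine (base θ (by simpa using h3) h2).trans ?_
      nlinarith [Real.sqrt_nonneg (qdist z w / θ)]
    | succ k ih =>
      intro θ h1 h2 h3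
      rcases le_or_gt (1 / 4) θ with h4 | h4
      · refine (base θ h4 h2).trans ?_
        nlinarith [Real.sqrt_nonneg (qdist z w / θ)]
      · have h5 := hb.norm_sub_dilate_step hz hw h1 h4
        have h6 := ih (4 * θ) (by linarith) (by linarith) (by rw [pow_succ] at h3; linarith)
        have h7 : Real.sqrt (qdist z w / (4 * θ)) = Real.sqrt (qdist z w / θ) / 2 := by
          rw [show qdist z w / (4 * θ) = (qdist z w / θ) / 2 ^ 2 by
            rw [div_div]; congr 1; ring, Real.sqrt_div' _ (by norm_num),
            Real.sqrt_sq (by norm_num)]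
        rw [h7] at h6
        have h8 : b ((1 - θ) • z) - b ((1 - θ) • w) =
            ((b ((1 - θ) • z) - b ((1 - 4 * θ) • z)) - (b ((1 - θ) • w) - b ((1 - 4 * θ) • w))) +
            (b ((1 - 4 * θ) • z) - b ((1 - 4 * θ) • w)) := by ring
        rw [h8]
        refine (norm_add_le _ _).trans ((add_le_add h5 h6).trans (le_of_eq ?_))
        ring
  have hθ0 : 0 < θ := by linarith
  obtain ⟨k, hk⟩ := exists_pow_lt_of_lt_one hθ0 (show (1 / 4 : ℝ) < 1 by norm_num)
  have h1 := step k θ hθ hθ1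
    ((pow_le_pow_of_le_one (by norm_num) (by norm_num) (Nat.le_succ k)).trans hk.le)
  have h2 : Real.sqrt (qdist z w / θ) ≤ 1 / 8 := by
    refine Real.sqrt_le_iff.2 ⟨by norm_num, ?_⟩
    rw [div_le_iff₀ hθ0]; linarith
  nlinarith

/-- The two-point estimate for Bloch functions. Both points are moved radially to depth comparable
to `qdist z w`, which costs `log (qdist z w / (1 - ‖v‖))` for `v = z, w`, and there the values are
compared by `norm_sub_dilate_le`. For `z` the logarithm is replaced by a power. -/
lemma HasBlochBound.norm_sub_le_qdist (hb : HasBlochBound b M) {z w : Cn n}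
    (hz : z ∈ unitBall n) (hw : w ∈ unitBall n) :
    ‖b z - b w‖ ≤ 150 * M * ((qdist z w / (1 - ‖z‖)) ^ (1 / 4 : ℝ) *
      (1 + Real.log (qdist z w / (1 - ‖w‖)))) := by
  have hz1 := mem_unitBall.1 hz
  have hw1 := mem_unitBall.1 hw
  have hD : 0 < qdist z w := qdist_pos hz1 hw1.le
  have hDz : 1 - ‖z‖ ≤ qdist z w := one_sub_norm_le_qdist hw1.le
  have hDw : 1 - ‖w‖ ≤ qdist z w := one_sub_norm_le_qdist' hz1.le
  have hM := hb.pos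
  set D := qdist z w
  set θ := min 1 (64 * D) with hθ
  have hθ0 : 0 ≤ θ := by positivity
  have hθ1 : θ ≤ 1 := min_le_left _ _
  have hmid : ‖b ((1 - θ) • z) - b ((1 - θ) • w)‖ ≤ 20 * M := by
    rcases le_or_gt (64 * D) 1 with h | h
    · exact hb.norm_sub_dilate_le hz hw (by rw [hθ, min_eq_right h]) hθ1
    · have : θ = 1 := min_eq_left h.le
      rw [this]; simp; positivity
  have hrad : ∀ v ∈ unitBall n, 1 - ‖v‖ ≤ D →
      ‖b ((1 - θ) • v) - b v‖ ≤ M * (5 + Real.log (D / (1 - ‖v‖))) := by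
    intro v hv hvD
    have hv0 : 0 < 1 - ‖v‖ := by linarith [mem_unitBall.1 hv]
    refine (hb.norm_sub_radial_le hv hθ0 hθ1).trans ?_
    refine mul_le_mul_of_nonneg_left ?_ hM.le
    have e1 : (1 - ‖v‖ + θ) / (1 - ‖v‖) ≤ 65 * (D / (1 - ‖v‖)) := by
      rw [← mul_div_assoc]
      gcongr
      linarith [min_le_right 1 (64 * D)]
    have e2 : Real.log 65 ≤ 5 := by
      have h3 : Real.log 65 ≤ Real.log 128 := Real.log_le_log (by norm_num) (by norm_num)
      have h4 : Real.log 128 = 7 * Real.log 2 := by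
        rw [show (128 : ℝ) = 2 ^ 7 by norm_num, Real.log_pow]; norm_num
      have := Real.log_two_lt_d9
      linarith
    calc _ ≤ Real.log (65 * (D / (1 - ‖v‖))) := Real.log_le_log (by positivity) e1
      _ = Real.log 65 + Real.log (D / (1 - ‖v‖)) :=
        Real.log_mul (by norm_num) (by positivity)
      _ ≤ _ := by gcongr
  have h1 := hrad z hz hDz
  have h2 := hrad w hw hDw
  have hz0 : 0 < 1 - ‖z‖ := by linarith
  have hw0 : 0 < 1 - ‖w‖ := by linarith
  have htot : ‖b z - b w‖ ≤
      M * (30 + Real.log (D / (1 - ‖z‖)) + Real.log (D / (1 - ‖w‖))) := by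
    have e : b z - b w = (b ((1 - θ) • z) - b ((1 - θ) • w)) - (b ((1 - θ) • z) - b z) +
        (b ((1 - θ) • w) - b w) := by ring
    rw [e]
    refine (norm_add_le _ _).trans ?_
    have := norm_sub_le (b ((1 - θ) • z) - b ((1 - θ) • w)) (b ((1 - θ) • z) - b z)
    linarith
  have hlz : 1 ≤ D / (1 - ‖z‖) := (one_le_div hz0).2 hDz
  have hlw : 0 ≤ Real.log (D / (1 - ‖w‖)) := Real.log_nonneg ((one_le_div hw0).2 hDw)
  have hx : 1 ≤ (D / (1 - ‖z‖)) ^ (1 / 4 : ℝ) := Real.one_le_rpow hlz (by norm_num)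
  have hlogx : Real.log (D / (1 - ‖z‖)) ≤ 4 * (D / (1 - ‖z‖)) ^ (1 / 4 : ℝ) := by
    have := Real.log_le_rpow_div (x := D / (1 - ‖z‖)) (by positivity) (ε := 1 / 4) (by norm_num)
    linarith
  refine htot.trans ?_
  generalize (D / (1 - ‖z‖)) ^ (1 / 4 : ℝ) = x at *
  generalize Real.log (D / (1 - ‖w‖)) = y at *
  have : 30 + Real.log (D / (1 - ‖z‖)) + y ≤ 150 * (x * (1 + y)) := by nlinarith
  calc _ ≤ M * (150 * (x * (1 + y))) := by gcongr
    _ = _ := by ring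

end

/-! ### The commutator with a Bloch function -/

lemma one_sub_herm_ne_zero {z w : Cn n} (hz : z ∈ unitBall n) (hw : w ∈ unitBall n) :
    1 - herm z w ≠ 0 := by
  have : 0 < qdist z w := qdist_pos (mem_unitBall.1 hz) (mem_unitBall.1 hw).le
  exact norm_pos_iff.1 this

lemma continuous_herm_right (z : Cn n) : Continuous fun w => herm z w := by
  unfold herm; fun_prop

/-- For fixed `z` in the ball the Bergman kernel is bounded above and below on the ball, so it does
not affect integrability. -/
lemma integrable_div_kernel_iff {A : Set (Cn n)} (hA : MeasurableSet A) (hAB : A ⊆ unitBall n)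
    {f : Cn n → ℂ} {z : Cn n} (hz : z ∈ unitBall n) :
    IntegrableOn (fun w => f w / (1 - herm z w) ^ (n + 1)) A ↔ IntegrableOn f A := by
  have hm : Measurable fun w : Cn n => (1 - herm z w) ^ (n + 1) :=
    ((continuous_const.sub (continuous_herm_right z)).pow _).measurable
  constructor
  · intro h
    have h1 : IntegrableOn (fun w => (1 - herm z w) ^ (n + 1) *
        (f w / (1 - herm z w) ^ (n + 1))) A := by
      refine Integrable.bdd_mul (c := 2 ^ (n + 1)) h hm.aestronglyMeasurable ?_
      filter_upwards [ae_restrict_mem hA] with w hw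
      rw [norm_pow]
      have : ‖1 - herm z w‖ ≤ 2 := qdist_le_two (mem_unitBall.1 hz).le (mem_unitBall.1 (hAB hw)).le
      gcongr
    refine h1.congr ?_
    filter_upwards [ae_restrict_mem hA] with w hw
    have := one_sub_herm_ne_zero hz (hAB hw)
    field_simp
  · intro h
    have h1 : IntegrableOn (fun w => ((1 - herm z w) ^ (n + 1))⁻¹ * f w) A := by
      refine Integrable.bdd_mul (c := ((1 - ‖z‖) ^ (n + 1))⁻¹) h hm.inv.aestronglyMeasurable ?_
      filter_upwards [ae_restrict_mem hA] with w hw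
      rw [norm_inv, norm_pow]
      have h0 : 0 < 1 - ‖z‖ := by linarith [mem_unitBall.1 hz]
      have : 1 - ‖z‖ ≤ ‖1 - herm z w‖ := one_sub_norm_le_qdist (mem_unitBall.1 (hAB hw)).le
      gcongr
    refine h1.congr (Filter.Eventually.of_forall fun w => ?_)
    simp only; rw [div_eq_inv_mul]

lemma bergmanCommutator_eq {a f : Cn n → ℂ} {z : Cn n} (hz : z ∈ unitBall n)
    (hf : IntegrableOn f (unitBall n)) (haf : IntegrableOn (fun w => a w * f w) (unitBall n)) :
    bergmanCommutator a f z = ((n.factorial : ℂ) / (Real.pi : ℂ) ^ n) *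
      ∫ w in unitBall n, (a z - a w) * f w / (1 - herm z w) ^ (n + 1) := by
  unfold bergmanCommutator bergmanProj
  rw [mul_left_comm, ← mul_sub, ← integral_const_mul, ← integral_sub]
  · congr 1
    refine integral_congr_ae (Filter.Eventually.of_forall fun w => ?_)
    simp only; ring
  · exact ((integrable_div_kernel_iff measurableSet_unitBall subset_rfl hz).2 hf).const_mul _
  · exact (integrable_div_kernel_iff measurableSet_unitBall subset_rfl hz).2 haf

lemma norm_bergmanCommutator_le {b f : Cn n → ℂ} {z : Cn n} (hz : z ∈ unitBall n)
    (hf : IntegrableOn f (unitBall n))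
    (hbf : IntegrableOn (fun w => conjFun b w * f w) (unitBall n)) :
    ENNReal.ofReal ‖bergmanCommutator (conjFun b) f z‖ ≤
      ∫⁻ w in unitBall n, ENNReal.ofReal ((n.factorial / Real.pi ^ n) *
        (‖b z - b w‖ * (qdist z w ^ (n + 1))⁻¹ * ‖f w‖)) := by
  rw [bergmanCommutator_eq hz hf hbf, ← integral_const_mul, ofReal_norm]
  refine (enorm_integral_le_lintegral_enorm _).trans (lintegral_mono fun w => ?_)
  rw [← ofReal_norm]
  apply ENNReal.ofReal_le_ofReal
  apply le_of_eq
  have h1 : ‖conjFun b z - conjFun b w‖ = ‖b z - b w‖ := by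
    unfold conjFun
    rw [← star_sub, norm_star]
  rw [norm_mul, norm_div, norm_div, norm_mul, h1, norm_pow, norm_pow]
  simp only [Complex.norm_natCast, Complex.norm_real, Real.norm_eq_abs, abs_of_pos Real.pi_pos]
  unfold qdist
  ring

lemma volume_unitBall_lt_top : volume (unitBall n) < ⊤ := measure_ball_lt_top

lemma HasBlochBound.integrableOn [NeZero n] {b : Cn n → ℂ} {M : ℝ} (hb : HasBlochBound b M) :
    IntegrableOn b (unitBall n) := by
  have hmeas : AEStronglyMeasurable b (volume.restrict (unitBall n)) :=
    (DifferentiableOn.continuousOn hb.holomorphic).aestronglyMeasurable measurableSet_unitBall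
  have h0 : (0 : Cn n) ∈ unitBall n := mem_unitBall.2 (by simp)
  obtain ⟨C, hC, hbox⟩ := exists_lintegral_qBall_le n
  have hM := hb.pos
  have hw : ∀ w ∈ unitBall n, ‖b w - b 0‖ ≤ 750 * M * (1 - ‖w‖) ^ (-(3 / 4) : ℝ) := by
    intro w hw
    have hw0 : 0 < 1 - ‖w‖ := by linarith [mem_unitBall.1 hw]
    have hw1 : 1 - ‖w‖ ≤ 1 := by linarith [norm_nonneg w]
    have h1 := hb.norm_sub_le_qdist h0 hw
    have h2 : qdist (0 : Cn n) w = 1 := by simp [qdist, herm]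
    rw [h2, norm_zero, sub_zero, div_one, Real.one_rpow, one_mul] at h1
    rw [norm_sub_rev]
    refine h1.trans ?_
    have h3 : Real.log (1 / (1 - ‖w‖)) ≤ 4 * (1 - ‖w‖) ^ (-(3 / 4) : ℝ) := by
      have h4 := Real.log_le_rpow_div (x := 1 / (1 - ‖w‖)) (by positivity) (ε := 3 / 4)
        (by norm_num)
      rw [one_div, Real.inv_rpow hw0.le, ← Real.rpow_neg hw0.le] at h4
      have : 0 ≤ (1 - ‖w‖) ^ (-(3 / 4) : ℝ) := by positivity
      rw [one_div]; linarith
    have h5 : 1 ≤ (1 - ‖w‖) ^ (-(3 / 4) : ℝ) :=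
      Real.one_le_rpow_of_pos_of_le_one_of_nonpos hw0 hw1 (by norm_num)
    nlinarith
  have hint : IntegrableOn (fun w => b w - b 0) (unitBall n) := by
    refine ⟨hmeas.sub aestronglyMeasurable_const, ?_⟩
    calc ∫⁻ w in unitBall n, ‖b w - b 0‖ₑ
        ≤ ∫⁻ w in unitBall n, ENNReal.ofReal (750 * M) *
          ENNReal.ofReal ((1 - ‖w‖) ^ (-(3 / 4) : ℝ)) := by
          refine setLIntegral_mono' measurableSet_unitBall fun w hw' => ?_
          rw [← ofReal_norm, ← ENNReal.ofReal_mul (by positivity)]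
          exact ENNReal.ofReal_le_ofReal (hw w hw')
      _ = ENNReal.ofReal (750 * M) * ∫⁻ w in unitBall n,
          ENNReal.ofReal ((1 - ‖w‖) ^ (-(3 / 4) : ℝ)) :=
          lintegral_const_mul' _ _ ENNReal.ofReal_ne_top
      _ < ⊤ := by
          refine ENNReal.mul_lt_top ENNReal.ofReal_lt_top ?_
          have hsub : unitBall n ⊆ qBall (0 : Cn n) 2 := fun w hw' =>
            ⟨hw', by simp [qdist, herm]⟩
          exact ((lintegral_mono_set hsub).trans (hbox 0 h0 2 (by norm_num))).trans_lt
            ENNReal.ofReal_lt_top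
  have : IntegrableOn (fun w => (b w - b 0) + b 0) (unitBall n) :=
    hint.add (integrableOn_const (by exact volume_unitBall_lt_top.ne))
  simpa using this

/-- The `L log L` distributional inequality of the commutator with a Bloch function, for all bounded
measurable functions, of compact support or not. -/
theorem exists_volume_levelSet_le [NeZero n] {b : Cn n → ℂ} (hb : b ∈ blochSpace n) :
    ∃ C : ℝ, 0 < C ∧ ∀ f : Cn n → ℂ, AEMeasurable f volume → (∃ M : ℝ, ∀ z, ‖f z‖ ≤ M) →
      ∀ t : ℝ, 0 < t →
        volume (levelSet b f t) ≤
          ENNReal.ofReal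
            (C * ∫ z in unitBall n, ‖f z‖ / t * (1 + Real.posLog (‖f z‖ / t))) := by
  obtain ⟨M, hM⟩ := exists_hasBlochBound hb
  have hM0 := hM.pos
  obtain ⟨C, hC, hweak⟩ := exists_volume_logKernel_le n
  set K : ℝ := n.factorial / Real.pi ^ n * (150 * M) with hK
  have hK0 : 0 < K := by
    have : (0 : ℝ) < n.factorial := by exact_mod_cast n.factorial_pos
    positivity
  have hplK : 0 ≤ Real.posLog K := Real.posLog_nonneg
  refine ⟨C * (K * (1 + Real.posLog K)), by positivity, fun f hf hbdd t ht => ?_⟩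
  obtain ⟨A, hA⟩ := hbdd
  have hA0 : 0 ≤ A := (norm_nonneg _).trans (hA 0)
  have hfint : IntegrableOn f (unitBall n) := by
    refine Measure.integrableOn_of_bounded (M := A) volume_unitBall_lt_top.ne
      hf.aestronglyMeasurable (Filter.Eventually.of_forall hA)
  have hbfint : IntegrableOn (fun w => conjFun b w * f w) (unitBall n) := by
    have h1 : IntegrableOn (conjFun b) (unitBall n) := by
      have h2 := hM.integrableOn
      have h3 : AEStronglyMeasurable (conjFun b) (volume.restrict (unitBall n)) :=
        continuous_star.comp_aestronglyMeasurable h2.aestronglyMeasurable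
      refine Integrable.mono h2 h3 (Filter.Eventually.of_forall fun w => ?_)
      simp [conjFun]
    exact Integrable.mul_bdd (c := A) h1 hf.aestronglyMeasurable.restrict
      (Filter.Eventually.of_forall hA)
  -- the weak type inequality for the positive kernel is stated for measurable functions
  set f' := hf.mk f with hf'
  have hff' : f =ᵐ[volume] f' := hf.ae_eq_mk
  have hf'm : Measurable f' := hf.measurable_mk
  set g : Cn n → ℝ := fun w => K * (‖f' w‖ / t) with hg
  have hgm : Measurable g := by fun_prop
  have hg0 : ∀ w, 0 ≤ g w := fun w => by positivity
  have hsub : levelSet b f t ⊆ {z | z ∈ unitBall n ∧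
      1 < ∫⁻ w in unitBall n, ENNReal.ofReal (logKernel z w * g w)} := by
    rintro z ⟨hz, hzt⟩
    refine ⟨hz, ?_⟩
    have h1 := norm_bergmanCommutator_le hz hfint hbfint
    have h2 : ∫⁻ w in unitBall n, ENNReal.ofReal ((n.factorial / Real.pi ^ n) *
        (‖b z - b w‖ * (qdist z w ^ (n + 1))⁻¹ * ‖f w‖)) ≤
        ENNReal.ofReal t * ∫⁻ w in unitBall n, ENNReal.ofReal (logKernel z w * g w) := by
      rw [← lintegral_const_mul' _ _ ENNReal.ofReal_ne_top]
      refine lintegral_mono_ae ?_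
      filter_upwards [ae_restrict_mem measurableSet_unitBall, ae_restrict_of_ae hff'] with w hw hfw
      rw [← ENNReal.ofReal_mul ht.le]
      apply ENNReal.ofReal_le_ofReal
      have h3 := hM.norm_sub_le_qdist hz hw
      have hD := qdist_nonneg z w
      rw [hfw]
      calc _ ≤ (n.factorial / Real.pi ^ n) * ((150 * M * ((qdist z w / (1 - ‖z‖)) ^ (1 / 4 : ℝ) *
            (1 + Real.log (qdist z w / (1 - ‖w‖))))) * (qdist z w ^ (n + 1))⁻¹ * ‖f' w‖) := by
            gcongr
        _ = _ := by
            rw [hg, hK]; unfold logKernel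
            field_simp
    have h4 := ((ENNReal.ofReal_lt_ofReal_iff (ht.trans hzt)).2 hzt).trans_le (h1.trans h2)
    by_contra h5
    push Not at h5
    have h6 : ENNReal.ofReal t * ∫⁻ w in unitBall n, ENNReal.ofReal (logKernel z w * g w) ≤
        ENNReal.ofReal t := by
      calc _ ≤ ENNReal.ofReal t * 1 := by gcongr
        _ = _ := mul_one _
    exact absurd (h4.trans_le h6) (lt_irrefl _)
  refine (measure_mono hsub).trans ((hweak g hgm hg0).trans ?_)
  set Φ : Cn n → ℝ := fun z => ‖f z‖ / t * (1 + Real.posLog (‖f z‖ / t)) with hΦ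
  have hΦ0 : ∀ z, 0 ≤ Φ z := fun z => by
    have : 0 ≤ Real.posLog (‖f z‖ / t) := Real.posLog_nonneg
    positivity
  have hpm : Measurable Real.posLog := by unfold Real.posLog; fun_prop
  have hΦint : IntegrableOn Φ (unitBall n) := by
    refine Measure.integrableOn_of_bounded (M := A / t * (1 + Real.posLog (A / t)))
      volume_unitBall_lt_top.ne ?_ (Filter.Eventually.of_forall fun z => ?_)
    · have h1 : AEMeasurable (fun z => ‖f z‖ / t) volume := hf.norm.div_const t
      exact (h1.mul ((hpm.comp_aemeasurable h1).const_add 1)).aestronglyMeasurable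
    · rw [Real.norm_of_nonneg (hΦ0 z)]
      have h1 : Real.posLog (‖f z‖ / t) ≤ Real.posLog (A / t) :=
        Real.posLog_le_posLog (by positivity) (by gcongr; exact hA z)
      have h2 : 0 ≤ Real.posLog (‖f z‖ / t) := Real.posLog_nonneg
      have := hA z
      simp only [hΦ]
      gcongr
  have hcmp : ∫⁻ w in unitBall n, ENNReal.ofReal (g w * (1 + Real.posLog (g w))) ≤
      ENNReal.ofReal (K * (1 + Real.posLog K)) * ∫⁻ w in unitBall n, ENNReal.ofReal (Φ w) := by
    rw [← lintegral_const_mul' _ _ ENNReal.ofReal_ne_top]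
    refine lintegral_mono_ae ?_
    filter_upwards [ae_restrict_of_ae hff'] with w hfw
    rw [← ENNReal.ofReal_mul (by positivity)]
    apply ENNReal.ofReal_le_ofReal
    simp only [hg, hΦ, ← hfw]
    set x := ‖f w‖ / t
    have hx : 0 ≤ x := by positivity
    have h1 : Real.posLog (K * x) ≤ Real.posLog K + Real.posLog x := Real.posLog_mul
    have h2 : 0 ≤ Real.posLog x := Real.posLog_nonneg
    calc _ ≤ K * x * (1 + (Real.posLog K + Real.posLog x)) := by gcongr
      _ ≤ K * x * ((1 + Real.posLog K) * (1 + Real.posLog x)) := by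
          gcongr
          nlinarith [mul_nonneg hplK h2]
      _ = _ := by ring
  calc _ ≤ ENNReal.ofReal C * (ENNReal.ofReal (K * (1 + Real.posLog K)) *
        ∫⁻ w in unitBall n, ENNReal.ofReal (Φ w)) := by gcongr
    _ = _ := by
        rw [← ofReal_integral_eq_lintegral_ofReal hΦint (Filter.Eventually.of_forall hΦ0),
          ← ENNReal.ofReal_mul (by positivity), ← ENNReal.ofReal_mul hC.le, ← mul_assoc]

theorem lLogLInequality_of_mem_blochSpace [NeZero n] {b : Cn n → ℂ} (hb : b ∈ blochSpace n) :
    LLogLInequality b := by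
  obtain ⟨C, hC, h⟩ := exists_volume_levelSet_le hb
  exact ⟨C, hC, fun f hf hM _ _ t ht => h f hf hM t ht⟩

lemma integral_charFun_posLog {A : Set (Cn n)} (hA : NullMeasurableSet A volume)
    (hAB : A ⊆ unitBall n) {t : ℝ} (ht : 1 < t) :
    ∫ z in unitBall n, ‖charFun A z‖ / t * (1 + Real.posLog (‖charFun A z‖ / t)) =
      volume.real A / t := by
  have h1 : ∀ z, ‖charFun A z‖ / t * (1 + Real.posLog (‖charFun A z‖ / t)) =
      A.indicator (fun _ => 1 / t) z := by
    intro z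
    unfold charFun
    by_cases hz : z ∈ A
    · rw [Set.indicator_of_mem hz, Set.indicator_of_mem hz, norm_one]
      have : Real.posLog (1 / t) = 0 := by
        rw [Real.posLog_eq_zero_iff, abs_of_pos (by positivity)]
        exact (div_le_one (by linarith)).2 ht.le
      rw [this]; ring
    · rw [Set.indicator_of_notMem hz, Set.indicator_of_notMem hz]; simp
  simp only [h1]
  have hA' : NullMeasurableSet A (volume.restrict (unitBall n)) :=
    hA.mono_ac Measure.restrict_le_self.absolutelyContinuous
  rw [integral_indicator₀ hA', setIntegral_const, measureReal_def, measureReal_def,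
    Measure.restrict_apply₀ hA', Set.inter_eq_left.2 hAB, smul_eq_mul, mul_one_div]

lemma aemeasurable_charFun {A : Set (Cn n)} (hA : NullMeasurableSet A volume) :
    AEMeasurable (charFun A) volume :=
  aemeasurable_const.indicator₀ hA

lemma norm_charFun_le (A : Set (Cn n)) (z : Cn n) : ‖charFun A z‖ ≤ 1 := by
  unfold charFun
  refine (norm_indicator_le_norm_self _ _).trans ?_
  simp

theorem restrictedInequality_of_mem_blochSpace [NeZero n] {b : Cn n → ℂ}
    (hb : b ∈ blochSpace n) : RestrictedInequality b := by
  obtain ⟨C, hC, h⟩ := exists_volume_levelSet_le hb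
  obtain ⟨M, hM⟩ := exists_hasBlochBound hb
  refine ⟨C, hC, fun A hA hAB => ⟨hM.integrableOn.mono_set hAB, fun t ht => ?_⟩⟩
  have := h (charFun A) (aemeasurable_charFun hA) ⟨1, norm_charFun_le A⟩ t (by linarith)
  rwa [integral_charFun_posLog hA hAB ht] at this

/-! ### Mean values and weak type bounds of holomorphic functions -/

/-- The complex homothety with centre `c` and factor `ζ`; for `|ζ| = 1` it is a rotation. -/
noncomputable def rotateAbout (c : Cn n) (ζ : ℂ) (w : Cn n) : Cn n := c + ζ • (w - c)

lemma measurePreserving_rotateAbout (c : Cn n) {ζ : ℂ} (hζ : ‖ζ‖ = 1) :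
    MeasurePreserving (rotateAbout c ζ) volume volume := by
  have h0 : ζ ≠ 0 := by rintro rfl; simp at hζ
  let f : Cn n ≃ₗᵢ[ℝ] Cn n :=
    { toLinearEquiv := (LinearEquiv.smulOfNeZero ℂ (Cn n) ζ h0).restrictScalars ℝ
      norm_map' := fun x => by
        change ‖ζ • x‖ = ‖x‖
        rw [norm_smul, hζ, one_mul] }
  have hf : MeasurePreserving (fun x : Cn n => ζ • x) volume volume :=
    LinearIsometryEquiv.measurePreserving f
  exact (measurePreserving_add_left volume c).comp
    (hf.comp (measurePreserving_sub_right volume c))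

/-- The mean value property of holomorphic functions on an open set that is balanced about `c`: the
integral is invariant under rotations about `c`, and averaging the integrand over the rotations
gives its value at `c`. -/
lemma setIntegral_eq_of_balanced {A : Set (Cn n)} {c : Cn n} (hA : IsOpen A)
    (hbal : ∀ w ∈ A, ∀ ζ : ℂ, ‖ζ‖ ≤ 1 → rotateAbout c ζ w ∈ A)
    {g : Cn n → ℂ} (hg : DifferentiableOn ℂ g A) (hint : IntegrableOn g A) :
    ∫ w in A, g w = volume.real A • g c := by
  have hrot : ∀ θ : ℝ, ‖circleMap 0 1 θ‖ = 1 := fun θ => by simp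
  have hpre : ∀ θ : ℝ, rotateAbout c (circleMap 0 1 θ) ⁻¹' A = A := by
    intro θ
    ext w
    refine ⟨fun hw => ?_, fun hw => hbal w hw _ (hrot θ).le⟩
    have h0 : circleMap 0 1 θ ≠ 0 := by
      intro h; have := hrot θ; rw [h] at this; simp at this
    have := hbal _ hw (circleMap 0 1 θ)⁻¹ (by rw [norm_inv, hrot, inv_one])
    rw [rotateAbout, rotateAbout, add_sub_cancel_left, smul_smul, inv_mul_cancel₀ h0, one_smul,
      add_sub_cancel] at this
    exact this
  have hcont : Continuous fun p : ℝ × Cn n => rotateAbout c (circleMap 0 1 p.1) p.2 := by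
    unfold rotateAbout
    have : Continuous fun p : ℝ × Cn n => circleMap 0 1 p.1 :=
      (continuous_circleMap 0 1).comp continuous_fst
    fun_prop
  have hmp : ∀ θ : ℝ, MeasurePreserving (rotateAbout c (circleMap 0 1 θ))
      (volume.restrict A) (volume.restrict A) := by
    intro θ
    have := (measurePreserving_rotateAbout c (hrot θ)).restrict_preimage hA.measurableSet
    rwa [hpre θ] at this
  have hrotint : ∀ θ : ℝ, IntegrableOn (fun w => g (rotateAbout c (circleMap 0 1 θ) w)) A := by
    intro θ
    exact (hmp θ).integrable_comp_of_integrable hint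
  have hmean : ∀ w ∈ A, Real.circleAverage (fun ζ => g (rotateAbout c ζ w)) 0 1 = g c := by
    intro w hw
    have hd : DiffContOnCl ℂ (fun ζ => g (rotateAbout c ζ w)) (Metric.ball 0 |1|) := by
      refine DifferentiableOn.diffContOnCl fun ζ hζ => ?_
      rw [abs_one, closure_ball _ one_ne_zero, mem_closedBall_zero_iff] at hζ
      have h1 : DifferentiableAt ℂ g (rotateAbout c ζ w) :=
        hg.differentiableAt (hA.mem_nhds (hbal w hw ζ hζ))
      have h2 : DifferentiableAt ℂ (fun ζ => rotateAbout c ζ w) ζ := by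
        unfold rotateAbout; fun_prop
      exact (h1.comp ζ h2).differentiableWithinAt
    rw [hd.circleAverage]
    simp [rotateAbout]
  have hprod : Integrable (Function.uncurry fun (θ : ℝ) (w : Cn n) =>
      g (rotateAbout c (circleMap 0 1 θ) w))
      ((volume.restrict (Set.Ioc 0 (2 * Real.pi))).prod (volume.restrict A)) := by
    have hmeas : AEStronglyMeasurable (Function.uncurry fun (θ : ℝ) (w : Cn n) =>
        g (rotateAbout c (circleMap 0 1 θ) w))
        ((volume.restrict (Set.Ioc 0 (2 * Real.pi))).prod (volume.restrict A)) := by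
      rw [Measure.prod_restrict]
      refine ContinuousOn.aestronglyMeasurable ?_ (measurableSet_Ioc.prod hA.measurableSet)
      refine hg.continuousOn.comp hcont.continuousOn ?_
      rintro ⟨θ, w⟩ ⟨-, hw⟩
      exact hbal w hw _ (hrot θ).le
    rw [integrable_prod_iff hmeas]
    refine ⟨Filter.Eventually.of_forall hrotint, ?_⟩
    have : ∀ θ : ℝ, ∫ w in A, ‖g (rotateAbout c (circleMap 0 1 θ) w)‖ = ∫ w in A, ‖g w‖ := by
      intro θ
      have h := integral_map (hmp θ).measurable.aemeasurable (f := fun w => ‖g w‖)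
        (by rw [(hmp θ).map_eq]; exact hint.norm.aestronglyMeasurable)
      rw [(hmp θ).map_eq] at h
      exact h.symm
    simp only [Function.uncurry, this]
    exact integrableOn_const (by rw [Real.volume_Ioc]; exact ENNReal.ofReal_ne_top)
  have hpi : (2 * Real.pi) ≠ 0 := by positivity
  have h1 : ∀ θ : ℝ, ∫ w in A, g (rotateAbout c (circleMap 0 1 θ) w) = ∫ w in A, g w := by
    intro θ
    have h := integral_map (hmp θ).measurable.aemeasurable (f := g)
      (by rw [(hmp θ).map_eq]; exact hint.aestronglyMeasurable)
    rw [(hmp θ).map_eq] at h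
    exact h.symm
  calc ∫ w in A, g w = (2 * Real.pi)⁻¹ • ∫ θ in Set.Ioc 0 (2 * Real.pi),
        ∫ w in A, g (rotateAbout c (circleMap 0 1 θ) w) := by
        simp only [h1]
        rw [setIntegral_const, measureReal_def, Real.volume_Ioc, sub_zero,
          ENNReal.toReal_ofReal (by positivity), smul_smul, inv_mul_cancel₀ hpi, one_smul]
    _ = (2 * Real.pi)⁻¹ • ∫ w in A, ∫ θ in Set.Ioc 0 (2 * Real.pi),
        g (rotateAbout c (circleMap 0 1 θ) w) := by rw [integral_integral_swap hprod]
    _ = ∫ w in A, g c := by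
        rw [← integral_smul]
        refine setIntegral_congr_fun hA.measurableSet fun w hw => ?_
        have := hmean w hw
        rw [Real.circleAverage_def, intervalIntegral.integral_of_le (by positivity)] at this
        exact this
    _ = _ := setIntegral_const _

/-- A weak type bound for large heights makes a holomorphic function on the unit ball bounded on the
half ball. At a maximum point `u₀` of `‖g x‖ (3/4 - ‖x‖) ^ d`, the mean value property on the ball
of radius `(3/4 - ‖u₀‖) / 2` shows that `‖g‖` exceeds `‖g u₀‖ / 2` on a fixed proportion of it. -/
lemma exists_bound_of_weak_type (n : ℕ) [NeZero n] (C t₀ : ℝ) (hC : 0 ≤ C) (ht₀ : 0 < t₀) :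
    ∃ K : ℝ, 0 < K ∧ ∀ g : Cn n → ℂ, DifferentiableOn ℂ g (unitBall n) →
      (∀ t : ℝ, t₀ < t → volume {u | u ∈ unitBall n ∧ t < ‖g u‖} ≤ ENNReal.ofReal (C / t)) →
      ∀ u : Cn n, ‖u‖ ≤ 1 / 2 → ‖g u‖ ≤ K := by
  set d := Module.finrank ℝ (Cn n) with hd
  have hd0 : d ≠ 0 := by
    have : Nontrivial (Cn n) := inferInstance
    exact Module.finrank_pos.ne'
  set v : ℝ := volume.real (Metric.ball (0 : Cn n) 1) with hv
  have hv0 : 0 < v := ENNReal.toReal_pos (Metric.measure_ball_pos _ _ one_pos).ne'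
    measure_ball_lt_top.ne
  set K₀ : ℝ := 2 * t₀ + 2 ^ (2 * d + 2) * C / v with hK₀
  have hK₀0 : 0 < K₀ := by positivity
  refine ⟨4 ^ d * K₀, by positivity, fun g hg hweak u hu => ?_⟩
  have hsub : Metric.closedBall (0 : Cn n) (3 / 4) ⊆ unitBall n := by
    intro x hx
    rw [mem_closedBall_zero_iff] at hx
    exact mem_unitBall.2 (by linarith)
  have hgc : ContinuousOn g (unitBall n) := hg.continuousOn
  obtain ⟨u₀, hu₀, hmax⟩ := (isCompact_closedBall (0 : Cn n) (3 / 4)).exists_isMaxOn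
    ⟨0, by simp; norm_num⟩ (f := fun x => ‖g x‖ * (3 / 4 - ‖x‖) ^ d)
    ((hgc.mono hsub).norm.mul (by fun_prop))
  have hmax' : ∀ x : Cn n, ‖x‖ ≤ 3 / 4 →
      ‖g x‖ * (3 / 4 - ‖x‖) ^ d ≤ ‖g u₀‖ * (3 / 4 - ‖u₀‖) ^ d := fun x hx =>
    hmax (mem_closedBall_zero_iff.2 hx)
  rw [mem_closedBall_zero_iff] at hu₀
  set A := ‖g u₀‖ with hA
  set δ := 3 / 4 - ‖u₀‖ with hδ
  have hδ0 : 0 ≤ δ := by linarith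
  have hδ1 : δ ≤ 1 := by linarith [norm_nonneg u₀]
  have hA0 : 0 ≤ A := norm_nonneg _
  have main : A * δ ^ d ≤ K₀ := by
    rcases hδ0.eq_or_lt with h0 | hδpos
    · rw [← h0, zero_pow hd0, mul_zero]; exact hK₀0.le
    rcases le_or_gt A (2 * t₀) with hAt | hAt
    · have : δ ^ d ≤ 1 := pow_le_one₀ hδ0 hδ1
      have : 0 ≤ 2 ^ (2 * d + 2) * C / v := by positivity
      nlinarith
    have hApos : 0 < A := by linarith
    set B := Metric.ball u₀ (δ / 2) with hB
    have hBn : ∀ x ∈ B, ‖x‖ ≤ 3 / 4 - δ / 2 := by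
      intro x hx
      rw [hB, mem_ball_iff_norm] at hx
      have := norm_le_norm_add_norm_sub' x u₀
      linarith
    have hBsub : B ⊆ unitBall n := fun x hx => mem_unitBall.2 (by linarith [hBn x hx])
    have hgB : ∀ x ∈ B, ‖g x‖ ≤ 2 ^ d * A := by
      intro x hx
      have h1 := hBn x hx
      have h2 := hmax' x (by linarith)
      have h3 : (δ / 2) ^ d ≤ (3 / 4 - ‖x‖) ^ d := by gcongr; linarith
      have h4 : ‖g x‖ * (δ / 2) ^ d ≤ A * δ ^ d :=
        (mul_le_mul_of_nonneg_left h3 (norm_nonneg _)).trans h2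
      rw [div_pow, ← mul_div_assoc, div_le_iff₀ (by positivity)] at h4
      have h5 : 0 < δ ^ d := by positivity
      nlinarith
    set S := B ∩ g ⁻¹' {y | A / 2 < ‖y‖} with hS
    have hSm : MeasurableSet S := ((hgc.mono hBsub).isOpen_inter_preimage Metric.isOpen_ball
      (isOpen_lt continuous_const continuous_norm)).measurableSet
    have hSvol : volume.real S ≤ C / (A / 2) := by
      refine ENNReal.toReal_le_of_le_ofReal (by positivity) (le_trans (measure_mono ?_)
        (hweak (A / 2) (by linarith)))
      exact fun x hx => ⟨hBsub hx.1, hx.2⟩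
    have hBfin : volume B ≠ ⊤ := measure_ball_lt_top.ne
    have hBvol : volume.real B = (δ / 2) ^ d * v := by
      rw [hB, measureReal_def, Measure.addHaar_ball volume u₀ (by positivity), ENNReal.toReal_mul,
        ENNReal.toReal_ofReal (by positivity)]
      rfl
    have hconst : ∀ r : ℝ, Integrable (fun _ : Cn n => r) (volume.restrict B) := fun r =>
      integrableOn_const hBfin
    have hgint : IntegrableOn g B := by
      refine Integrable.mono' (hconst (2 ^ d * A))
        ((hgc.mono hBsub).aestronglyMeasurable measurableSet_ball) ?_
      filter_upwards [ae_restrict_mem measurableSet_ball] with x hx using hgB x hx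
    have hmean : ∫ w in B, g w = volume.real B • g u₀ :=
      setIntegral_eq_of_balanced (c := u₀) Metric.isOpen_ball (fun w hw ζ hζ => by
        rw [mem_ball_iff_norm] at hw ⊢
        rw [rotateAbout, add_sub_cancel_left, norm_smul]
        nlinarith [norm_nonneg (w - u₀), norm_nonneg ζ]) (hg.mono hBsub) hgint
    have h1 : volume.real B * A ≤ A / 2 * volume.real B + 2 ^ d * A * volume.real S := by
      calc volume.real B * A = ‖∫ w in B, g w‖ := by
            rw [hmean, norm_smul, Real.norm_of_nonneg measureReal_nonneg]
        _ ≤ ∫ w in B, ‖g w‖ := norm_integral_le_integral_norm _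
        _ ≤ ∫ w in B, (A / 2 + S.indicator (fun _ => 2 ^ d * A) w) := by
            refine setIntegral_mono_on hgint.norm ?_ measurableSet_ball fun x hx => ?_
            · exact (hconst _).add ((hconst _).indicator hSm)
            · by_cases hxS : A / 2 < ‖g x‖
              · rw [Set.indicator_of_mem (show x ∈ S from ⟨hx, hxS⟩)]
                linarith [hgB x hx]
              · have : 0 ≤ S.indicator (fun _ => 2 ^ d * A) x :=
                  Set.indicator_nonneg (fun _ _ => by positivity) x
                push Not at hxS
                linarith
        _ = _ := by
            rw [integral_add (hconst _) ((hconst _).indicator hSm), setIntegral_const,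
              integral_indicator hSm, setIntegral_const, measureReal_restrict_apply hSm,
              Set.inter_eq_left.2 Set.inter_subset_left]
            simp only [smul_eq_mul]; ring
    have h2 : volume.real B ≤ 2 ^ (d + 1) * (C / (A / 2)) := by
      have h3 : volume.real B * A ≤ 2 ^ (d + 1) * volume.real S * A := by
        rw [pow_succ]; linarith
      exact (le_of_mul_le_mul_right h3 hApos).trans (by gcongr)
    rw [hBvol, div_pow, div_mul_eq_mul_div, div_le_iff₀ (by positivity)] at h2
    have h3 : A * δ ^ d ≤ 2 ^ (2 * d + 2) * C / v := by
      rw [le_div_iff₀ hv0]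
      calc A * δ ^ d * v = A * (δ ^ d * v) := by ring
        _ ≤ A * (2 ^ (d + 1) * (C / (A / 2)) * 2 ^ d) := by gcongr
        _ = 2 ^ (2 * d + 2) * C := by field_simp; ring
    linarith
  have h1 := (hmax' u (by linarith)).trans main
  have h2 : (1 / 4 : ℝ) ^ d ≤ (3 / 4 - ‖u‖) ^ d := by gcongr; linarith
  have h3 := (mul_le_mul_of_nonneg_left h2 (norm_nonneg (g u))).trans h1
  rw [one_div, inv_pow, ← div_eq_mul_inv, div_le_iff₀ (by positivity)] at h3
  linarith

/-! ### Polydisks -/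

section

variable [NeZero n]

/-- The polydisc with centre `z` and axes along the basis `e`, of radius `ρ` in the direction of
index `0` and `√ρ` in the others. For an adapted frame it is `polydisk e z ρ`, see
`polydisk_eq_boxAbout`; this description shows that it is balanced about `z`. -/
def boxAbout (e : OrthonormalBasis (Fin n) ℂ (Cn n)) (z : Cn n) (ρ : ℝ) : Set (Cn n) :=
  {w | ‖e.repr (w - z) 0‖ < ρ ∧ ∀ j : Fin n, j ≠ 0 → ‖e.repr (w - z) j‖ < Real.sqrt ρ}

lemma repr_smul_frame_zero (e : OrthonormalBasis (Fin n) ℂ (Cn n)) (a : ℂ) :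
    e.repr (a • e 0) 0 = a := by
  simp [OrthonormalBasis.repr_self]

lemma repr_smul_frame_of_ne (e : OrthonormalBasis (Fin n) ℂ (Cn n)) (a : ℂ) {j : Fin n}
    (hj : j ≠ 0) : e.repr (a • e 0) j = 0 := by
  simp [OrthonormalBasis.repr_self, hj]

lemma repr_zero_eq_norm {e : OrthonormalBasis (Fin n) ℂ (Cn n)} {z : Cn n}
    (hze : z = ((‖z‖ : ℝ) : ℂ) • e 0) : e.repr z 0 = ((‖z‖ : ℝ) : ℂ) := by
  have := repr_smul_frame_zero e ((‖z‖ : ℝ) : ℂ)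
  rwa [← hze] at this

lemma repr_eq_zero_of_ne {e : OrthonormalBasis (Fin n) ℂ (Cn n)} {z : Cn n}
    (hze : z = ((‖z‖ : ℝ) : ℂ) • e 0) {j : Fin n} (hj : j ≠ 0) : e.repr z j = 0 := by
  have := repr_smul_frame_of_ne e ((‖z‖ : ℝ) : ℂ) hj
  rwa [← hze] at this

lemma IsAdaptedFrame.eq_smul {e : Cn n → OrthonormalBasis (Fin n) ℂ (Cn n)}
    (he : IsAdaptedFrame e) {z : Cn n} (hz : z ∈ unitBall n) (hz0 : z ≠ 0) :
    z = ((‖z‖ : ℝ) : ℂ) • e z 0 := by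
  have hpos : 0 < ‖z‖ := norm_pos_iff.2 hz0
  rw [he z hz hz0, smul_smul, ← Complex.ofReal_mul, mul_inv_cancel₀ hpos.ne']
  simp

lemma polydisk_eq_boxAbout {e : Cn n → OrthonormalBasis (Fin n) ℂ (Cn n)}
    (he : IsAdaptedFrame e) {z : Cn n} (hz : z ∈ unitBall n) (hz0 : z ≠ 0) (ρ : ℝ) :
    polydisk e z ρ = boxAbout (e z) z ρ := by
  have hze := he.eq_smul hz hz0
  have h0 := repr_zero_eq_norm hze
  have hrad : ∀ w, ‖radialProj z w - z‖ = ‖(e z).repr (w - z) 0‖ := by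
    intro w
    have h1 : radialProj z w = (e z).repr w 0 • e z 0 := by
      unfold radialProj herm
      rw [← he z hz hz0, (e z).repr_apply_apply]
    have h2 : radialProj z w - z = ((e z).repr (w - z) 0) • e z 0 := by
      rw [h1, map_sub, PiLp.sub_apply, h0, sub_smul, ← hze]
    rw [h2, norm_smul, (e z).norm_eq_one, mul_one]
  ext w
  unfold polydisk boxAbout
  simp only [Set.mem_ofPred_eq, hrad]
  refine and_congr_right fun _ => forall₂_congr fun j hj => ?_
  rw [map_sub, PiLp.sub_apply, repr_eq_zero_of_ne hze hj, sub_zero]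

lemma isOpen_boxAbout (e : OrthonormalBasis (Fin n) ℂ (Cn n)) (z : Cn n) (ρ : ℝ) :
    IsOpen (boxAbout e z ρ) := by
  have h : ∀ j, Continuous fun w => ‖e.repr (w - z) j‖ := by
    intro j
    have : Continuous fun w => e.repr (w - z) :=
      e.repr.continuous.comp (continuous_id.sub continuous_const)
    fun_prop
  have : boxAbout e z ρ = {w | ‖e.repr (w - z) 0‖ < ρ} ∩
      ⋂ j : Fin n, {w | j ≠ 0 → ‖e.repr (w - z) j‖ < Real.sqrt ρ} := by
    ext w; simp [boxAbout]
  rw [this]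
  refine (isOpen_lt (h 0) continuous_const).inter (isOpen_iInter_of_finite fun j => ?_)
  by_cases hj : j = 0
  · simp [hj]
  · simpa [hj] using isOpen_lt (h j) continuous_const

lemma rotateAbout_mem_boxAbout {e : OrthonormalBasis (Fin n) ℂ (Cn n)} {z : Cn n} {ρ : ℝ}
    {w : Cn n} (hw : w ∈ boxAbout e z ρ) {ζ : ℂ} (hζ : ‖ζ‖ ≤ 1) :
    rotateAbout z ζ w ∈ boxAbout e z ρ := by
  have h : ∀ j, ‖e.repr (rotateAbout z ζ w - z) j‖ ≤ ‖e.repr (w - z) j‖ := by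
    intro j
    rw [rotateAbout, add_sub_cancel_left, map_smul, PiLp.smul_apply, norm_smul]
    exact mul_le_of_le_one_left (norm_nonneg _) hζ
  exact ⟨(h 0).trans_lt hw.1, fun j hj => (h j).trans_lt (hw.2 j hj)⟩

/-- The linear map that multiplies the coordinate `0` by `ρ` and the others by `√ρ`, and then reads
them in the basis `e`. It maps the unit polydisc of the standard basis onto `boxAbout e 0 ρ`. -/
noncomputable def stretch (e : OrthonormalBasis (Fin n) ℂ (Cn n)) (ρ : ℝ) : Cn n →ₗ[ℂ] Cn n where
  toFun u := e.repr.symm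
    (WithLp.toLp 2 fun j => ((if j = 0 then ρ else Real.sqrt ρ : ℝ) : ℂ) * u j)
  map_add' u v := by
    rw [← map_add]; congr 1; ext j; simp [mul_add]
  map_smul' c u := by
    rw [RingHom.id_apply, ← map_smul]; congr 1; ext j; simp; ring

lemma repr_stretch (e : OrthonormalBasis (Fin n) ℂ (Cn n)) (ρ : ℝ) (u : Cn n) (j : Fin n) :
    e.repr (stretch e ρ u) j = ((if j = 0 then ρ else Real.sqrt ρ : ℝ) : ℂ) * u j := by
  simp [stretch]

lemma image_stretch_eq (e : OrthonormalBasis (Fin n) ℂ (Cn n)) {ρ : ℝ} (hρ : 0 < ρ) :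
    stretch e ρ '' {u : Cn n | ‖u 0‖ < 1 ∧ ∀ j : Fin n, j ≠ 0 → ‖u j‖ < 1} =
      {w : Cn n | ‖e.repr w 0‖ < ρ ∧ ∀ j : Fin n, j ≠ 0 → ‖e.repr w j‖ < Real.sqrt ρ} := by
  have hs : 0 < Real.sqrt ρ := Real.sqrt_pos.2 hρ
  have hsc : ∀ j : Fin n, 0 < (if j = 0 then ρ else Real.sqrt ρ) := by
    intro j; split_ifs <;> assumption
  have hn : ∀ u j, ‖e.repr (stretch e ρ u) j‖ = (if j = 0 then ρ else Real.sqrt ρ) * ‖u j‖ := by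
    intro u j
    rw [repr_stretch, norm_mul, Complex.norm_real, Real.norm_of_nonneg (hsc j).le]
  ext w
  constructor
  · rintro ⟨u, ⟨h0, hj⟩, rfl⟩
    refine ⟨?_, fun j hj' => ?_⟩
    · rw [hn, if_pos rfl]; nlinarith
    · rw [hn, if_neg hj']; have := hj j hj'; nlinarith
  · rintro ⟨h0, hj⟩
    set u : Cn n := WithLp.toLp 2 fun j =>
      (((if j = 0 then ρ else Real.sqrt ρ : ℝ) : ℂ))⁻¹ * e.repr w j with hu
    have hw : stretch e ρ u = w := by
      apply e.repr.injective
      ext j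
      rw [repr_stretch, hu]
      have := (hsc j).ne'
      simp only
      rw [← mul_assoc, mul_inv_cancel₀ (by exact_mod_cast this), one_mul]
    refine ⟨u, ⟨?_, fun j hj' => ?_⟩, hw⟩
    · have := hn u 0
      rw [hw, if_pos rfl] at this
      nlinarith
    · have := hn u j
      rw [hw, if_neg hj'] at this
      have := hj j hj'
      nlinarith

/-- `stretch e ρ` multiplies volumes by `ρ ^ (n + 1)`. The factor is found on the unit polydisc,
whose image is known, rather than by computing a determinant. -/
lemma volume_image_stretch (e : OrthonormalBasis (Fin n) ℂ (Cn n)) {ρ : ℝ} (hρ : 0 < ρ)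
    (S : Set (Cn n)) : volume (stretch e ρ '' S) = ENNReal.ofReal (ρ ^ (n + 1)) * volume S := by
  obtain ⟨κ, hκ, hvol⟩ := exists_volume_polydisc n
  set Λ : Cn n →ₗ[ℝ] Cn n := (stretch e ρ).restrictScalars ℝ with hΛ
  have h1 : ∀ S : Set (Cn n), volume (stretch e ρ '' S) =
      ENNReal.ofReal |LinearMap.det Λ| * volume S := fun S =>
    Measure.addHaar_image_linearMap volume Λ S
  have hP := h1 {u : Cn n | ‖u 0‖ < 1 ∧ ∀ j : Fin n, j ≠ 0 → ‖u j‖ < 1}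
  rw [image_stretch_eq e hρ] at hP
  have h2 := hvol e 0 ρ (Real.sqrt ρ) hρ.le (Real.sqrt_nonneg _)
  have h3 := hvol (EuclideanSpace.basisFun (Fin n) ℂ) 0 1 1 zero_le_one zero_le_one
  simp only [sub_zero, EuclideanSpace.basisFun_repr] at h2 h3
  rw [h2, h3, ← ENNReal.ofReal_mul (abs_nonneg _), Real.sq_sqrt hρ.le,
    ENNReal.ofReal_eq_ofReal_iff (by positivity) (by positivity)] at hP
  have h4 : |LinearMap.det Λ| = ρ ^ (n + 1) := by
    have h5 : ρ ^ (n + 1) = ρ ^ 2 * ρ ^ (n - 1) := by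
      rw [← pow_add]; congr 1
      have := NeZero.ne n
      omega
    have h6 : κ * |LinearMap.det Λ| = κ * ρ ^ (n + 1) := by
      rw [h5]; simp only [one_pow, mul_one] at hP; linarith
    exact mul_left_cancel₀ hκ.ne' h6
  rw [h1, h4]

/-- The rescaled form of `exists_bound_of_weak_type`: the bound `K` depends neither on the box nor
on its size. -/
lemma exists_bound_of_weak_type_boxAbout (n : ℕ) [NeZero n] (C t₀ : ℝ) (hC : 0 ≤ C)
    (ht₀ : 0 < t₀) : ∃ K : ℝ, 0 < K ∧ ∀ (e : OrthonormalBasis (Fin n) ℂ (Cn n)) (z : Cn n) (ρ : ℝ),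
      0 < ρ → ρ ≤ 1 → ∀ g : Cn n → ℂ, DifferentiableOn ℂ g (boxAbout e z ρ) →
      (∀ t : ℝ, t₀ < t → volume {w | w ∈ boxAbout e z ρ ∧ t < ‖g w‖} ≤
        ENNReal.ofReal (C / t * ρ ^ (n + 1))) →
      ∀ v : Cn n, ‖v‖ ≤ ρ / 2 → ‖g (z + v)‖ ≤ K := by
  obtain ⟨K, hK, hbound⟩ := exists_bound_of_weak_type n C t₀ hC ht₀
  refine ⟨K, hK, fun e z ρ hρ hρ1 g hg hweak v hv => ?_⟩
  have hs : 0 < Real.sqrt ρ := Real.sqrt_pos.2 hρ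
  have hρs : ρ ≤ Real.sqrt ρ := by
    refine Real.le_sqrt_of_sq_le ?_
    nlinarith
  have hsc : ∀ j : Fin n, ρ ≤ (if j = 0 then ρ else Real.sqrt ρ) := by
    intro j; split_ifs
    · exact le_rfl
    · exact hρs
  set L : Cn n → Cn n := fun u => z + stretch e ρ u with hL
  have hmem : ∀ u ∈ unitBall n, L u ∈ boxAbout e z ρ := by
    intro u hu
    have hu1 := mem_unitBall.1 hu
    have hn : ∀ j, ‖e.repr (L u - z) j‖ = (if j = 0 then ρ else Real.sqrt ρ) * ‖u j‖ := by
      intro j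
      rw [hL]; simp only
      rw [add_sub_cancel_left, repr_stretch, norm_mul, Complex.norm_real,
        Real.norm_of_nonneg (hρ.le.trans (hsc j))]
    have hj : ∀ j, ‖u j‖ < 1 := fun j => (PiLp.norm_apply_le u j).trans_lt hu1
    refine ⟨?_, fun j hj' => ?_⟩
    · rw [hn, if_pos rfl]; have := hj 0; nlinarith
    · rw [hn, if_neg hj']; have := hj j; nlinarith
  have hLd : Differentiable ℂ L := by
    have : Differentiable ℂ (stretch e ρ) :=
      (LinearMap.toContinuousLinearMap (stretch e ρ)).differentiable
    exact this.const_add z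
  have hGd : DifferentiableOn ℂ (g ∘ L) (unitBall n) := hg.comp hLd.differentiableOn hmem
  have hGw : ∀ t : ℝ, t₀ < t → volume {u | u ∈ unitBall n ∧ t < ‖(g ∘ L) u‖} ≤
      ENNReal.ofReal (C / t) := by
    intro t ht
    set S := {u | u ∈ unitBall n ∧ t < ‖(g ∘ L) u‖} with hS
    have h1 : (fun w => z + w) '' (stretch e ρ '' S) ⊆ {w | w ∈ boxAbout e z ρ ∧ t < ‖g w‖} := by
      rintro _ ⟨_, ⟨u, hu, rfl⟩, rfl⟩
      exact ⟨hmem u hu.1, hu.2⟩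
    have h2 := (measure_mono h1).trans (hweak t ht)
    rw [Set.image_add_left, measure_preimage_add, volume_image_stretch e hρ, mul_comm (C / t),
      ENNReal.ofReal_mul (by positivity)] at h2
    exact (ENNReal.mul_le_mul_iff_right (by simpa using by positivity)
      ENNReal.ofReal_ne_top).1 h2
  set u : Cn n := WithLp.toLp 2 fun j =>
    (((if j = 0 then ρ else Real.sqrt ρ : ℝ) : ℂ))⁻¹ * e.repr v j with hu
  have huv : stretch e ρ u = v := by
    apply e.repr.injective
    ext j
    rw [repr_stretch, hu]
    have := (hρ.trans_le (hsc j)).ne'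
    simp only
    rw [← mul_assoc, mul_inv_cancel₀ (by exact_mod_cast this), one_mul]
  have hun : ‖u‖ ≤ 1 / 2 := by
    have h1 : ‖u‖ ≤ ρ⁻¹ * ‖v‖ := by
      refine le_of_sq_le_sq ?_ (by positivity)
      rw [EuclideanSpace.norm_sq_eq, mul_pow, ← e.repr.norm_map v, EuclideanSpace.norm_sq_eq,
        Finset.mul_sum]
      refine Finset.sum_le_sum fun j _ => ?_
      rw [hu]; simp only
      rw [norm_mul, mul_pow, norm_inv, Complex.norm_real,
        Real.norm_of_nonneg (hρ.le.trans (hsc j))]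
      have := hsc j
      gcongr
    refine h1.trans ?_
    rw [inv_mul_le_iff₀ hρ]; linarith
  have := hbound (g ∘ L) hGd hGw u hun
  simpa [hL, huv] using this

end

/-! ### From the polydisk inequality to the Bloch space -/

lemma tanh_pos {r : ℝ} (hr : 0 < r) : 0 < Real.tanh r := by
  rw [Real.tanh_eq_sinh_div_cosh]
  exact div_pos (Real.sinh_pos_iff.2 hr) (Real.cosh_pos r)

lemma hatRadius_le {r : ℝ} (hr : Real.tanh r ≤ 1 / 16) (hr0 : 0 ≤ Real.tanh r) {z : Cn n}
    (hz : ‖z‖ < 1) : hatRadius r z ≤ 3 * Real.tanh r * (1 - ‖z‖ ^ 2) := by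
  have hz2 : ‖z‖ ^ 2 < 1 := by nlinarith [norm_nonneg z]
  unfold hatRadius
  set R := Real.tanh r
  have hR2 : R ^ 2 ≤ 1 / 256 := by nlinarith
  have h1 : 255 / 256 ≤ 1 - R ^ 2 * ‖z‖ ^ 2 := by nlinarith [sq_nonneg R, sq_nonneg ‖z‖]
  have h2 : (1 - ‖z‖ ^ 2) / (1 - R ^ 2 * ‖z‖ ^ 2) ≤ 3 / 2 * (1 - ‖z‖ ^ 2) := by
    rw [div_le_iff₀ (by linarith)]
    nlinarith
  nlinarith

lemma hatRadius_pos {r : ℝ} (hr : 0 < r) {z : Cn n} (hz : ‖z‖ < 1) : 0 < hatRadius r z := by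
  have hz2 : ‖z‖ ^ 2 < 1 := by nlinarith [norm_nonneg z]
  have hR : 0 < Real.tanh r := tanh_pos hr
  have hR1 : Real.tanh r ^ 2 < 1 := by nlinarith [Real.tanh_lt_one r]
  have h1 : 0 < 1 - Real.tanh r ^ 2 * ‖z‖ ^ 2 := by nlinarith [sq_nonneg ‖z‖]
  unfold hatRadius
  have : 0 < 1 - ‖z‖ ^ 2 := by linarith
  positivity

lemma one_sub_norm_sq_le_hatRadius {r : ℝ} (hr : 0 < r) {z : Cn n} (hz : ‖z‖ < 1) :
    1 - ‖z‖ ^ 2 ≤ hatRadius r z / (2 * Real.tanh r) := by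
  have hz2 : ‖z‖ ^ 2 < 1 := by nlinarith [norm_nonneg z]
  have hR : 0 < Real.tanh r := tanh_pos hr
  have hR1 : Real.tanh r ^ 2 < 1 := by nlinarith [Real.tanh_lt_one r]
  have h1 : 0 < 1 - Real.tanh r ^ 2 * ‖z‖ ^ 2 := by nlinarith [sq_nonneg ‖z‖]
  unfold hatRadius
  rw [mul_div_cancel_left₀ _ (by positivity), le_div_iff₀ h1]
  have : 0 ≤ Real.tanh r ^ 2 * ‖z‖ ^ 2 := by positivity
  nlinarith

section

variable [NeZero n]

lemma exists_volume_boxAbout (n : ℕ) [NeZero n] : ∃ κ : ℝ, 0 < κ ∧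
    ∀ (e : OrthonormalBasis (Fin n) ℂ (Cn n)) (z : Cn n) (ρ : ℝ), 0 ≤ ρ →
      volume.real (boxAbout e z ρ) = κ * ρ ^ (n + 1) := by
  obtain ⟨κ, hκ, hvol⟩ := exists_volume_polydisc n
  refine ⟨κ, hκ, fun e z ρ hρ => ?_⟩
  have h1 := hvol e 0 ρ (Real.sqrt ρ) hρ (Real.sqrt_nonneg _)
  have h2 : boxAbout e z ρ = (fun w => w + -z) ⁻¹'
      {w : Cn n | ‖e.repr w 0 - 0‖ < ρ ∧ ∀ j : Fin n, j ≠ 0 → ‖e.repr w j‖ < Real.sqrt ρ} := by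
    ext w
    simp only [boxAbout, Set.mem_ofPred_eq, Set.mem_preimage, sub_zero, ← sub_eq_add_neg]
  have h3 : ρ ^ (n + 1) = ρ ^ 2 * ρ ^ (n - 1) := by
    rw [← pow_add]; congr 1
    have := NeZero.ne n
    omega
  rw [measureReal_def, h2, measure_preimage_add_right, h1, Real.sq_sqrt hρ,
    ENNReal.toReal_ofReal (by positivity), h3, mul_assoc]

/-- A closed polydisc whose radius is at most `3 / (16 n)` times `1 - ‖z‖ ^ 2` lies in the open unit
ball. -/
lemma norm_lt_one_of_norm_repr_le {e : OrthonormalBasis (Fin n) ℂ (Cn n)} {z w : Cn n} {ρ : ℝ}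
    (hze : z = ((‖z‖ : ℝ) : ℂ) • e 0) (hz : ‖z‖ < 1) (hρ : 0 ≤ ρ)
    (hnρ : n * ρ ≤ 3 / 16 * (1 - ‖z‖ ^ 2)) (h0 : ‖e.repr (w - z) 0‖ ≤ ρ)
    (hj : ∀ j : Fin n, j ≠ 0 → ‖e.repr (w - z) j‖ ≤ Real.sqrt ρ) : ‖w‖ < 1 := by
  have hn : (1 : ℝ) ≤ n := by exact_mod_cast NeZero.one_le
  have hsq : ‖w‖ ^ 2 ≤ ((‖z‖ + ρ) ^ 2 - ρ) + n * ρ := by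
    rw [← e.repr.norm_map w, EuclideanSpace.norm_sq_eq]
    calc ∑ j, ‖e.repr w j‖ ^ 2
        ≤ ∑ j : Fin n, ((if j = 0 then (‖z‖ + ρ) ^ 2 - ρ else 0) + ρ) := by
          refine Finset.sum_le_sum fun j _ => ?_
          by_cases hj0 : j = 0
          · subst hj0
            rw [if_pos rfl, sub_add_cancel]
            refine pow_le_pow_left₀ (norm_nonneg _) ?_ 2
            have : e.repr w 0 = ((‖z‖ : ℝ) : ℂ) + e.repr (w - z) 0 := by
              rw [map_sub, PiLp.sub_apply, repr_zero_eq_norm hze]; ring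
            rw [this]
            refine (norm_add_le _ _).trans ?_
            rw [Complex.norm_real, norm_norm]
            linarith
          · rw [if_neg hj0, zero_add]
            have h := hj j hj0
            rw [map_sub, PiLp.sub_apply, repr_eq_zero_of_ne hze hj0, sub_zero] at h
            calc ‖e.repr w j‖ ^ 2 ≤ Real.sqrt ρ ^ 2 := pow_le_pow_left₀ (norm_nonneg _) h 2
              _ = ρ := Real.sq_sqrt hρ
      _ = _ := by
          rw [Finset.sum_add_distrib, Finset.sum_ite_eq' Finset.univ (0 : Fin n)]
          simp
  have hz0' := norm_nonneg z
  have hρn : ρ ≤ n * ρ := le_mul_of_one_le_left hρ hn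
  have hz2 : ‖z‖ ^ 2 < 1 := by nlinarith
  have : ‖w‖ ^ 2 < 1 := by nlinarith [mul_nonneg hρ hz0']
  nlinarith [norm_nonneg w]

/-- For small `r`, namely `tanh r = 1 / (16 n)`, the closures of all polydisks lie in the ball. -/
lemma exists_polydisk_subset (e : Cn n → OrthonormalBasis (Fin n) ℂ (Cn n))
    (he : IsAdaptedFrame e) : ∃ r : ℝ, 0 < r ∧ ∀ z ∈ unitBall n, z ≠ 0 →
      IsOpen (polydisk e z (hatRadius r z)) ∧
      closure (polydisk e z (hatRadius r z)) ⊆ unitBall n := by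
  have hn : (1 : ℝ) ≤ n := by exact_mod_cast NeZero.one_le
  have hmem : (1 / (16 * n) : ℝ) ∈ Set.Ioo (0 : ℝ) 1 := by
    constructor
    · positivity
    · rw [div_lt_one (by positivity)]; linarith
  have htanh : Real.tanh (Real.artanh (1 / (16 * n))) = 1 / (16 * n) :=
    Real.tanh_artanh ⟨by linarith [hmem.1], hmem.2⟩
  set r := Real.artanh (1 / (16 * n)) with hr
  have hr0 : 0 < r := Real.artanh_pos hmem
  refine ⟨r, hr0, fun z hz hz0 => ?_⟩
  have hz1 := mem_unitBall.1 hz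
  rw [polydisk_eq_boxAbout he hz hz0]
  refine ⟨isOpen_boxAbout _ _ _, fun w hw => ?_⟩
  have hc : ∀ j, Continuous fun w => ‖(e z).repr (w - z) j‖ := by
    intro j
    have : Continuous fun w => (e z).repr (w - z) :=
      (e z).repr.continuous.comp (continuous_id.sub continuous_const)
    fun_prop
  have hclosed : ∀ (j : Fin n) (s : ℝ), (∀ w ∈ boxAbout (e z) z (hatRadius r z),
      ‖(e z).repr (w - z) j‖ ≤ s) → ‖(e z).repr (w - z) j‖ ≤ s := fun j s h =>
    closure_minimal h (isClosed_le (hc j) continuous_const) hw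
  have h16 : (1 / (16 * n) : ℝ) ≤ 1 / 16 := by
    apply one_div_le_one_div_of_le <;> linarith
  have hle := hatRadius_le (r := r) (by rw [htanh]; exact h16) (by rw [htanh]; exact hmem.1.le) hz1
  rw [htanh] at hle
  refine mem_unitBall.2 (norm_lt_one_of_norm_repr_le (he.eq_smul hz hz0) hz1
    (hatRadius_pos hr0 hz1).le ?_ (hclosed 0 _ fun w hw => hw.1.le)
    fun j hj => hclosed j _ fun w hw => (hw.2 j hj).le)
  calc n * hatRadius r z ≤ n * (3 * (1 / (16 * n)) * (1 - ‖z‖ ^ 2)) := by gcongr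
    _ = 3 / 16 * (1 - ‖z‖ ^ 2) := by field_simp

theorem polydiskInequality_of_lLogLInequality {e : Cn n → OrthonormalBasis (Fin n) ℂ (Cn n)}
    (he : IsAdaptedFrame e) {b : Cn n → ℂ} (h : LLogLInequality b) : PolydiskInequality e b := by
  obtain ⟨C, hC, h⟩ := h
  obtain ⟨r, hr, hE⟩ := exists_polydisk_subset e he
  refine ⟨C, r, hC, hr, fun z hz hz0 => subset_closure.trans (hE z hz hz0).2,
    fun z hz hz0 t ht => ?_⟩
  obtain ⟨hopen, hcl⟩ := hE z hz hz0
  set E := polydisk e z (hatRadius r z)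
  have hsupp : tsupport (charFun E) ⊆ closure E :=
    closure_mono (Function.support_subset_iff'.2 fun w hw => Set.indicator_of_notMem hw _)
  have hcomp : HasCompactSupport (charFun E) :=
    (isCompact_closedBall (0 : Cn n) 1).of_isClosed_subset (isClosed_tsupport _)
      ((hsupp.trans hcl).trans Metric.ball_subset_closedBall)
  have hnull := hopen.measurableSet.nullMeasurableSet (μ := volume)
  have := h (charFun E) (aemeasurable_charFun hnull) ⟨1, norm_charFun_le E⟩ hcomp
    (hsupp.trans hcl) t (by linarith)
  rwa [integral_charFun_posLog hnull (subset_closure.trans hcl) ht] at this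

theorem polydiskInequality_of_restrictedInequality
    {e : Cn n → OrthonormalBasis (Fin n) ℂ (Cn n)} (he : IsAdaptedFrame e) {b : Cn n → ℂ}
    (h : RestrictedInequality b) : PolydiskInequality e b := by
  obtain ⟨C, hC, h⟩ := h
  obtain ⟨r, hr, hE⟩ := exists_polydisk_subset e he
  have hsub : ∀ z ∈ unitBall n, z ≠ 0 → polydisk e z (hatRadius r z) ⊆ unitBall n :=
    fun z hz hz0 => subset_closure.trans (hE z hz hz0).2
  exact ⟨C, r, hC, hr, hsub, fun z hz hz0 => (h _
    (hE z hz hz0).1.measurableSet.nullMeasurableSet (hsub z hz hz0)).2⟩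

end

/-- The Bergman projection of `conj g` cut off to a balanced set: up to conjugation the integrand
`g u / (1 - ⟨u, w⟩) ^ (n + 1)` is holomorphic in `u`, so the mean value property evaluates it. -/
lemma bergmanProj_conj_mul_charFun {g : Cn n → ℂ} (hg : HolOnBall g) {A : Set (Cn n)}
    (hA : IsOpen A) (hAB : A ⊆ unitBall n) {c : Cn n}
    (hbal : ∀ w ∈ A, ∀ ζ : ℂ, ‖ζ‖ ≤ 1 → rotateAbout c ζ w ∈ A) (hint : IntegrableOn g A)
    {w : Cn n} (hw : w ∈ unitBall n) :
    bergmanProj (fun u => conjFun g u * charFun A u) w = ((n.factorial : ℂ) / (Real.pi : ℂ) ^ n) *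
      (volume.real A * conjFun g c / (1 - herm w c) ^ (n + 1)) := by
  set h : Cn n → ℂ := fun u => g u / (1 - herm u w) ^ (n + 1) with hh
  have hstar : ∀ u, star (h u) = conjFun g u / (1 - herm w u) ^ (n + 1) := by
    intro u
    rw [hh]
    simp only [conjFun, herm, star_div₀, star_pow, star_sub, star_one]
    congr 3
    exact inner_conj_symm _ _
  have hhd : DifferentiableOn ℂ h A := by
    have hherm : Differentiable ℂ fun u : Cn n => herm u w := (innerSL ℂ w).differentiable
    have hinv : DifferentiableOn ℂ (fun u => (1 - herm u w) ^ (n + 1))⁻¹ A :=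
      ((hherm.const_sub 1).pow _).differentiableOn.inv fun u hu =>
        pow_ne_zero _ (one_sub_herm_ne_zero (hAB hu) hw)
    exact (DifferentiableOn.mono hg hAB).mul hinv
  have hint' : IntegrableOn (conjFun g) A :=
    (Complex.conjCLE : ℂ →L[ℝ] ℂ).integrable_comp hint
  have hhint : IntegrableOn h A := by
    have h1 := (integrable_div_kernel_iff hA.measurableSet hAB hw).2 hint'
    have h2 := (Complex.conjCLE : ℂ →L[ℝ] ℂ).integrable_comp h1
    refine h2.congr (Filter.Eventually.of_forall fun u => ?_)
    simp only [← hstar]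
    exact star_star (h u)
  have hmean := setIntegral_eq_of_balanced hA hbal hhd hhint
  unfold bergmanProj
  congr 1
  have h1 : ∀ u, conjFun g u * charFun A u / (1 - herm w u) ^ (n + 1) =
      A.indicator (fun u => star (h u)) u := by
    intro u
    unfold charFun
    by_cases hu : u ∈ A
    · rw [Set.indicator_of_mem hu, Set.indicator_of_mem hu, hstar, mul_one]
    · rw [Set.indicator_of_notMem hu, Set.indicator_of_notMem hu]; simp
  simp only [h1]
  rw [setIntegral_indicator hA.measurableSet, Set.inter_eq_right.2 hAB]
  have h2 : ∫ u in A, star (h u) = star (∫ u in A, h u) := integral_conj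
  rw [h2, hmean, star_smul, hstar, Complex.real_smul]
  simp [mul_div_assoc]

/-- The commutator of the characteristic function of a balanced set, in closed form up to one
constant `κ`. If `b` is integrable on `A` then `κ = b c`. If not, the Bochner integral that defines
`P (conj b * 1_A)` has the value `0` at every point, and the formula holds with `κ = 0`. -/
lemma exists_bergmanCommutator_charFun_eq {b : Cn n → ℂ} (hb : HolOnBall b) {A : Set (Cn n)}
    (hA : IsOpen A) (hAB : A ⊆ unitBall n) {c : Cn n}
    (hbal : ∀ w ∈ A, ∀ ζ : ℂ, ‖ζ‖ ≤ 1 → rotateAbout c ζ w ∈ A) :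
    ∃ κ : ℂ, ∀ w ∈ unitBall n, bergmanCommutator (conjFun b) (charFun A) w =
      ((n.factorial : ℂ) / (Real.pi : ℂ) ^ n) *
        (volume.real A * star (b w - κ) / (1 - herm w c) ^ (n + 1)) := by
  have hfin : volume A ≠ ⊤ := ((measure_mono hAB).trans_lt volume_unitBall_lt_top).ne
  have hone : ∀ w ∈ unitBall n, bergmanProj (charFun A) w =
      ((n.factorial : ℂ) / (Real.pi : ℂ) ^ n) *
        (volume.real A / (1 - herm w c) ^ (n + 1)) := by
    intro w hw
    have := bergmanProj_conj_mul_charFun (g := fun _ => 1) (differentiableOn_const 1) hA hAB hbal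
      (integrableOn_const hfin) hw
    simpa [conjFun] using this
  by_cases hint : IntegrableOn b A
  · refine ⟨b c, fun w hw => ?_⟩
    unfold bergmanCommutator
    rw [hone w hw, bergmanProj_conj_mul_charFun hb hA hAB hbal hint hw, star_sub]
    unfold conjFun
    ring
  · refine ⟨0, fun w hw => ?_⟩
    have hzero : bergmanProj (fun u => conjFun b u * charFun A u) w = 0 := by
      unfold bergmanProj
      rw [integral_undef, mul_zero]
      intro hI
      refine hint ?_
      have h1 : IntegrableOn (fun u => conjFun b u / (1 - herm w u) ^ (n + 1)) A := by
        have h2 : IntegrableOn (fun u => conjFun b u * charFun A u / (1 - herm w u) ^ (n + 1)) A :=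
          IntegrableOn.mono_set hI hAB
        refine h2.congr_fun (fun u hu => ?_) hA.measurableSet
        simp [charFun, Set.indicator_of_mem hu]
      have h3 := (integrable_div_kernel_iff hA.measurableSet hAB hw).1 h1
      have h4 := (Complex.conjCLE : ℂ →L[ℝ] ℂ).integrable_comp h3
      refine h4.congr (Filter.Eventually.of_forall fun u => ?_)
      exact star_star (b u)
    unfold bergmanCommutator
    rw [hone w hw, hzero, sub_zero, sub_zero]
    unfold conjFun
    ring

/-- Cauchy's estimate, applied in each coordinate direction on a disc of radius `ρ / 2`. -/
lemma norm_holGrad_le {b : Cn n → ℂ} (hb : HolOnBall b) {z : Cn n} {ρ K : ℝ} (hρ : 0 < ρ)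
    (hz : ‖z‖ + ρ ≤ 1) (hK : ∀ v : Cn n, ‖v‖ ≤ ρ / 2 → ‖b (z + v) - b z‖ ≤ K) :
    ‖holGrad b z‖ ≤ n * (2 * K / ρ) := by
  have hK0 : 0 ≤ K := (norm_nonneg _).trans (hK 0 (by simpa using by positivity))
  have hzB : z ∈ unitBall n := mem_unitBall.2 (by linarith)
  have hcoord : ∀ j : Fin n, ‖fderiv ℂ b z (EuclideanSpace.single j 1)‖ ≤ 2 * K / ρ := by
    intro j
    set v : Cn n := EuclideanSpace.single j 1 with hv
    have hvn : ‖v‖ = 1 := by simp [hv]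
    set f : ℂ → ℂ := fun ζ => b (z + ζ • v) - b z with hf
    have hL : ∀ ζ : ℂ, HasDerivAt (fun ζ : ℂ => z + ζ • v) v ζ := by
      intro ζ
      simpa using ((hasDerivAt_id ζ).smul_const v).const_add z
    have hsub : ∀ ζ ∈ Metric.ball (0 : ℂ) ρ, z + ζ • v ∈ unitBall n := by
      intro ζ hζ
      rw [mem_ball_zero_iff] at hζ
      refine mem_unitBall.2 ((norm_add_le _ _).trans_lt ?_)
      rw [norm_smul, hvn, mul_one]; linarith
    have hd : DifferentiableOn ℂ f (Metric.ball 0 ρ) := fun ζ hζ =>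
      (((hb.differentiableAt (hsub ζ hζ)).comp ζ
        (hL ζ).differentiableAt).sub_const _).differentiableWithinAt
    have h1 := Complex.norm_deriv_le_of_forall_mem_sphere_norm_le (f := f) (c := 0) (R := ρ / 2)
      (C := K) (by positivity)
      (hd.diffContOnCl_ball (Metric.closedBall_subset_ball (by linarith))) (fun ζ hζ => by
        refine hK _ ?_
        rw [norm_smul, hvn, mul_one]
        exact (mem_sphere_zero_iff_norm.1 hζ).le)
    have h2 : HasDerivAt f (fderiv ℂ b z v) 0 := by
      have h3 : HasFDerivAt b (fderiv ℂ b z) (z + (0 : ℂ) • v) := by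
        simpa using (hb.differentiableAt hzB).hasFDerivAt
      exact (h3.comp_hasDerivAt 0 (hL 0)).sub_const _
    rw [h2.deriv] at h1
    refine h1.trans (le_of_eq ?_)
    field_simp
  refine le_of_sq_le_sq ?_ (by positivity)
  rw [EuclideanSpace.norm_sq_eq]
  calc ∑ j, ‖(holGrad b z) j‖ ^ 2 ≤ ∑ _j : Fin n, (2 * K / ρ) ^ 2 :=
        Finset.sum_le_sum fun j _ => pow_le_pow_left₀ (norm_nonneg _) (hcoord j) 2
    _ = n * (2 * K / ρ) ^ 2 := by simp
    _ ≤ (n * (2 * K / ρ)) ^ 2 := by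
        rw [mul_pow]
        gcongr
        have : (n : ℝ) ≤ (n : ℝ) ^ 2 := by
          exact_mod_cast Nat.le_self_pow two_ne_zero n
        exact this

/-- On `E = polydisk e z ρ` with `ρ = hatRadius r z` the kernel `(1 - ⟨w, z⟩) ^ (-(n + 1))` is at
least a multiple of `1 / |E|`, so by `exists_bergmanCommutator_charFun_eq` the hypothesis is a weak
type bound for `b - κ` on `E`. It bounds the oscillation of `b` near `z`, and Cauchy's estimate
turns this into the Bloch bound at `z`. -/
theorem mem_blochSpace_of_polydiskInequality [NeZero n]
    {e : Cn n → OrthonormalBasis (Fin n) ℂ (Cn n)} (he : IsAdaptedFrame e) {b : Cn n → ℂ}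
    (hb : HolOnBall b) (h : PolydiskInequality e b) : b ∈ blochSpace n := by
  obtain ⟨C, r, hC, hr, hsub, hweak⟩ := h
  obtain ⟨κ, hκ, hvol⟩ := exists_volume_boxAbout n
  have hR : 0 < Real.tanh r := tanh_pos hr
  set R := Real.tanh r with hRdef
  set A : ℝ := 1 + 1 / (2 * R) with hA
  have hA0 : 0 < A := by positivity
  set c : ℝ := (n.factorial / Real.pi ^ n) * (κ / A ^ (n + 1)) with hc
  have hc0 : 0 < c := by
    have := Real.pi_pos
    have := n.factorial_pos
    positivity
  obtain ⟨K, hK, hbound⟩ := exists_bound_of_weak_type_boxAbout n (C * κ / c) (1 / c)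
    (by positivity) (by positivity)
  have hmain : ∀ z ∈ unitBall n, z ≠ 0 → ‖holGrad b z‖ * (1 - ‖z‖) ≤ n * (4 * K) / (2 * R) := by
    intro z hz hz0
    have hz1 := mem_unitBall.1 hz
    have hze := he.eq_smul hz hz0
    set ρ := hatRadius r z with hρdef
    have hρ : 0 < ρ := hatRadius_pos hr hz1
    have hE := polydisk_eq_boxAbout he hz hz0 ρ
    have hEB := hsub z hz hz0
    have hw := hweak z hz hz0
    rw [← hρdef, hE] at hEB hw
    -- otherwise the polydisk contains the boundary point `z / ‖z‖`
    have hρ1 : ρ ≤ 1 - ‖z‖ := by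
      by_contra! hlt
      have h1 : e z 0 ∈ boxAbout (e z) z ρ := by
        have h2 : e z 0 - z = ((1 - ‖z‖ : ℝ) : ℂ) • e z 0 := by
          conv_lhs => rw [hze]
          push_cast
          rw [sub_smul, one_smul]
          congr 2
          rw [← hze]
        unfold boxAbout
        rw [Set.mem_ofPred_eq, h2]
        refine ⟨?_, fun j hj => ?_⟩
        · rw [repr_smul_frame_zero, Complex.norm_real, Real.norm_of_nonneg (by linarith)]
          exact hlt
        · rw [repr_smul_frame_of_ne _ _ hj, norm_zero]
          exact Real.sqrt_pos.2 hρ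
      have h3 := mem_unitBall.1 (hEB h1)
      rw [(e z).norm_eq_one] at h3
      exact lt_irrefl _ h3
    have hδ : 1 - ‖z‖ ^ 2 ≤ ρ / (2 * R) := one_sub_norm_sq_le_hatRadius hr hz1
    obtain ⟨m, hm⟩ := exists_bergmanCommutator_charFun_eq hb (isOpen_boxAbout (e z) z ρ) hEB
      (fun w hw ζ hζ => rotateAbout_mem_boxAbout hw hζ)
    have hq : ∀ w ∈ boxAbout (e z) z ρ, qdist w z ≤ A * ρ := by
      intro w hw
      have h0 := repr_zero_eq_norm hze
      have h1 : qdist z w = ‖1 - ((‖z‖ : ℝ) : ℂ) * (e z).repr w 0‖ := by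
        have := qdist_smul_frame (e z) ‖z‖ w 0
        rwa [← hze] at this
      have h2 : 1 - ((‖z‖ : ℝ) : ℂ) * (e z).repr w 0 =
          ((1 - ‖z‖ ^ 2 : ℝ) : ℂ) - ((‖z‖ : ℝ) : ℂ) * (e z).repr (w - z) 0 := by
        rw [map_sub, PiLp.sub_apply, h0]; push_cast; ring
      rw [qdist_comm, h1, h2]
      refine (norm_sub_le _ _).trans ?_
      rw [norm_mul, Complex.norm_real, Complex.norm_real, norm_norm,
        Real.norm_of_nonneg (by nlinarith [norm_nonneg z])]
      have h3 := hw.1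
      have h4 : ‖z‖ * ‖(e z).repr (w - z) 0‖ ≤ ρ := by
        nlinarith [norm_nonneg z, norm_nonneg ((e z).repr (w - z) 0)]
      have h5 : A * ρ = ρ + ρ / (2 * R) := by rw [hA]; ring
      linarith
    have hlow : ∀ w ∈ boxAbout (e z) z ρ,
        c * ‖b w - m‖ ≤ ‖bergmanCommutator (conjFun b) (charFun (boxAbout (e z) z ρ)) w‖ := by
      intro w hw
      have hwB := hEB hw
      have hqpos : 0 < qdist w z := qdist_pos (mem_unitBall.1 hwB) hz1.le
      rw [hm w hwB, norm_mul, norm_div, norm_div, norm_mul, norm_star, norm_pow, norm_pow,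
        Complex.norm_real, Complex.norm_real, Complex.norm_natCast,
        Real.norm_of_nonneg Real.pi_pos.le, Real.norm_of_nonneg measureReal_nonneg,
        hvol (e z) z ρ hρ.le, hc, mul_assoc]
      have := Real.pi_pos
      gcongr
      change κ / A ^ (n + 1) * ‖b w - m‖ ≤ κ * ρ ^ (n + 1) * ‖b w - m‖ / qdist w z ^ (n + 1)
      rw [le_div_iff₀ (by positivity)]
      calc κ / A ^ (n + 1) * ‖b w - m‖ * qdist w z ^ (n + 1)
          ≤ κ / A ^ (n + 1) * ‖b w - m‖ * (A * ρ) ^ (n + 1) := by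
            gcongr
            exact hq w hw
        _ = κ * ρ ^ (n + 1) * ‖b w - m‖ := by rw [mul_pow]; field_simp
    have hb1 := hbound (e z) z ρ hρ (by linarith [norm_nonneg z]) (fun w => b w - m)
      ((DifferentiableOn.mono hb hEB).sub_const m) (fun t ht => by
        have ht0 : 0 < t := lt_trans (by positivity) ht
        have hct : 1 < c * t := by rwa [div_lt_iff₀' hc0] at ht
        refine (measure_mono ?_).trans ((hw (c * t) hct).trans (ENNReal.ofReal_le_ofReal ?_))
        · rintro w ⟨hwE, hwt⟩
          exact ⟨hEB hwE, (mul_lt_mul_of_pos_left hwt hc0).trans_le (hlow w hwE)⟩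
        · rw [hvol (e z) z ρ hρ.le]
          refine le_of_eq ?_
          field_simp)
    -- `m` is unknown, and drops out of the difference
    have hosc : ∀ v : Cn n, ‖v‖ ≤ ρ / 2 → ‖b (z + v) - b z‖ ≤ 2 * K := by
      intro v hv
      have h1 := hb1 v hv
      have h2 := hb1 0 (by simpa using by positivity)
      rw [add_zero] at h2
      have h3 : b (z + v) - b z = (b (z + v) - m) - (b z - m) := by ring
      rw [h3]
      exact (norm_sub_le _ _).trans (by linarith)
    have hg := norm_holGrad_le hb hρ (by linarith) hosc
    have h1 : 1 - ‖z‖ ≤ ρ / (2 * R) := by nlinarith [norm_nonneg z]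
    calc ‖holGrad b z‖ * (1 - ‖z‖) ≤ n * (2 * (2 * K) / ρ) * (ρ / (2 * R)) := by
          gcongr
      _ = n * (4 * K) / (2 * R) := by field_simp; ring
  -- at the centre no polydisk is available, and none is needed for a single point
  refine ⟨hb, max (n * (4 * K) / (2 * R)) ‖holGrad b 0‖, ?_⟩
  rintro _ ⟨z, hz, rfl⟩
  by_cases hz0 : z = 0
  · subst hz0
    simp
  · exact (hmain z hz hz0).trans (le_max_left _ _)

end BergmanBloch

theorem theoremD (n : ℕ) [NeZero n]
    (e : BergmanBloch.Cn n → OrthonormalBasis (Fin n) ℂ (BergmanBloch.Cn n))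
    (he : BergmanBloch.IsAdaptedFrame e)
    (b : BergmanBloch.Cn n → ℂ) (hb : BergmanBloch.HolOnBall b) :
    List.TFAE [
      b ∈ BergmanBloch.blochSpace n,
      BergmanBloch.LLogLInequality b,
      BergmanBloch.RestrictedInequality b,
      BergmanBloch.PolydiskInequality e b] := by
  tfae_have 1 → 2 := BergmanBloch.lLogLInequality_of_mem_blochSpace
  tfae_have 1 → 3 := BergmanBloch.restrictedInequality_of_mem_blochSpace
  tfae_have 2 → 4 := BergmanBloch.polydiskInequality_of_lLogLInequality he
  tfae_have 3 → 4 := BergmanBloch.polydiskInequality_of_restrictedInequality he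
  tfae_have 4 → 1 := BergmanBloch.mem_blochSpace_of_polydiskInequality he hb
  tfae_finish
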